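/- **Notation.** Let $\mathbb{F}_q$ be a finite field, $C$ a smooth projective geometrically irreducible curve over $\mathbb{F}_q$ with function field $Q$, $\infty\in C$ a closed point, and $A=\Gamma(C\setminus\{\infty\},\mathcal{O}_C)$. Let $K$ be a field which is complete with respect to a non-trivial non-archimedean absolute value $|\cdot|\colon K\to\mathbb{R}_{\ge0}$, let $R=\{x\in K:|x|\le1\}$ with maximal ideal $\mathfrak{m}_R$, let $\gamma\colon A\hookrightarrow R$ be an injective ring homomorphism, and assume that $\epsilon:=\gamma^{-1}(\mathfrak{m}_R)$ is a maximal ideal of $A$. Put $\mathbb{F}_\epsilon=A/\epsilon$ and $\hat q=\#\mathbb{F}_\epsilon$. Let $z\in\mathcal{O}_{C,\epsilon}$ be a uniformizing parameter at $\epsilon$ and $\zeta=\gamma(z)\in R$ its image. The completion of $\mathcal{O}_{C,\epsilon}$ is identified with $A_\epsilon=\mathbb{F}_\epsilon[[z]]$, and $Q_\epsilon=\operatorname{Frac}(A_\epsilon)$. Regard $\mathbb{F}_\epsilon$ as a subfield of $R$ through the unique ring homomorphism $\mathbb{F}_\epsilon\to R$ which lifts the embedding $\mathbb{F}_\epsilon\hookrightarrow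 R/\mathfrak{m}_R$ induced by $\gamma$. Let $K^{\rm sep}$ be a separable closure of $K$ and $G=\operatorname{Gal}(K^{\rm sep}/K)$ with the Krull topology. On $R[[z]]$, $R((z)):=R[[z]][\tfrac1z]$, $K^{\rm sep}[[z]]$ and $K^{\rm sep}((z))$ let $\hat\sigma$ be the ring endomorphism with $\hat\sigma(z)=z$ which raises coefficients to their $\hat q$-th power. For an $R[[z]]$-module $\hat M$ put $\hat\sigma^*\hat M=\hat M\otimes_{R[[z]],\hat\sigma}R[[z]]$, and write $\hat M[\tfrac1{z-\zeta}]$ and $\hat M[\tfrac1z]$ for its base changes to $R[[z]][\tfrac1{z-\zeta}]$ and $R((z))$. **Local shtukas.** A *local shtuka* over $R$ is a pair $\underline{\hat M}=(\hat M,\tau_{\hat M})$ of a finite free $R[[z]]$-module $\hat M$ and an isomorphism $\tau_{\hat M}\colon\hat\sigma^*\hat M[\tfrac1{z-\zeta}]\to\hat M[\tfrac1{z-\zeta}]$ of $R[[z]][\tfrac1{z-\zeta}]$-modules. A *morphism* $\underline{\hat M}\to\underline{\hat M}'$ is an $R[[z]]$-linear map $f\colon\hat M\to\hat M'$, and a *quasi-morphism*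 is an $R((z))$-linear map $f\colon\hat M[\tfrac1z]\to\hat M'[\tfrac1z]$, such that $\tau_{\hat M'}\circ\hat\sigma^*f=f\circ\tau_{\hat M}$ (for quasi-morphisms this is an equation between maps $\hat\sigma^*\hat M[\tfrac1z][\tfrac1{z-\zeta}]\to\hat M'[\tfrac1z][\tfrac1{z-\zeta}]$). **Tate modules.** As $z-\zeta$ is a unit in $K^{\rm sep}[[z]]$, one can define the (dual) Tate module and the rational (dual) Tate module of $\underline{\hat M}$ as $$\check T_\epsilon\underline{\hat M}=\{m\in\hat M\otimes_{R[[z]]}K^{\rm sep}[[z]]:\tau_{\hat M}(\hat\sigma^*m)=m\},\qquad \check V_\epsilon\underline{\hat M}=\{m\in\hat M\otimes_{R[[z]]}K^{\rm sep}((z)):\tau_{\hat M}(\hat\sigma^*m)=m\},$$ where $\hat\sigma^*m=m\otimes1$. These are an $A_\epsilon$-module and a $Q_\epsilon$-vector space, on which $G$ acts linearly through the coefficients of $K^{\rm sep}[[z]]$ and $K^{\rm sep}((z))$. Let $\operatorname{Rep}_{A_\epsilon}G$ be the category of representations of $G$ on finite free $A_\epsilon$-modules which are continuous (for every $n\ge0$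 the set of all $g\in G$ which act trivially modulo $z^n$ is open), and $\operatorname{Rep}_{Q_\epsilon}G$ the category of representations of $G$ on finite dimensional $Q_\epsilon$-vector spaces which are continuous for the $z$-adic topology. The morphisms are the $G$-equivariant linear maps. **Theorem.** Assume that $R$ is discretely valued. Then $\underline{\hat M}\mapsto\check T_\epsilon\underline{\hat M}$ is a fully faithful functor from the category of local shtukas over $R$ to $\operatorname{Rep}_{A_\epsilon}G$, and $\underline{\hat M}\mapsto\check V_\epsilon\underline{\hat M}$ is a fully faithful functor from the category of local shtukas over $R$ with quasi-morphisms to $\operatorname{Rep}_{Q_\epsilon}G$. (In particular, both functors do take values in the stated categories.) -/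

import Mathlib

open CategoryTheory IsLocalRing Topology Filter
open scoped PowerSeries LaurentSeries TensorProduct

namespace LocSht
universe v

noncomputable section

/-! ### Base change along a ring homomorphism -/
section BaseChange

variable {B C D : Type*} [CommRing B] [CommRing C] [CommRing D]

/-- The base change `C ⊗_{B,g} M` of a `B`-module `M` along a ring homomorphism `g : B → C`. -/
def BaseChange (g : B →+* C) (M : Type*) [AddCommGroup M] [Module B M] : Type _ :=
  letI := g.toAlgebra
  C ⊗[B] M

variable {M M' M'' N : Type*} [AddCommGroup M] [Module B M] [AddCommGroup M'] [Module B M']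
  [AddCommGroup M''] [Module B M''] [AddCommGroup N] [Module D N]
  {P : Type*} [AddCommGroup P] [Module C P]

namespace BaseChange

instance (g : B →+* C) : AddCommGroup (BaseChange g M) :=
  letI := g.toAlgebra
  (inferInstance : AddCommGroup (C ⊗[B] M))

instance (g : B →+* C) : Module C (BaseChange g M) :=
  letI := g.toAlgebra
  (inferInstance : Module C (C ⊗[B] M))

/-- The canonical `g`-semilinear map `M → C ⊗_{B,g} M`, `m ↦ 1 ⊗ m`. -/
def mk (g : B →+* C) : M →ₛₗ[g] BaseChange g M :=
  letI := g.toAlgebra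
  { toFun := fun m => ((1 : C) ⊗ₜ[B] m : C ⊗[B] M)
    map_add' := fun a b => TensorProduct.tmul_add _ _ _
    map_smul' := fun b m => by
      change ((1 : C) ⊗ₜ[B] (b • m) : C ⊗[B] M) = (g b) • ((1 : C) ⊗ₜ[B] m : C ⊗[B] M)
      rw [← TensorProduct.smul_tmul, TensorProduct.smul_tmul', Algebra.smul_def, smul_eq_mul]
      rfl }

theorem hom_ext {g : B →+* C} {s : C →+* D} {φ ψ : BaseChange g M →ₛₗ[s] N}
    (h : ∀ m, φ (mk g m) = ψ (mk g m)) (x : BaseChange g M) : φ x = ψ x := by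
  letI := g.toAlgebra
  induction x using (TensorProduct.induction_on (R := B) (M := C) (N := M)) with
  | zero => exact (map_zero φ).trans (map_zero ψ).symm
  | tmul c m =>
    have : (c ⊗ₜ[B] m : C ⊗[B] M) = c • (mk g m : BaseChange g M) := by
      change (c ⊗ₜ[B] m : C ⊗[B] M) = c • ((1 : C) ⊗ₜ[B] m : C ⊗[B] M)
      rw [TensorProduct.smul_tmul', smul_eq_mul, mul_one]
    erw [this, map_smulₛₗ, map_smulₛₗ, h]
  | add x y hx hy =>
    exact (map_add φ _ _).trans ((congrArg₂ (· + ·) hx hy).trans (map_add ψ _ _).symm)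

/-- The `s`-semilinear extension `c ⊗ m ↦ s(c) φ(m)` of an `s ∘ g`-semilinear map `φ`. -/
def lift {g : B →+* C} (s : C →+* D) (φ : M →ₛₗ[s.comp g] N) : BaseChange g M →ₛₗ[s] N :=
  letI := g.toAlgebra
  letI : Module C N := Module.compHom N s
  letI : Module B N := Module.compHom N (s.comp g)
  haveI : IsScalarTower B C N := ⟨fun b c n => by
    change s (g b * c) • n = s (g b) • s c • n
    rw [map_mul, mul_smul]⟩
  let φ' : M →ₗ[B] N := { toFun := φ, map_add' := φ.map_add, map_smul' := φ.map_smulₛₗ }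
  let ψ : C ⊗[B] M →ₗ[C] N := TensorProduct.AlgebraTensorModule.lift
    ((LinearMap.lsmul C (M →ₗ[B] N)).flip φ' )
  { toFun := ψ, map_add' := ψ.map_add, map_smul' := fun c x => ψ.map_smul c x }

theorem lift_mk {g : B →+* C} (s : C →+* D) (φ : M →ₛₗ[s.comp g] N) (m : M) :
    lift s φ (mk g m) = φ m := by
  change s 1 • φ m = φ m
  rw [map_one, one_smul]

/-- The canonical map `C ⊗_B M → D ⊗_B M`, `c ⊗ m ↦ h(c) ⊗ m`, for `h : C → D` over `B`. -/
def along {g : B →+* C} {g' : B →+* D} (h : C →+* D) (hg : h.comp g = g') :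
    BaseChange g M →ₛₗ[h] BaseChange g' M :=
  lift h
    { toFun := mk g'
      map_add' := (mk g').map_add
      map_smul' := fun b m => by rw [hg]; exact (mk g').map_smulₛₗ b m }

theorem along_mk {g : B →+* C} {g' : B →+* D} (h : C →+* D) (hg : h.comp g = g') (m : M) :
    along h hg (mk g m) = mk g' m := lift_mk _ _ m

theorem along_along {C' : Type*} [CommRing C'] {g : B →+* C} {g' : B →+* D} {g'' : B →+* C'}
    (h : C →+* D) (h' : D →+* C') (h'' : C →+* C') (hh : h'.comp h = h'') (hg : h.comp g = g')
    (hg' : h'.comp g' = g'') (hg'' : h''.comp g = g'') (x : BaseChange g M) :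
    along h' hg' (along h hg x) = along h'' hg'' x := by
  subst hh
  let φ : BaseChange g M →ₛₗ[h'.comp h] BaseChange g'' M :=
    { toFun := fun x => along h' hg' (along h hg x)
      map_add' := fun a b => by simp only [map_add]
      map_smul' := fun c x => by rw [map_smulₛₗ, map_smulₛₗ]; rfl }
  refine hom_ext (φ := φ) (ψ := along _ hg'') (fun m => ?_) x
  change along h' hg' (along h hg (mk g m)) = _
  rw [along_mk, along_mk, along_mk]

theorem along_id {g : B →+* C} (h : C →+* C) (hg : h.comp g = g) (hid : h = RingHom.id C)
    (x : BaseChange g M) : along h hg x = x := by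
  subst hid
  exact hom_ext (φ := along (RingHom.id C) hg) (ψ := LinearMap.id) (fun m => along_mk _ _ _) x

/-- `id_C ⊗ f`. -/
def map (g : B →+* C) (f : M →ₗ[B] M') : BaseChange g M →ₗ[C] BaseChange g M' :=
  lift (RingHom.id C)
    { toFun := fun m => mk g (f m)
      map_add' := fun a b => by rw [map_add, map_add]
      map_smul' := fun b m => by rw [map_smul]; exact (mk g).map_smulₛₗ b (f m) }

theorem map_mk (g : B →+* C) (f : M →ₗ[B] M') (m : M) : map g f (mk g m) = mk g (f m) :=
  lift_mk _ _ m

theorem map_along {g : B →+* C} {g' : B →+* D} (h : C →+* D) (hg : h.comp g = g')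
    (f : M →ₗ[B] M') (x : BaseChange g M) :
    map g' f (along h hg x) = along h hg (map g f x) :=
  hom_ext (φ := (map g' f).comp (along h hg)) (ψ := (along h hg).comp (map g f)) (fun m => by
    rw [LinearMap.comp_apply, LinearMap.comp_apply, along_mk, map_mk, map_mk, along_mk]) x

/-- The base change `D ⊗_B M → D ⊗_B M'` along `h : C → D` of a `C`-linear map
`C ⊗_B M → C ⊗_B M'`. -/
def extend {g : B →+* C} {g' : B →+* D} (h : C →+* D) (hg : h.comp g = g')
    (f : BaseChange g M →ₗ[C] BaseChange g M') : BaseChange g' M →ₗ[D] BaseChange g' M' :=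
  lift (RingHom.id D)
    { toFun := fun m => along h hg (f (mk g m))
      map_add' := fun a b => by rw [map_add, map_add, map_add]
      map_smul' := fun b m => by
        rw [map_smulₛₗ, map_smul, map_smulₛₗ]
        exact congrArg (· • _) (DFunLike.congr_fun hg b) }

theorem extend_mk {g : B →+* C} {g' : B →+* D} (h : C →+* D) (hg : h.comp g = g')
    (f : BaseChange g M →ₗ[C] BaseChange g M') (m : M) :
    extend h hg f (mk g' m) = along h hg (f (mk g m)) := lift_mk _ _ m

theorem linear_ext {g : B →+* C} {f₁ f₂ : BaseChange g M →ₗ[C] P}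
    (h : ∀ m, f₁ (mk g m) = f₂ (mk g m)) : f₁ = f₂ :=
  LinearMap.ext (hom_ext h)

theorem map_id (g : B →+* C) : map g (LinearMap.id : M →ₗ[B] M) = LinearMap.id :=
  linear_ext fun m => by rw [map_mk]; rfl

theorem map_comp (g : B →+* C) (f' : M' →ₗ[B] M'') (f : M →ₗ[B] M') :
    map g (f' ∘ₗ f) = map g f' ∘ₗ map g f :=
  linear_ext fun m => by rw [LinearMap.comp_apply, map_mk, map_mk, map_mk]; rfl

theorem extend_along {g : B →+* C} {g' : B →+* D} (h : C →+* D) (hg : h.comp g = g')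
    (f : BaseChange g M →ₗ[C] BaseChange g M') (x : BaseChange g M) :
    extend h hg f (along h hg x) = along h hg (f x) := by
  have := hom_ext (φ := ((extend h hg f).comp (along h hg) : BaseChange g M →ₛₗ[h] _))
    (ψ := ((along h hg).comp f : BaseChange g M →ₛₗ[h] _)) (fun m => by
      rw [LinearMap.comp_apply, LinearMap.comp_apply, along_mk, extend_mk]) x
  exact this

theorem extend_id {g : B →+* C} {g' : B →+* D} (h : C →+* D) (hg : h.comp g = g') :
    extend h hg (LinearMap.id : BaseChange g M →ₗ[C] _) = LinearMap.id :=
  linear_ext fun m => by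
    rw [extend_mk, LinearMap.id_apply, LinearMap.id_apply, along_mk]

theorem extend_comp {g : B →+* C} {g' : B →+* D} (h : C →+* D) (hg : h.comp g = g')
    (f' : BaseChange g M' →ₗ[C] BaseChange g M'') (f : BaseChange g M →ₗ[C] BaseChange g M') :
    extend h hg (f' ∘ₗ f) = extend h hg f' ∘ₗ extend h hg f :=
  linear_ext fun m => by
    rw [LinearMap.comp_apply, extend_mk, extend_mk, extend_along]; rfl

end BaseChange
end BaseChange

/-! ### Function fields of curves, closed points, and regular functions -/
section Curve

/-- `Q` is the function field of a smooth projective geometrically irreducible curve `C` over the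
finite field `Fq`: it is finitely generated as a field over `Fq`, of transcendence degree one, and
`Fq` is algebraically closed in `Q`. -/
class IsCurveFunctionField (Fq Q : Type*) [Field Fq] [Field Q] [Algebra Fq Q] : Prop where
  essFiniteType : Algebra.EssFiniteType Fq Q
  trdeg_eq_one : Algebra.trdeg Fq Q = 1
  mem_range_of_isAlgebraic : ∀ x : Q, IsAlgebraic Fq x → x ∈ (algebraMap Fq Q).range

/-- A closed point of the smooth projective curve with function field `Q`, given by its local ring:
a valuation ring of `Q` which contains `Fq` and is not all of `Q`. -/
structure ClosedPoint (Fq Q : Type*) [Field Fq] [Field Q] [Algebra Fq Q] where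
  localRing : ValuationSubring Q
  algebraMap_mem : ∀ c : Fq, algebraMap Fq Q c ∈ localRing
  ne_top : localRing ≠ ⊤

/-- The ring `Γ(C ∖ {P}, 𝒪_C)` of the rational functions which are regular outside the closed
point `P`. -/
def regularAway {Fq Q : Type*} [Field Fq] [Field Q] [Algebra Fq Q] (P : ClosedPoint Fq Q) :
    Subalgebra Fq Q where
  carrier := {f | ∀ P' : ClosedPoint Fq Q, P' ≠ P → f ∈ P'.localRing}
  mul_mem' ha hb P' h := mul_mem (ha P' h) (hb P' h)
  add_mem' ha hb P' h := add_mem (ha P' h) (hb P' h)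
  algebraMap_mem' c P' _ := P'.algebraMap_mem c

/-- The residue rings of `A` modulo proper nonzero ideals are finite. -/
theorem finite_quotient {Fq Q : Type*} [Field Fq] [Finite Fq] [Field Q] [Algebra Fq Q]
    [hQ : IsCurveFunctionField Fq Q] (A : Subalgebra Fq Q) (I : Ideal A) (hI : I ≠ ⊤)
    (hI0 : I ≠ ⊥) : Finite (A ⧸ I) := by
  obtain ⟨a, haI, ha0⟩ := Submodule.exists_mem_ne_zero_of_ne_bot hI0
  -- the element `a` is transcendental over `Fq`
  have ha : Transcendental Fq (a : Q) := by
    intro halg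
    obtain ⟨c, hc⟩ := hQ.mem_range_of_isAlgebraic _ halg
    have hc0 : c ≠ 0 := by
      rintro rfl
      apply ha0
      ext
      rw [← hc, map_zero]
      rfl
    apply hI
    rw [Ideal.eq_top_iff_one]
    have : (1 : A) = algebraMap Fq A c⁻¹ * a := by
      ext
      have : ((algebraMap Fq A c⁻¹ * a : A) : Q) = algebraMap Fq Q c⁻¹ * (a : Q) := rfl
      rw [this, ← hc, ← map_mul, inv_mul_cancel₀ hc0, map_one]
      rfl
    rw [this]
    exact I.mul_mem_left _ haI
  let E := IntermediateField.adjoin Fq {(a : Q)}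
  have hfin : Module.Finite E Q := by
    have h1 := hQ.essFiniteType
    have : AlgebraicIndependent Fq (fun _ : Unit => (a : Q)) :=
      (algebraicIndependent_unique_type_iff (ι := Unit)).mpr ha
    have hb : IsTranscendenceBasis Fq (fun _ : Unit => (a : Q)) := by
      apply this.isTranscendenceBasis_of_lift_trdeg_le_of_finite
      rw [hQ.trdeg_eq_one]; simp
    have h2 : Algebra.IsAlgebraic E Q := by
      have := hb.isAlgebraic_field
      rwa [Set.range_const] at this
    have h3 : Algebra.EssFiniteType E Q := Algebra.EssFiniteType.of_comp Fq E Q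
    exact Algebra.finite_of_essFiniteType_of_isAlgebraic
  -- a family in `A` that is `Fq`-independent modulo `I` is `Fq(a)`-independent in `Q`
  have key : ∀ (ι : Type _) [Fintype ι] (y : ι → A),
      LinearIndependent Fq (fun i => Ideal.Quotient.mkₐ Fq I (y i)) →
      LinearIndependent E (fun i => (y i : Q)) := by
    intro ι _ y hy
    have hdiv : ∀ (n : ℕ) (p : ι → Polynomial Fq),
        ∑ i, Polynomial.aeval a (p i) * y i = 0 → ∀ i, Polynomial.X ^ n ∣ p i := by
      intro n
      induction n with
      | zero => intro p _ i; simp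
      | succ n ih =>
        intro p hp
        have h0 : ∀ i, (p i).coeff 0 = 0 := by
          apply Fintype.linearIndependent_iff.mp hy
          have h := congrArg (Ideal.Quotient.mkₐ Fq I) hp
          rw [map_zero, map_sum] at h
          rw [← h]
          refine Finset.sum_congr rfl fun i _ => ?_
          have haz : Ideal.Quotient.mkₐ Fq I a = 0 := Ideal.Quotient.eq_zero_iff_mem.mpr haI
          rw [map_mul, ← Polynomial.aeval_algHom_apply, haz, ← Polynomial.coeff_zero_eq_aeval_zero']
          exact Algebra.smul_def (A := A ⧸ I) _ _
        choose r hr using fun i => Polynomial.X_dvd_iff.mpr (h0 i)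
        have h1 : ∑ i, Polynomial.aeval a (r i) * y i = 0 := by
          have : a * ∑ i, Polynomial.aeval a (r i) * y i = 0 := by
            rw [← hp, Finset.mul_sum]
            refine Finset.sum_congr rfl fun i _ => ?_
            rw [hr i, map_mul, Polynomial.aeval_X, mul_assoc]
          exact (mul_eq_zero.mp this).resolve_left ha0
        intro i
        rw [hr i, pow_succ']
        exact mul_dvd_mul_left _ (ih r h1 i)
    have hB : LinearIndependent (Algebra.adjoin Fq {(a : Q)}) (fun i => (y i : Q)) := by
      rw [Fintype.linearIndependent_iff]
      intro b hb
      have hex : ∀ i, ∃ p : Polynomial Fq, Polynomial.aeval (a : Q) p = (b i : Q) := by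
        intro i
        have h := Algebra.adjoin_singleton_eq_range_aeval Fq (a : Q)
        exact h.le (b i).2
      choose p hp using hex
      have hsum : ∑ i, Polynomial.aeval a (p i) * y i = 0 := by
        apply Subtype.val_injective
        have hc : ∀ i, ((Polynomial.aeval a (p i) : A) : Q) = Polynomial.aeval (a : Q) (p i) :=
          fun i => (Polynomial.aeval_algHom_apply A.val a (p i)).symm
        rw [ZeroMemClass.coe_zero, ← hb, AddSubmonoidClass.coe_finsetSum]
        refine Finset.sum_congr rfl fun i _ => ?_
        rw [MulMemClass.coe_mul, hc, hp]
        rfl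
      intro i
      have hpi : p i = 0 := by
        by_contra hne
        have := Polynomial.natDegree_le_of_dvd (hdiv ((p i).natDegree + 1) p hsum i) hne
        rw [Polynomial.natDegree_X_pow] at this
        omega
      apply Subtype.val_injective
      rw [← hp i, hpi, map_zero]
      rfl
    open scoped IntermediateField.algebraAdjoinAdjoin in
    exact (LinearIndependent.iff_fractionRing (Algebra.adjoin Fq {(a : Q)}) E).mp hB
  have hrank : Module.rank Fq (A ⧸ I) ≤ (Module.finrank E Q : ℕ) := by
    apply rank_le
    intro s hs
    have h := key s (fun i => Function.surjInv (Ideal.Quotient.mkₐ_surjective Fq I) i) (by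
      simpa only [Function.surjInv_eq] using hs)
    have h' := h.fintype_card_le_finrank
    rwa [Fintype.card_coe] at h'
  have hfree : Module.Free Fq (A ⧸ I) := Module.Free.of_divisionRing Fq (A ⧸ I)
  have : Module.Finite Fq (A ⧸ I) :=
    Module.rank_lt_aleph0_iff.mp (hrank.trans_lt (Cardinal.natCast_lt_aleph0))
  exact Module.finite_of_finite Fq

end Curve

/-! ### The base: the maps `A → R`, the place `ε`, the uniformizer `z` -/
section Datum

/-- The valuation ring `R = {x ∈ K : |x| ≤ 1}`. -/
abbrev IntegerRing (K : Type*) [NontriviallyNormedField K] [IsUltrametricDist K] :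
    ValuationSubring K :=
  (NormedField.valuation (K := K)).valuationSubring

variable (Fq Q K : Type*) [Field Fq] [Finite Fq] [Field Q] [Algebra Fq Q]
  [IsCurveFunctionField Fq Q] [NontriviallyNormedField K] [IsUltrametricDist K]

/-- A closed point `∞` of the curve and an injective ring homomorphism `γ : A → R`, where `A` is the
ring of regular functions outside `∞`, such that `γ⁻¹(𝔪_R)` is a maximal ideal of `A`. -/
structure CharDatum where
  infty : ClosedPoint Fq Q
  γ : regularAway infty →+* IntegerRing K
  γ_injective : Function.Injective γ
  isMaximal_comap : ((maximalIdeal (IntegerRing K)).comap γ).IsMaximal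

variable {Fq Q K}

/-- The `A`-characteristic `ε = γ⁻¹(𝔪_R)`. -/
def CharDatum.ε (𝔇 : CharDatum Fq Q K) : Ideal (regularAway 𝔇.infty) :=
  (maximalIdeal (IntegerRing K)).comap 𝔇.γ

instance (𝔇 : CharDatum Fq Q K) : 𝔇.ε.IsMaximal := 𝔇.isMaximal_comap

instance (𝔇 : CharDatum Fq Q K) : 𝔇.ε.IsPrime := 𝔇.isMaximal_comap.isPrime

/-- The point `∞`, the homomorphism `γ : A → R`, and a uniformizing parameter `z` at `ε`, that is, a
generator of the maximal ideal of the discrete valuation ring `𝒪_{C,ε} = A_{(ε)}`. -/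
structure BaseDatum (Fq Q K : Type*) [Field Fq] [Finite Fq] [Field Q] [Algebra Fq Q]
    [IsCurveFunctionField Fq Q] [NontriviallyNormedField K] [IsUltrametricDist K] where
  toCharDatum : CharDatum Fq Q K
  z : Localization.AtPrime toCharDatum.ε
  z_ne_zero : z ≠ 0
  maximalIdeal_eq_span_z :
    maximalIdeal (Localization.AtPrime toCharDatum.ε) = Ideal.span {z}

namespace BaseDatum

variable (𝔇 : BaseDatum Fq Q K)

/-- The ring `A` of regular functions outside `∞`. -/
abbrev A : Subalgebra Fq Q := regularAway 𝔇.toCharDatum.infty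

/-- The injection `γ : A → R`. -/
abbrev γ : 𝔇.A →+* IntegerRing K := 𝔇.toCharDatum.γ

/-- The maximal ideal `ε` of `A`. -/
abbrev ε : Ideal 𝔇.A := 𝔇.toCharDatum.ε

/-- The residue field `𝔽_ε = A / ε`. -/
def 𝔽ε : Type _ := 𝔇.A ⧸ 𝔇.ε

instance : Field 𝔇.𝔽ε := Ideal.Quotient.field 𝔇.ε

/-- The residue map `A → 𝔽_ε`. -/
def toResidue : 𝔇.A →+* 𝔇.𝔽ε := Ideal.Quotient.mk 𝔇.ε

/-- The number `q̂` of elements of `𝔽_ε`. -/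
def qhat : ℕ := Nat.card 𝔇.𝔽ε

theorem γ_mem_iff (a : 𝔇.A) : a ∈ 𝔇.ε ↔ ‖((𝔇.γ a : IntegerRing K) : K)‖ < 1 := by
  change 𝔇.γ a ∈ maximalIdeal (IntegerRing K) ↔ _
  rw [Valuation.mem_maximalIdeal_iff]
  exact Iff.rfl

theorem isUnit_γ (s : 𝔇.ε.primeCompl) : IsUnit (𝔇.γ s) := by
  by_contra h
  exact s.2 ((mem_maximalIdeal _).mpr h)

/-- The extension of `γ` to the local ring `𝒪_{C,ε}`. -/
def γLoc : Localization.AtPrime 𝔇.ε →+* IntegerRing K :=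
  IsLocalization.lift (M := 𝔇.ε.primeCompl) 𝔇.isUnit_γ

/-- The image `ζ` of `z` in `R`. -/
def ζ : IntegerRing K := 𝔇.γLoc 𝔇.z

theorem exists_z : ∃ a : 𝔇.A, ∃ s : 𝔇.ε.primeCompl, a ∈ 𝔇.ε ∧ a ≠ 0 ∧
    𝔇.z * algebraMap _ _ (s : 𝔇.A) = algebraMap _ _ a := by
  obtain ⟨⟨a, s⟩, h⟩ := IsLocalization.surj 𝔇.ε.primeCompl 𝔇.z
  refine ⟨a, s, ?_, ?_, h⟩
  · have hz : 𝔇.z ∈ maximalIdeal (Localization.AtPrime 𝔇.ε) := by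
      rw [𝔇.maximalIdeal_eq_span_z]
      exact Ideal.mem_span_singleton_self _
    rw [← IsLocalization.AtPrime.to_map_mem_maximal_iff (Localization.AtPrime 𝔇.ε) 𝔇.ε, ← h]
    exact Ideal.mul_mem_right _ _ hz
  · rintro rfl
    rw [map_zero] at h
    exact 𝔇.z_ne_zero (((IsLocalization.map_units (Localization.AtPrime 𝔇.ε) s).mul_left_eq_zero).mp h)

theorem ζ_ne_zero : 𝔇.ζ ≠ 0 := by
  obtain ⟨a, s, _, ha0, h⟩ := 𝔇.exists_z
  intro h0
  have := congrArg 𝔇.γLoc h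
  rw [map_mul, show 𝔇.γLoc 𝔇.z = 0 from h0, zero_mul] at this
  have h1 : 𝔇.γLoc (algebraMap _ _ a) = 𝔇.γ a := IsLocalization.lift_eq _ _
  rw [h1] at this
  exact ha0 (𝔇.toCharDatum.γ_injective (by rw [← this, map_zero]))

instance : Finite 𝔇.𝔽ε := by
  obtain ⟨a, _, ha, ha0, _⟩ := 𝔇.exists_z
  refine finite_quotient 𝔇.A 𝔇.ε (Ideal.IsMaximal.ne_top inferInstance) ?_
  intro h
  rw [h] at ha
  exact ha0 ha

theorem qhat_pos : 0 < 𝔇.qhat := Nat.card_pos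

theorem one_lt_qhat : 1 < 𝔇.qhat := Finite.one_lt_card

theorem pow_qhat (x : 𝔇.𝔽ε) : x ^ 𝔇.qhat = x := by
  letI := Fintype.ofFinite 𝔇.𝔽ε
  rw [qhat, Nat.card_eq_fintype_card, FiniteField.pow_card]

theorem exists_char : ∃ p k : ℕ, p.Prime ∧ CharP Fq p ∧ 𝔇.qhat = p ^ k := by
  letI := Fintype.ofFinite 𝔇.𝔽ε
  letI := Fintype.ofFinite Fq
  obtain ⟨p, hp⟩ := CharP.exists Fq
  have : CharP 𝔇.𝔽ε p :=
    charP_of_injective_ringHom (f := 𝔇.toResidue.comp (algebraMap Fq 𝔇.A))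
      (RingHom.injective _) p
  obtain ⟨n, hpp, hn⟩ := FiniteField.card 𝔇.𝔽ε p
  exact ⟨p, n, hpp, hp, by rw [qhat, Nat.card_eq_fintype_card, hn]⟩

theorem add_pow_qhat {E : Type*} [CommRing E] (i : IntegerRing K →+* E) (n : ℕ) (x y : E) :
    (x + y) ^ 𝔇.qhat ^ n = x ^ 𝔇.qhat ^ n + y ^ 𝔇.qhat ^ n := by
  nontriviality E
  obtain ⟨p, k, hp, hc, hq⟩ := 𝔇.exists_char
  have : CharP E p :=
    charP_of_injective_ringHom (f := (i.comp 𝔇.γ).comp (algebraMap Fq 𝔇.A))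
      (RingHom.injective _) p
  have : ExpChar E p := .prime hp
  rw [hq, ← pow_mul]
  exact add_pow_expChar_pow ..

/-- The `q̂`-Frobenius `x ↦ x ^ q̂` of an `R`-algebra (given by `i : R → E`). -/
def frob {E : Type*} [CommRing E] (i : IntegerRing K →+* E) : E →+* E where
  toFun x := x ^ 𝔇.qhat
  map_one' := one_pow _
  map_mul' x y := mul_pow x y _
  map_zero' := zero_pow 𝔇.qhat_pos.ne'
  map_add' x y := by simpa using 𝔇.add_pow_qhat i 1 x y

section Teichmuller
variable [CompleteSpace K]

theorem exists_teich (a : 𝔇.A) : ∃ x : K,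
    Tendsto (fun n : ℕ => ((𝔇.γ a : IntegerRing K) : K) ^ 𝔇.qhat ^ n) atTop (𝓝 x) := by
  set y : K := ((𝔇.γ a : IntegerRing K) : K) with hy
  have hδ : ‖y ^ 𝔇.qhat - y‖ < 1 := by
    have h : a ^ 𝔇.qhat - a ∈ 𝔇.ε := by
      have : 𝔇.toResidue (a ^ 𝔇.qhat - a) = 0 := by
        rw [map_sub, map_pow, pow_qhat, sub_self]
      exact Ideal.Quotient.eq_zero_iff_mem.mp this
    have := (𝔇.γ_mem_iff _).mp h
    rw [map_sub, map_pow] at this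
    exact this
  apply cauchySeq_tendsto_of_complete
  refine cauchySeq_of_le_geometric ‖y ^ 𝔇.qhat - y‖ 1 hδ fun n => ?_
  have h1 : y ^ 𝔇.qhat ^ (n + 1) = (y ^ 𝔇.qhat - y) ^ 𝔇.qhat ^ n + y ^ 𝔇.qhat ^ n := by
    rw [← 𝔇.add_pow_qhat (IntegerRing K).subtype, sub_add_cancel, pow_succ', pow_mul]
  rw [dist_comm, dist_eq_norm, h1, add_sub_cancel_right, norm_pow, one_mul]
  exact pow_le_pow_of_le_one (norm_nonneg _) hδ.le (Nat.lt_pow_self 𝔇.one_lt_qhat).le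

/-- The element `lim_n γ(a) ^ (q̂ ^ n)` of `K`. -/
def teichLim (a : 𝔇.A) : K := (𝔇.exists_teich a).choose

theorem tendsto_teichLim (a : 𝔇.A) :
    Tendsto (fun n : ℕ => ((𝔇.γ a : IntegerRing K) : K) ^ 𝔇.qhat ^ n) atTop
      (𝓝 (𝔇.teichLim a)) :=
  (𝔇.exists_teich a).choose_spec

theorem norm_γ_le_one (a : 𝔇.A) : ‖((𝔇.γ a : IntegerRing K) : K)‖ ≤ 1 := (𝔇.γ a).2

theorem norm_teichLim_le_one (a : 𝔇.A) : ‖𝔇.teichLim a‖ ≤ 1 :=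
  le_of_tendsto (𝔇.tendsto_teichLim a).norm (Eventually.of_forall fun n => by
    rw [norm_pow]
    exact pow_le_one₀ (norm_nonneg _) (𝔇.norm_γ_le_one a))

/-- `a ↦ lim_n γ(a) ^ (q̂ ^ n)` as a ring homomorphism `A → R`. -/
def teichA : 𝔇.A →+* IntegerRing K where
  toFun a := ⟨𝔇.teichLim a, 𝔇.norm_teichLim_le_one a⟩
  map_one' := Subtype.ext <| tendsto_nhds_unique (𝔇.tendsto_teichLim 1) <| by
    simp
  map_mul' a b := Subtype.ext <| tendsto_nhds_unique (𝔇.tendsto_teichLim (a * b)) <|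
    ((𝔇.tendsto_teichLim a).mul (𝔇.tendsto_teichLim b)).congr fun n => by
      rw [map_mul, ← mul_pow]; rfl
  map_zero' := Subtype.ext <| tendsto_nhds_unique (𝔇.tendsto_teichLim 0) <| by
    simp [𝔇.qhat_pos.ne']
  map_add' a b := Subtype.ext <| tendsto_nhds_unique (𝔇.tendsto_teichLim (a + b)) <|
    ((𝔇.tendsto_teichLim a).add (𝔇.tendsto_teichLim b)).congr fun n => by
      rw [map_add, ← 𝔇.add_pow_qhat (IntegerRing K).subtype]; rfl

theorem teichA_eq_zero (a : 𝔇.A) (ha : a ∈ 𝔇.ε) : 𝔇.teichA a = 0 := by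
  refine Subtype.ext (tendsto_nhds_unique (𝔇.tendsto_teichLim a) ?_)
  exact (tendsto_pow_atTop_nhds_zero_of_norm_lt_one ((𝔇.γ_mem_iff a).mp ha)).comp
    (tendsto_atTop_mono (fun n => (Nat.lt_pow_self 𝔇.one_lt_qhat).le) tendsto_id)

/-- The ring homomorphism `𝔽_ε → R` lifting the inclusion `𝔽_ε → R / 𝔪_R` induced by `γ`. It is the
restriction to constants of the continuous extension `A_ε = 𝔽_ε⟦z⟧ → R` of `γ`, and sends the class
of `a` to `lim_n γ(a) ^ (q̂ ^ n)`. -/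
def teich : 𝔇.𝔽ε →+* IntegerRing K :=
  Ideal.Quotient.lift 𝔇.ε 𝔇.teichA 𝔇.teichA_eq_zero

/-- `𝔽_ε → R` lifts the embedding of residue fields `𝔽_ε → k` induced by `γ`. -/
theorem residue_teich (a : 𝔇.A) :
    residue (IntegerRing K) (𝔇.teich (𝔇.toResidue a)) = residue (IntegerRing K) (𝔇.γ a) := by
  have hq : ∀ n : ℕ, residue (IntegerRing K) (𝔇.γ a) ^ 𝔇.qhat ^ n
      = residue (IntegerRing K) (𝔇.γ a) := by
    intro n
    have h1 : residue (IntegerRing K) (𝔇.γ a) ^ 𝔇.qhat = residue (IntegerRing K) (𝔇.γ a) := by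
      rw [← map_pow, ← map_pow, ← sub_eq_zero, ← map_sub, ← map_sub, residue_eq_zero_iff]
      change a ^ 𝔇.qhat - a ∈ 𝔇.ε
      refine Ideal.Quotient.eq_zero_iff_mem.mp ?_
      have : 𝔇.toResidue (a ^ 𝔇.qhat - a) = 0 := by
        rw [map_sub, map_pow, pow_qhat, sub_self]
      exact this
    induction n with
    | zero => simp
    | succ n ih => rw [pow_succ, pow_mul, ih, h1]
  have hn := (𝔇.tendsto_teichLim a).eventually (Metric.ball_mem_nhds _ one_pos)
  obtain ⟨n, hn⟩ := hn.exists
  rw [← hq n, ← map_pow, ← sub_eq_zero, ← map_sub, residue_eq_zero_iff,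
    Valuation.mem_maximalIdeal_iff]
  change dist _ _ < 1 at hn
  rw [dist_comm, dist_eq_norm] at hn
  exact hn

end Teichmuller
end BaseDatum
end Datum

/-! ### Local shtukas over `R`, morphisms and quasi-morphisms -/
section Laurent

/-- The homomorphism `E((z)) → E'((z))` which applies `f : E → E'` to the coefficients. -/
def laurentMap {E E' : Type*} [CommRing E] [CommRing E'] (f : E →+* E') : E⸨X⸩ →+* E'⸨X⸩ :=
  IsLocalization.map (M := Submonoid.powers (PowerSeries.X : E⟦X⟧))
    (T := Submonoid.powers (PowerSeries.X : E'⟦X⟧)) E'⸨X⸩ (PowerSeries.map f) (by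
      rw [Submonoid.powers_le]
      exact ⟨1, by simp⟩)

theorem laurentMap_algebraMap {E E' : Type*} [CommRing E] [CommRing E'] (f : E →+* E')
    (p : E⟦X⟧) : laurentMap f (algebraMap E⟦X⟧ E⸨X⸩ p) =
      algebraMap E'⟦X⟧ E'⸨X⸩ (PowerSeries.map f p) :=
  IsLocalization.map_eq _ p

theorem laurent_hom_ext {E P : Type*} [CommRing E] [CommRing P] {f g : E⸨X⸩ →+* P}
    (h : ∀ p, f (algebraMap E⟦X⟧ E⸨X⸩ p) = g (algebraMap E⟦X⟧ E⸨X⸩ p)) (x : E⸨X⸩) :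
    f x = g x := by
  have : f = g := IsLocalization.ringHom_ext (Submonoid.powers (PowerSeries.X : E⟦X⟧))
    (RingHom.ext h)
  rw [this]

end Laurent

section Shtuka

variable {Fq Q K : Type*} [Field Fq] [Finite Fq] [Field Q] [Algebra Fq Q]
  [IsCurveFunctionField Fq Q] [NontriviallyNormedField K] [IsUltrametricDist K]
  (𝔇 : BaseDatum Fq Q K)

namespace BaseDatum

/-- `σ̂` on `R⟦z⟧`. -/
def σ : (IntegerRing K)⟦X⟧ →+* (IntegerRing K)⟦X⟧ :=
  PowerSeries.map (𝔇.frob (RingHom.id _))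

/-- The element `z - ζ` of `R⟦z⟧`. -/
def zSubζ : (IntegerRing K)⟦X⟧ := PowerSeries.X - PowerSeries.C 𝔇.ζ

/-- The ring `R⟦z⟧[1/(z-ζ)]`. -/
abbrev Rzζ : Type _ := Localization.Away 𝔇.zSubζ

/-- The localization map `R⟦z⟧ → R⟦z⟧[1/(z-ζ)]`. -/
abbrev loc : (IntegerRing K)⟦X⟧ →+* 𝔇.Rzζ := algebraMap _ _

/-- `R⟦z⟧[1/z] = R((z))`. -/
abbrev toLaurent (E : Type*) [CommRing E] : E⟦X⟧ →+* E⸨X⸩ := algebraMap _ _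

/-- `R⟦z⟧[1/z][1/(z-ζ)]`. -/
abbrev Rzzζ : Type _ :=
  Localization.Away (toLaurent (IntegerRing K) 𝔇.zSubζ)

/-- The canonical map `R⟦z⟧[1/(z-ζ)] → R⟦z⟧[1/z][1/(z-ζ)]`. -/
def locToRzzζ : 𝔇.Rzζ →+* 𝔇.Rzzζ :=
  IsLocalization.Away.lift 𝔇.zSubζ
    (g := (algebraMap (IntegerRing K)⸨X⸩ 𝔇.Rzzζ).comp (toLaurent (IntegerRing K)))
    (IsLocalization.Away.algebraMap_isUnit (S := 𝔇.Rzzζ) (toLaurent (IntegerRing K) 𝔇.zSubζ))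

/-- The localization map `R⟦z⟧[1/z] → R⟦z⟧[1/z][1/(z-ζ)]`. -/
abbrev laurentToRzzζ : (IntegerRing K)⸨X⸩ →+* 𝔇.Rzzζ := algebraMap _ _

/-- The canonical map `R⟦z⟧ → R⟦z⟧[1/z][1/(z-ζ)]`. -/
abbrev toRzzζ : (IntegerRing K)⟦X⟧ →+* 𝔇.Rzzζ :=
  𝔇.laurentToRzzζ.comp (toLaurent (IntegerRing K))

theorem locToRzzζ_comp : 𝔇.locToRzzζ.comp 𝔇.loc = 𝔇.toRzzζ :=
  IsLocalization.Away.lift_comp 𝔇.zSubζ _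

/-- `σ̂` on `R((z))`. -/
def σLaurent : (IntegerRing K)⸨X⸩ →+* (IntegerRing K)⸨X⸩ :=
  laurentMap (𝔇.frob (RingHom.id _))

end BaseDatum

/-- A local shtuka over `R`: a finite free `R⟦z⟧`-module `M` together with an isomorphism
`τ_M : (σ̂^* M)[1/(z-ζ)] ≃ M[1/(z-ζ)]`. -/
structure LocalShtuka (𝔇 : BaseDatum Fq Q K) where
  M : Type v
  [addCommGroup : AddCommGroup M]
  [module : Module (IntegerRing K)⟦X⟧ M]
  [finite : Module.Finite (IntegerRing K)⟦X⟧ M]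
  [free : Module.Free (IntegerRing K)⟦X⟧ M]
  τ : BaseChange 𝔇.loc (BaseChange 𝔇.σ M) ≃ₗ[𝔇.Rzζ] BaseChange 𝔇.loc M

attribute [instance] LocalShtuka.addCommGroup LocalShtuka.module LocalShtuka.finite
  LocalShtuka.free

variable {𝔇}

namespace LocalShtuka

/-- Given ring homomorphisms `g : R⟦z⟧ → C`, `g' : R⟦z⟧ → D` over `R⟦z⟧`, where `g'` factors through
`h : R⟦z⟧[1/(z-ζ)] → D`, and `s : C → D` compatible with `σ̂`, this is the `s`-semilinear map
`C ⊗ M → D ⊗ M`, `c ⊗ m ↦ s(c) · τ_M(σ̂^* m)`. -/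
def frob {C D : Type*} [CommRing C] [CommRing D] {g : (IntegerRing K)⟦X⟧ →+* C}
    {g' : (IntegerRing K)⟦X⟧ →+* D} (h : 𝔇.Rzζ →+* D) (hg : h.comp 𝔇.loc = g') (s : C →+* D)
    (hs : s.comp g = g'.comp 𝔇.σ) (N : LocalShtuka.{v} 𝔇) :
    BaseChange g N.M →ₛₗ[s] BaseChange g' N.M :=
  BaseChange.lift s
    { toFun := fun m =>
        BaseChange.along h hg (N.τ (BaseChange.mk 𝔇.loc (BaseChange.mk 𝔇.σ m)))
      map_add' := fun a b => by simp only [map_add]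
      map_smul' := fun b m => by
        rw [map_smulₛₗ, map_smulₛₗ, map_smul, map_smulₛₗ]
        refine congrArg (· • _) ?_
        exact (DFunLike.congr_fun hg _).trans (DFunLike.congr_fun hs _).symm }

theorem frob_mk {C D : Type*} [CommRing C] [CommRing D] {g : (IntegerRing K)⟦X⟧ →+* C}
    {g' : (IntegerRing K)⟦X⟧ →+* D} (h : 𝔇.Rzζ →+* D) (hg : h.comp 𝔇.loc = g') (s : C →+* D)
    (hs : s.comp g = g'.comp 𝔇.σ) (N : LocalShtuka.{v} 𝔇) (m : N.M) :
    N.frob h hg s hs (BaseChange.mk g m) =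
      BaseChange.along h hg (N.τ (BaseChange.mk 𝔇.loc (BaseChange.mk 𝔇.σ m))) :=
  BaseChange.lift_mk _ _ _

/-- A morphism of local shtukas: an `R⟦z⟧`-linear map `f : M → M'` with
`τ_{M'} ∘ σ̂^* f = f ∘ τ_M`. -/
@[ext]
structure Hom (N N' : LocalShtuka.{v} 𝔇) where
  f : N.M →ₗ[(IntegerRing K)⟦X⟧] N'.M
  comm : N'.τ.toLinearMap ∘ₗ BaseChange.map 𝔇.loc (BaseChange.map 𝔇.σ f) =
    BaseChange.map 𝔇.loc f ∘ₗ N.τ.toLinearMap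

theorem laurent_comp_σ : (𝔇.laurentToRzzζ.comp 𝔇.σLaurent).comp
    (BaseDatum.toLaurent (IntegerRing K)) = 𝔇.toRzzζ.comp 𝔇.σ := by
  ext x
  exact congrArg 𝔇.laurentToRzzζ (laurentMap_algebraMap _ x)

/-- The semilinear map `x ↦ τ_M(σ̂^* x)` from `M[1/z]` to `M[1/z][1/(z-ζ)]`. -/
def frobLaurent (N : LocalShtuka.{v} 𝔇) :
    BaseChange (BaseDatum.toLaurent (IntegerRing K)) N.M
      →ₛₗ[𝔇.laurentToRzzζ.comp 𝔇.σLaurent] BaseChange 𝔇.toRzzζ N.M :=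
  N.frob 𝔇.locToRzzζ 𝔇.locToRzzζ_comp _ laurent_comp_σ

/-- A quasi-morphism of local shtukas: an `R((z))`-linear map `f : M[1/z] → M'[1/z]` with
`τ_{M'} ∘ σ̂^* f = f ∘ τ_M`. The equation is one of `R((z))[1/(z-ζ)]`-linear maps on
`(σ̂^* M)[1/z][1/(z-ζ)]`; this module is generated by the elements `σ̂^* x` for `x ∈ M[1/z]`, and
the equation is stated on these generators. -/
@[ext]
structure QuasiHom (N N' : LocalShtuka.{v} 𝔇) where
  f : BaseChange (BaseDatum.toLaurent (IntegerRing K)) N.M →ₗ[(IntegerRing K)⸨X⸩]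
    BaseChange (BaseDatum.toLaurent (IntegerRing K)) N'.M
  comm : ∀ x, N'.frobLaurent (f x) =
    BaseChange.extend 𝔇.laurentToRzzζ rfl f (N.frobLaurent x)

/-- The category of local shtukas over `R`. -/
instance : Category (LocalShtuka.{v} 𝔇) where
  Hom := Hom
  id N := ⟨LinearMap.id, by
    rw [BaseChange.map_id, BaseChange.map_id, BaseChange.map_id]; rfl⟩
  comp a b := ⟨b.f ∘ₗ a.f, by
    rw [BaseChange.map_comp, BaseChange.map_comp, BaseChange.map_comp, ← LinearMap.comp_assoc,
      b.comm, LinearMap.comp_assoc, a.comm, LinearMap.comp_assoc]⟩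

end LocalShtuka

/-- The category of local shtukas with quasi-morphisms: the objects are local shtukas. -/
structure QuasiLocalShtuka (𝔇 : BaseDatum Fq Q K) where
  obj : LocalShtuka.{v} 𝔇

instance : Category (QuasiLocalShtuka.{v} 𝔇) where
  Hom N N' := LocalShtuka.QuasiHom N.obj N'.obj
  id N := ⟨LinearMap.id, fun x => by rw [BaseChange.extend_id]; rfl⟩
  comp a b := ⟨b.f ∘ₗ a.f, fun x => by
    rw [BaseChange.extend_comp, LinearMap.comp_apply, b.comm, a.comm, LinearMap.comp_apply]⟩

end Shtuka

/-! ### Tate modules -/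
section Tate

variable {Fq Q K : Type*} [Field Fq] [Finite Fq] [Field Q] [Algebra Fq Q]
  [IsCurveFunctionField Fq Q] [NontriviallyNormedField K] [IsUltrametricDist K]

/-- A ring `C` over `R⟦z⟧[1/(z-ζ)]` with a lift `σ` of `σ̂`, whose fixed ring receives a ring `E`, and
with an action of a group `G` commuting with all of this. It is used below only for `C = L⟦z⟧` and
`C = L((z))`. -/
structure CoeffRing (𝔇 : BaseDatum Fq Q K) (E G C : Type*) [CommRing E] [Group G] [CommRing C]
    where
  incl : (IntegerRing K)⟦X⟧ →+* C
  inclLoc : 𝔇.Rzζ →+* C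
  inclLoc_comp : inclLoc.comp 𝔇.loc = incl
  σ : C →+* C
  σ_comp_incl : σ.comp incl = incl.comp 𝔇.σ
  coeff : E →+* C
  σ_coeff : ∀ e, σ (coeff e) = coeff e
  act : G →* (C →+* C)
  act_incl : ∀ γ, (act γ).comp incl = incl
  act_coeff : ∀ γ e, act γ (coeff e) = coeff e
  act_σ : ∀ γ c, act γ (σ c) = σ (act γ c)

namespace CoeffRing

variable {𝔇 : BaseDatum Fq Q K} {E G C : Type*} [CommRing E] [Group G] [CommRing C]
  (P : CoeffRing 𝔇 E G C) (N : LocalShtuka.{v} 𝔇)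

/-- The `E`-module structure on `M ⊗ C` through `E → C`. -/
instance : Module E (BaseChange P.incl N.M) := Module.compHom _ P.coeff

theorem smul_def (e : E) (x : BaseChange P.incl N.M) : e • x = P.coeff e • x := rfl

/-- The semilinear map `x ↦ τ_M(σ̂^* x)` on `M ⊗ C`. -/
def frob : BaseChange P.incl N.M →ₛₗ[P.σ] BaseChange P.incl N.M :=
  N.frob P.inclLoc P.inclLoc_comp P.σ P.σ_comp_incl

/-- The `G`-action on `M ⊗ C` through the second factor. -/
def galois (γ : G) : BaseChange P.incl N.M →ₛₗ[P.act γ] BaseChange P.incl N.M :=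
  BaseChange.along (P.act γ) (P.act_incl γ)

/-- The `E`-module `{x ∈ M ⊗ C : τ_M(σ̂^* x) = x}`. -/
def solutions : Submodule E (BaseChange P.incl N.M) where
  carrier := {x | P.frob N x = x}
  add_mem' {x y} hx hy := by
    change P.frob N (x + y) = x + y
    rw [map_add, show P.frob N x = x from hx, show P.frob N y = y from hy]
  zero_mem' := map_zero _
  smul_mem' e x hx := by
    change P.frob N (P.coeff e • x) = P.coeff e • x
    rw [map_smulₛₗ, P.σ_coeff, show P.frob N x = x from hx]

theorem galois_frob (γ : G) (x : BaseChange P.incl N.M) :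
    P.galois N γ (P.frob N x) = P.frob N (P.galois N γ x) := by
  let s : C →+* C := (P.act γ).comp P.σ
  let φ : BaseChange P.incl N.M →ₛₗ[s] BaseChange P.incl N.M :=
    { toFun := fun x => P.galois N γ (P.frob N x)
      map_add' := fun a b => by simp only [map_add]
      map_smul' := fun c x => by rw [map_smulₛₗ, map_smulₛₗ]; rfl }
  let ψ : BaseChange P.incl N.M →ₛₗ[s] BaseChange P.incl N.M :=
    { toFun := fun x => P.frob N (P.galois N γ x)
      map_add' := fun a b => by simp only [map_add]
      map_smul' := fun c x => by
        rw [map_smulₛₗ, map_smulₛₗ, ← P.act_σ]; rfl }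
  refine BaseChange.hom_ext (φ := φ) (ψ := ψ) (fun m => ?_) x
  change P.galois N γ (P.frob N _) = P.frob N (P.galois N γ _)
  rw [galois, BaseChange.along_mk, frob, LocalShtuka.frob_mk]
  refine BaseChange.along_along _ _ _ ?_ _ _ _ _
  refine IsLocalization.ringHom_ext (Submonoid.powers 𝔇.zSubζ) ?_
  rw [RingHom.comp_assoc, P.inclLoc_comp, P.act_incl]

theorem galois_mem (γ : G) {x : BaseChange P.incl N.M} (hx : x ∈ P.solutions N) :
    P.galois N γ x ∈ P.solutions N := by
  change P.frob N _ = _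
  rw [← galois_frob, show P.frob N x = x from hx]

/-- The action of `G` on `{x ∈ M ⊗ C : τ_M(σ̂^* x) = x}`. -/
def ρ : Representation E G (P.solutions N) where
  toFun γ :=
    { toFun := fun x => ⟨P.galois N γ x, P.galois_mem N γ x.2⟩
      map_add' := fun x y => Subtype.ext (map_add (P.galois N γ) _ _)
      map_smul' := fun e x => Subtype.ext (by
        change P.galois N γ (P.coeff e • (x : BaseChange P.incl N.M)) = P.coeff e • _
        rw [map_smulₛₗ, P.act_coeff]) }
  map_one' := LinearMap.ext fun x => Subtype.ext
    (BaseChange.along_id _ (P.act_incl 1) (by rw [map_one]; rfl) _)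
  map_mul' γ γ' := LinearMap.ext fun x => Subtype.ext
    (BaseChange.along_along _ _ _ (by rw [map_mul]; rfl) _ _ _ _).symm

/-- The representation of `G` on `{x ∈ M ⊗ C : τ_M(σ̂^* x) = x}`. -/
def rep : Rep E G := Rep.of (P.ρ N)

/-- The map of solution spaces given by a `C`-linear map commuting with Frobenius and `G`. -/
def repHom {N N' : LocalShtuka.{v} 𝔇} (F : BaseChange P.incl N.M →ₗ[C] BaseChange P.incl N'.M)
    (hF : ∀ x, P.frob N' (F x) = F (P.frob N x))
    (hG : ∀ γ x, F (P.galois N γ x) = P.galois N' γ (F x)) : P.rep N ⟶ P.rep N' :=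
  Rep.ofHom
    { toFun := fun x => ⟨F x, by
        change P.frob N' _ = _
        rw [hF, show P.frob N x = x from x.2]⟩
      map_add' := fun x y => Subtype.ext (map_add F _ _)
      map_smul' := fun e x => Subtype.ext (map_smul F (P.coeff e) _)
      isIntertwining' := fun γ => LinearMap.ext fun x => Subtype.ext (hG γ x) }

theorem map_frob {N N' : LocalShtuka.{v} 𝔇} (a : N ⟶ N') (x : BaseChange P.incl N.M) :
    P.frob N' (BaseChange.map P.incl a.f x) = BaseChange.map P.incl a.f (P.frob N x) := by
  refine BaseChange.hom_ext (φ := (P.frob N').comp (BaseChange.map P.incl a.f))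
    (ψ := (BaseChange.map P.incl a.f).comp (P.frob N)) (fun m => ?_) x
  rw [LinearMap.comp_apply, LinearMap.comp_apply, BaseChange.map_mk, frob, frob,
    LocalShtuka.frob_mk, LocalShtuka.frob_mk, BaseChange.map_along, ← BaseChange.map_mk,
    ← BaseChange.map_mk]
  exact congrArg _ (LinearMap.congr_fun a.comm _)

theorem map_galois {N N' : LocalShtuka.{v} 𝔇} (a : N ⟶ N') (γ : G) (x : BaseChange P.incl N.M) :
    BaseChange.map P.incl a.f (P.galois N γ x) = P.galois N' γ (BaseChange.map P.incl a.f x) :=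
  BaseChange.map_along _ _ _ _

/-- The functor `M ↦ {x ∈ M ⊗ C : τ_M(σ̂^* x) = x}` on local shtukas. -/
def functor : LocalShtuka.{v} 𝔇 ⥤ Rep E G where
  obj N := P.rep N
  map a := P.repHom (BaseChange.map P.incl a.f) (P.map_frob a) (P.map_galois a)
  map_id N := Rep.hom_ext (Representation.IntertwiningMap.ext (LinearMap.ext fun x => Subtype.ext
    (LinearMap.congr_fun (BaseChange.map_id P.incl) _)))
  map_comp a b := Rep.hom_ext (Representation.IntertwiningMap.ext (LinearMap.ext fun x => Subtype.ext
    (LinearMap.congr_fun (BaseChange.map_comp P.incl b.f a.f) _)))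

section Quasi

variable {P} {r : (IntegerRing K)⸨X⸩ →+* C}
  (hr : r.comp (BaseDatum.toLaurent (IntegerRing K)) = P.incl)

theorem isUnit_zSubζ (hr : r.comp (BaseDatum.toLaurent (IntegerRing K)) = P.incl) :
     IsUnit (r (BaseDatum.toLaurent (IntegerRing K) 𝔇.zSubζ)) := by
  have h1 : r (BaseDatum.toLaurent (IntegerRing K) 𝔇.zSubζ) = P.inclLoc (𝔇.loc 𝔇.zSubζ) :=
    (DFunLike.congr_fun hr _).trans (DFunLike.congr_fun P.inclLoc_comp _).symm
  rw [h1]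
  exact (IsLocalization.Away.algebraMap_isUnit (S := 𝔇.Rzζ) 𝔇.zSubζ).map P.inclLoc

/-- The extension of `r : R((z)) → C` to `R((z))[1/(z-ζ)]`. -/
def liftRzzζ : 𝔇.Rzzζ →+* C :=
  IsLocalization.Away.lift (BaseDatum.toLaurent (IntegerRing K) 𝔇.zSubζ) (isUnit_zSubζ hr)

theorem liftRzzζ_comp : (liftRzzζ hr).comp 𝔇.laurentToRzzζ = r :=
  IsLocalization.Away.lift_comp _ _

theorem liftRzzζ_comp_toRzzζ : (liftRzzζ hr).comp 𝔇.toRzzζ = P.incl := by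
  rw [← RingHom.comp_assoc, liftRzzζ_comp, hr]

theorem liftRzzζ_comp_loc : (liftRzzζ hr).comp 𝔇.locToRzzζ = P.inclLoc := by
  refine IsLocalization.ringHom_ext (Submonoid.powers 𝔇.zSubζ) ?_
  rw [RingHom.comp_assoc, 𝔇.locToRzzζ_comp, liftRzzζ_comp_toRzzζ, P.inclLoc_comp]

theorem σ_comp_r (hr : r.comp (BaseDatum.toLaurent (IntegerRing K)) = P.incl) :
     P.σ.comp r = r.comp 𝔇.σLaurent := by
  refine RingHom.ext (laurent_hom_ext fun p => ?_)
  have h1 := DFunLike.congr_fun hr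
  have h2 : 𝔇.σLaurent (algebraMap _ _ p) = algebraMap _ _ (𝔇.σ p) := laurentMap_algebraMap _ _
  rw [RingHom.comp_apply, RingHom.comp_apply, h2]
  exact (congrArg P.σ (h1 p)).trans ((DFunLike.congr_fun P.σ_comp_incl p).trans (h1 _).symm)

theorem act_comp_r (hr : r.comp (BaseDatum.toLaurent (IntegerRing K)) = P.incl) (γ : G) :
     (P.act γ).comp r = r := by
  refine RingHom.ext (laurent_hom_ext fun p => ?_)
  have h1 := DFunLike.congr_fun hr
  exact (congrArg (P.act γ) (h1 p)).trans
    ((DFunLike.congr_fun (P.act_incl γ) p).trans (h1 p).symm)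

theorem frob_along (N : LocalShtuka.{v} 𝔇)
    (y : BaseChange (BaseDatum.toLaurent (IntegerRing K)) N.M) :
    P.frob N (BaseChange.along r hr y) =
      BaseChange.along (liftRzzζ hr) (liftRzzζ_comp_toRzzζ hr) (N.frobLaurent y) := by
  let φ : BaseChange (BaseDatum.toLaurent (IntegerRing K)) N.M →ₛₗ[P.σ.comp r]
      BaseChange P.incl N.M :=
    { toFun := fun y => P.frob N (BaseChange.along r hr y)
      map_add' := fun a b => by simp only [map_add]
      map_smul' := fun c x => by rw [map_smulₛₗ, map_smulₛₗ]; rfl }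
  let ψ : BaseChange (BaseDatum.toLaurent (IntegerRing K)) N.M →ₛₗ[P.σ.comp r]
      BaseChange P.incl N.M :=
    { toFun := fun y =>
        BaseChange.along (liftRzzζ hr) (liftRzzζ_comp_toRzzζ hr) (N.frobLaurent y)
      map_add' := fun a b => by simp only [map_add]
      map_smul' := fun c x => by
        rw [map_smulₛₗ, map_smulₛₗ, σ_comp_r hr]
        refine congrArg (· • _) ?_
        exact DFunLike.congr_fun (liftRzzζ_comp hr) _ }
  refine BaseChange.hom_ext (φ := φ) (ψ := ψ) (fun m => ?_) y
  change P.frob N (BaseChange.along r hr (BaseChange.mk _ m)) =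
    BaseChange.along (liftRzzζ hr) (liftRzzζ_comp_toRzzζ hr) (N.frobLaurent (BaseChange.mk _ m))
  rw [BaseChange.along_mk, frob, LocalShtuka.frobLaurent, LocalShtuka.frob_mk,
    LocalShtuka.frob_mk]
  exact (BaseChange.along_along _ _ _ (liftRzzζ_comp_loc hr) _ _ _ _).symm

theorem extend_along_lift {N N' : LocalShtuka.{v} 𝔇}
    (f : BaseChange (BaseDatum.toLaurent (IntegerRing K)) N.M →ₗ[(IntegerRing K)⸨X⸩]
      BaseChange (BaseDatum.toLaurent (IntegerRing K)) N'.M)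
    (y : BaseChange 𝔇.toRzzζ N.M) :
    BaseChange.extend r hr f
        (BaseChange.along (liftRzzζ hr) (liftRzzζ_comp_toRzzζ hr) y) =
      BaseChange.along (liftRzzζ hr) (liftRzzζ_comp_toRzzζ hr)
        (BaseChange.extend 𝔇.laurentToRzzζ rfl f y) := by
  refine BaseChange.hom_ext (φ := (BaseChange.extend r hr f).comp
      (BaseChange.along (liftRzzζ hr) (liftRzzζ_comp_toRzzζ hr)))
    (ψ := (BaseChange.along (liftRzzζ hr) (liftRzzζ_comp_toRzzζ hr)).comp
      (BaseChange.extend 𝔇.laurentToRzzζ rfl f)) (fun m => ?_) y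
  rw [LinearMap.comp_apply, LinearMap.comp_apply, BaseChange.along_mk, BaseChange.extend_mk,
    BaseChange.extend_mk]
  exact (BaseChange.along_along _ _ _ (liftRzzζ_comp hr) _ _ _ _).symm

theorem extend_frob {N N' : LocalShtuka.{v} 𝔇} (a : LocalShtuka.QuasiHom N N')
    (x : BaseChange P.incl N.M) :
    P.frob N' (BaseChange.extend r hr a.f x) = BaseChange.extend r hr a.f (P.frob N x) := by
  refine BaseChange.hom_ext (φ := (P.frob N').comp (BaseChange.extend r hr a.f))
    (ψ := (BaseChange.extend r hr a.f).comp (P.frob N)) (fun m => ?_) x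
  rw [LinearMap.comp_apply, LinearMap.comp_apply, ← BaseChange.along_mk r hr,
    BaseChange.extend_along, frob_along, frob_along, a.comm, extend_along_lift]

theorem extend_galois {N N' : LocalShtuka.{v} 𝔇} (a : LocalShtuka.QuasiHom N N') (γ : G)
    (x : BaseChange P.incl N.M) :
    BaseChange.extend r hr a.f (P.galois N γ x) =
      P.galois N' γ (BaseChange.extend r hr a.f x) := by
  refine BaseChange.hom_ext (φ := (BaseChange.extend r hr a.f).comp (P.galois N γ))
    (ψ := (P.galois N' γ).comp (BaseChange.extend r hr a.f)) (fun m => ?_) x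
  rw [LinearMap.comp_apply, LinearMap.comp_apply, galois, BaseChange.along_mk,
    BaseChange.extend_mk]
  exact (BaseChange.along_along _ _ _ (act_comp_r hr γ) _ _ _ _).symm

/-- The functor `M ↦ {x ∈ M ⊗ C : τ_M(σ̂^* x) = x}` on local shtukas with quasi-morphisms. -/
def quasiFunctor : QuasiLocalShtuka.{v} 𝔇 ⥤ Rep E G where
  obj N := P.rep N.obj
  map a := P.repHom (BaseChange.extend r hr a.f) (extend_frob hr a) (extend_galois hr a)
  map_id N := Rep.hom_ext (Representation.IntertwiningMap.ext (LinearMap.ext fun x => Subtype.ext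
    (LinearMap.congr_fun (BaseChange.extend_id r hr) _)))
  map_comp a b := Rep.hom_ext (Representation.IntertwiningMap.ext (LinearMap.ext fun x => Subtype.ext
    (LinearMap.congr_fun (BaseChange.extend_comp r hr b.f a.f) _)))

end Quasi

end CoeffRing

end Tate

/-! ### The Tate module functors -/
section TateFunctors

variable {Fq Q K : Type*} [Field Fq] [Finite Fq] [Field Q] [Algebra Fq Q]
  [IsCurveFunctionField Fq Q] [NontriviallyNormedField K] [IsUltrametricDist K]
  (𝔇 : BaseDatum Fq Q K) (L : Type*) [Field L] [Algebra K L]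

namespace BaseDatum

/-- The ring `A_ε = 𝔽_ε⟦z⟧`. -/
abbrev Aε : Type _ := 𝔇.𝔽ε⟦X⟧

/-- The field `Q_ε = Quot(A_ε)`. -/
abbrev Qε : Type _ := FractionRing 𝔇.Aε

end BaseDatum

/-- The inclusion `R → K → L`. -/
def toL (K : Type*) [NontriviallyNormedField K] [IsUltrametricDist K] (L : Type*) [Field L]
    [Algebra K L] : IntegerRing K →+* L :=
  (algebraMap K L).comp (IntegerRing K).subtype

theorem toL_injective : Function.Injective (toL K L) :=
  (algebraMap K L).injective.comp Subtype.val_injective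

theorem toL_comp (g : L ≃ₐ[K] L) : (g : L →+* L).comp (toL K L) = toL K L :=
  RingHom.ext fun x => g.commutes _

theorem isUnit_map_zSubζ : IsUnit (PowerSeries.map (toL K L) 𝔇.zSubζ) := by
  rw [PowerSeries.isUnit_iff_constantCoeff, isUnit_iff_ne_zero, BaseDatum.zSubζ]
  simpa using (map_ne_zero_iff _ (toL_injective L)).mpr 𝔇.ζ_ne_zero

/-- The action of `Gal(L/K)` on `L⟦z⟧` through the coefficients. -/
def galPowerSeries : (L ≃ₐ[K] L) →* (L⟦X⟧ →+* L⟦X⟧) where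
  toFun g := PowerSeries.map (g : L →+* L)
  map_one' := RingHom.ext fun x => PowerSeries.ext fun n => by simp
  map_mul' g g' := RingHom.ext fun x => PowerSeries.ext fun n => by simp

/-- The action of `Gal(L/K)` on `L((z))` through the coefficients. -/
def galLaurent : (L ≃ₐ[K] L) →* (L⸨X⸩ →+* L⸨X⸩) where
  toFun g := laurentMap (g : L →+* L)
  map_one' := RingHom.ext <| laurent_hom_ext fun p => by
    rw [laurentMap_algebraMap]
    exact congrArg _ (DFunLike.congr_fun (map_one (galPowerSeries L)) p)
  map_mul' g g' := RingHom.ext <| laurent_hom_ext fun p => by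
    rw [RingHom.mul_def, RingHom.comp_apply, laurentMap_algebraMap, laurentMap_algebraMap,
      laurentMap_algebraMap]
    exact congrArg _ (DFunLike.congr_fun (map_mul (galPowerSeries L) g g') p)

variable [CompleteSpace K]

/-- The embedding `𝔽_ε → R → L`. -/
def teichL : 𝔇.𝔽ε →+* L := (toL K L).comp 𝔇.teich

/-- `L⟦z⟧` with the inclusion of `R⟦z⟧`, with `σ̂`, the inclusion of `A_ε` and the action of
`Gal(L/K)`. -/
def tateCoeff : CoeffRing 𝔇 𝔇.Aε (L ≃ₐ[K] L) L⟦X⟧ where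
  incl := PowerSeries.map (toL K L)
  inclLoc := IsLocalization.Away.lift 𝔇.zSubζ (isUnit_map_zSubζ 𝔇 L)
  inclLoc_comp := IsLocalization.Away.lift_comp _ _
  σ := PowerSeries.map (𝔇.frob (toL K L))
  σ_comp_incl := RingHom.ext fun x => PowerSeries.ext fun n =>
    (map_pow (toL K L) (PowerSeries.coeff n x) 𝔇.qhat).symm
  coeff := PowerSeries.map (teichL 𝔇 L)
  σ_coeff e := PowerSeries.ext fun n => by
    rw [PowerSeries.coeff_map, PowerSeries.coeff_map]
    exact (map_pow (teichL 𝔇 L) _ _).symm.trans (congrArg _ (𝔇.pow_qhat _))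
  act := galPowerSeries L
  act_incl g := RingHom.ext fun x => PowerSeries.ext fun n => g.commutes _
  act_coeff g e := PowerSeries.ext fun n => g.commutes _
  act_σ g c := PowerSeries.ext fun n => map_pow g (PowerSeries.coeff n c) 𝔇.qhat

theorem algebraMap_comp_coeff_injective : Function.Injective
    ((algebraMap L⟦X⟧ L⸨X⸩).comp (tateCoeff 𝔇 L).coeff) :=
  (IsFractionRing.injective L⟦X⟧ L⸨X⸩).comp
    (PowerSeries.map_injective _ (teichL 𝔇 L).injective)

/-- `L((z))` with the inclusion of `R⟦z⟧`, with `σ̂`, the inclusion of `Q_ε` and the action of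
`Gal(L/K)`. -/
def rationalCoeff : CoeffRing 𝔇 𝔇.Qε (L ≃ₐ[K] L) L⸨X⸩ where
  incl := (algebraMap L⟦X⟧ L⸨X⸩).comp (tateCoeff 𝔇 L).incl
  inclLoc := (algebraMap L⟦X⟧ L⸨X⸩).comp (tateCoeff 𝔇 L).inclLoc
  inclLoc_comp := by rw [RingHom.comp_assoc, (tateCoeff 𝔇 L).inclLoc_comp]
  σ := laurentMap (𝔇.frob (toL K L))
  σ_comp_incl := RingHom.ext fun x => (laurentMap_algebraMap _ _).trans
    (congrArg _ (DFunLike.congr_fun (tateCoeff 𝔇 L).σ_comp_incl x))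
  coeff := IsFractionRing.lift (algebraMap_comp_coeff_injective 𝔇 L)
  σ_coeff e := by
    suffices h : (laurentMap (𝔇.frob (toL K L))).comp
        (IsFractionRing.lift (algebraMap_comp_coeff_injective 𝔇 L)) =
        (IsFractionRing.lift (algebraMap_comp_coeff_injective 𝔇 L) : 𝔇.Qε →+* L⸨X⸩) from
      DFunLike.congr_fun h e
    refine IsLocalization.ringHom_ext (nonZeroDivisors 𝔇.Aε) (RingHom.ext fun x => ?_)
    rw [RingHom.comp_apply, RingHom.comp_apply, RingHom.comp_apply, IsFractionRing.lift_algebraMap,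
      RingHom.comp_apply, laurentMap_algebraMap]
    exact congrArg _ ((tateCoeff 𝔇 L).σ_coeff x)
  act := galLaurent L
  act_incl g := RingHom.ext fun x => (laurentMap_algebraMap _ _).trans
    (congrArg _ (DFunLike.congr_fun ((tateCoeff 𝔇 L).act_incl g) x))
  act_coeff g e := by
    suffices h : (laurentMap (g : L →+* L)).comp
        (IsFractionRing.lift (algebraMap_comp_coeff_injective 𝔇 L)) =
        (IsFractionRing.lift (algebraMap_comp_coeff_injective 𝔇 L) : 𝔇.Qε →+* L⸨X⸩) from
      DFunLike.congr_fun h e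
    refine IsLocalization.ringHom_ext (nonZeroDivisors 𝔇.Aε) (RingHom.ext fun x => ?_)
    rw [RingHom.comp_apply, RingHom.comp_apply, RingHom.comp_apply, IsFractionRing.lift_algebraMap,
      RingHom.comp_apply, laurentMap_algebraMap]
    exact congrArg _ ((tateCoeff 𝔇 L).act_coeff g x)
  act_σ g c := by
    suffices h : (laurentMap (g : L →+* L)).comp (laurentMap (𝔇.frob (toL K L))) =
        (laurentMap (𝔇.frob (toL K L))).comp (laurentMap (g : L →+* L)) from
      DFunLike.congr_fun h c
    refine RingHom.ext (laurent_hom_ext fun p => ?_)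
    rw [RingHom.comp_apply, RingHom.comp_apply, laurentMap_algebraMap, laurentMap_algebraMap,
      laurentMap_algebraMap, laurentMap_algebraMap]
    exact congrArg _ ((tateCoeff 𝔇 L).act_σ g p)

theorem rationalCoeff_incl : (laurentMap (toL K L)).comp
    (BaseDatum.toLaurent (IntegerRing K)) = (rationalCoeff 𝔇 L).incl :=
  RingHom.ext fun x => laurentMap_algebraMap _ _

/-- The dual Tate module functor `M ↦ {m ∈ M ⊗_{R⟦z⟧} L⟦z⟧ : τ_M(σ̂^* m) = m}`. -/
def tateFunctor : LocalShtuka.{v} 𝔇 ⥤ Rep 𝔇.Aε (L ≃ₐ[K] L) :=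
  (tateCoeff 𝔇 L).functor

/-- The rational dual Tate module functor `M ↦ {m ∈ M ⊗_{R⟦z⟧} L((z)) : τ_M(σ̂^* m) = m}`, on
local shtukas with quasi-morphisms. -/
def rationalTateFunctor : QuasiLocalShtuka.{v} 𝔇 ⥤ Rep 𝔇.Qε (L ≃ₐ[K] L) :=
  CoeffRing.quasiFunctor (rationalCoeff_incl 𝔇 L)

end TateFunctors

/-! ### Continuous representations -/
section ContinuousRep

variable (F : Type*) [Field F] (G : Type*) [Group G] [TopologicalSpace G]

/-- Continuous representations of `G` on finite free `F⟦z⟧`-modules: for every `n`, the subgroup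
of all `g` which act trivially modulo `z ^ n` is open. -/
def IsContFiniteFree : ObjectProperty (Rep F⟦X⟧ G) := fun V =>
  Module.Finite F⟦X⟧ V ∧ Module.Free F⟦X⟧ V ∧
    ∀ n : ℕ, IsOpen {g : G | ∀ v : V, ∃ w : V, V.ρ g v - v = (PowerSeries.X : F⟦X⟧) ^ n • w}

/-- Continuous representations of `G` on finite dimensional vector spaces over the fraction field of
`F⟦z⟧`. Continuity is expressed by the lattice `Λ` spanned over `F⟦z⟧` by a basis `b`: for every
`n`, the set of all `g` whose matrix with respect to `b` is congruent to `1` modulo `z ^ n` is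
open. -/
def IsContFiniteDim : ObjectProperty (Rep (FractionRing F⟦X⟧) G) := fun V =>
  ∃ (r : ℕ) (b : Module.Basis (Fin r) (FractionRing F⟦X⟧) V),
    ∀ n : ℕ, IsOpen {g : G | ∀ i j : Fin r, ∃ c : F⟦X⟧,
      b.repr (V.ρ g (b j) - b j) i = algebraMap F⟦X⟧ (FractionRing F⟦X⟧) (PowerSeries.X ^ n * c)}

end ContinuousRep

end

end LocSht

/-!
A local shtuka with a basis is a matrix `T`, invertible over `R⟦z⟧[1/(z-ζ)]`, and its Frobenius is
`x ↦ T σ(x)`. Write `L` for the separable closure of `K`.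

*Tate modules.* Lang's theorem over the separably closed field `L` (`span_fixed_eq_top`), lifted
coefficient by coefficient to `L⟦z⟧` by Artin-Schreier equations
(`exists_powerSeries_matrix_fixed`), gives an invertible fundamental matrix `U` over `L⟦z⟧` with
`T σ(U) = U`. Its columns form a basis of the Tate module over `𝔽_ε⟦z⟧`, the fixed ring of `σ`, and
of the rational Tate module over the fraction field. An element `g` of the Galois group acts by the
matrix `U⁻¹ g(U)`, which is `1` modulo `z ^ n` exactly if `g` fixes the coefficients of `U` below
`z ^ n`; this is continuity. Faithfulness holds because the columns of `U` span `M ⊗ L⟦z⟧`.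

*Fullness.* An equivariant map of Tate modules extends to an `L⟦z⟧`-linear map whose matrix `F` is
Galois invariant, hence has entries in `K⟦z⟧`, and satisfies `T' σ(F) = F T`. The point is that over
a discretely valued `K` such an `F` has entries in `R⟦z⟧` (`exists_integral_matrix`). Only the
following is used: up to a power of `z - ζ`, the entries of `σ(F)` are `R⟦z⟧`-linear combinations of
those of `F`, and conversely (`FrobFamily`).

- `F` converges on the disc of radius `|ζ| ^ (1/2)` (`FrobFamily.growth`). Hence `σ ^ j (F)` has on
  this disc at most poles at `ζ, ζ ^ q, ζ ^ (q ^ 2), …` (`FrobFamily.growth_prod`).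
- For large `j` there is no pole at `ζ` (`FrobFamily.exists_growth_of_discrete`): multiplication by
  a `q ^ j`-th power removes the other poles and leaves coefficients which are `q ^ j`-th powers, so
  their valuations are divisible by `q ^ j`. A pole at `ζ` would make these valuations change in
  steps of a fixed multiple of `v(ζ)`, which is smaller than `q ^ j`. This is where discreteness
  enters.
- From `F = T' σ(F) T⁻¹` the absence of a pole at `ζ` descends from `σ ^ (j + 1) (F)` to
  `σ ^ j (F)`, as the factor introduces poles only at a point where `σ ^ j (F)` is known to converge
  (`FrobFamily.growth_descent`).
- Once `σ(F)` has no pole at `ζ`, the relation `σ(F) = T'⁻¹ F T` yields growth bounds for all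
  `σ ^ k (F)`. They bound the `q ^ k`-th power of a coefficient by an exponential function
  of `k`, so each coefficient has absolute value at most `1` (`FrobFamily.norm_coeff_le_one`).

For the rational Tate module one clears the powers of `z` in the denominators of `F`, on which `σ`
and the Galois group act trivially.
-/

namespace LocSht
universe v

/-! ### Growth of the coefficients of power series over an ultrametric field -/
section Growth

variable {K : Type*} [NormedField K]

/-- The coefficients of `f` satisfy `‖f_n‖ ≤ B s ^ n`; in particular `f` converges on the open disc
of radius `1 / s`. -/
def GrowthLE (B s : ℝ) (f : K⟦X⟧) : Prop := ∀ n, ‖PowerSeries.coeff n f‖ ≤ B * s ^ n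

namespace GrowthLE

variable {B B' s t : ℝ} {f g : K⟦X⟧}

theorem nonneg (hf : GrowthLE B s f) : 0 ≤ B := by
  simpa using (norm_nonneg _).trans (hf 0)

theorem mono (hf : GrowthLE B s f) (hB : B ≤ B') (hs : 0 ≤ s) (hst : s ≤ t) : GrowthLE B' t f :=
  fun n => (hf n).trans (mul_le_mul hB (pow_le_pow_left₀ hs hst n) (pow_nonneg hs n)
    (hf.nonneg.trans hB))

theorem one : GrowthLE 1 1 (1 : K⟦X⟧) := fun n => by
  rw [PowerSeries.coeff_one]
  split_ifs <;> simp

theorem X_sub_C {α : K} (hα : ‖α‖ ≤ 1) : GrowthLE 1 1 (PowerSeries.X - PowerSeries.C α) := by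
  intro n
  rcases n with _ | _ | n <;> simp [PowerSeries.coeff_X, hα]

variable [IsUltrametricDist K]

theorem sum {ι : Type*} {S : Finset ι} {f : ι → K⟦X⟧} (hB : 0 ≤ B) (hs : 0 ≤ s)
    (hf : ∀ i ∈ S, GrowthLE B s (f i)) : GrowthLE B s (∑ i ∈ S, f i) := fun n => by
  rw [map_sum]
  exact IsUltrametricDist.norm_sum_le_of_forall_le_of_nonneg (by positivity) fun i hi => hf i hi n

theorem mul (hs : 0 ≤ s) (hf : GrowthLE B s f) (hg : GrowthLE B' s g) :
    GrowthLE (B * B') s (f * g) := fun n => by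
  have h1 := hf.nonneg
  have h2 := hg.nonneg
  rw [PowerSeries.coeff_mul]
  refine IsUltrametricDist.norm_sum_le_of_forall_le_of_nonneg (by positivity) fun i hi => ?_
  rw [← Finset.HasAntidiagonal.mem_antidiagonal.mp hi, norm_mul, pow_add, mul_mul_mul_comm]
  exact mul_le_mul (hf _) (hg _) (norm_nonneg _) (by positivity)

/-- Multiplication by a power series with integral coefficients does not change the growth. -/
theorem integral_mul (hs : 1 ≤ s) (hf : GrowthLE 1 1 f) (hg : GrowthLE B s g) :
    GrowthLE B s (f * g) := by
  simpa using mul (zero_le_one.trans hs) (hf.mono le_rfl zero_le_one hs) hg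

theorem pow (hf : GrowthLE 1 1 f) (k : ℕ) : GrowthLE 1 1 (f ^ k) := by
  induction k with
  | zero => simpa using one
  | succ k ih => rw [pow_succ]; exact ih.integral_mul le_rfl hf

theorem prod {ι : Type*} {S : Finset ι} {f : ι → K⟦X⟧} (hf : ∀ i ∈ S, GrowthLE 1 1 (f i)) :
    GrowthLE 1 1 (∏ i ∈ S, f i) := by
  classical
  induction S using Finset.induction_on with
  | empty => simpa using one
  | insert i S hi ih =>
    rw [Finset.prod_insert hi]
    exact (hf i (Finset.mem_insert_self i S)).integral_mul le_rfl
      (ih fun j hj => hf j (Finset.mem_insert_of_mem hj))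

/-- If `(z - α) f` has growth `s` with `|α| s ≤ 1`, and `f` is already known to converge at `α`,
then `f` has growth `s`. -/
theorem of_X_sub_C_mul {α : K} (hs : 0 ≤ s) (hαs : ‖α‖ * s ≤ 1) (ht : 0 ≤ t) (hαt : ‖α‖ * t < 1)
    (h : GrowthLE B s ((PowerSeries.X - PowerSeries.C α) * f)) (hf : GrowthLE B' t f) :
    GrowthLE (B * s) s f := by
  intro n
  have hB := h.nonneg
  have hstep : ∀ m, ‖PowerSeries.coeff m f‖ ≤
      max (B * s ^ (m + 1)) (‖α‖ * ‖PowerSeries.coeff (m + 1) f‖) := by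
    intro m
    have h1 := h (m + 1)
    rw [sub_mul, map_sub, PowerSeries.coeff_succ_X_mul, PowerSeries.coeff_C_mul] at h1
    calc ‖PowerSeries.coeff m f‖
        = ‖(PowerSeries.coeff m f - α * PowerSeries.coeff (m + 1) f)
            + α * PowerSeries.coeff (m + 1) f‖ := by rw [sub_add_cancel]
      _ ≤ _ := (IsUltrametricDist.norm_add_le_max _ _).trans
            (max_le_max h1 (norm_mul _ _).le)
  have hiter : ∀ k, ‖PowerSeries.coeff n f‖ ≤
      max (B * s ^ (n + 1)) (‖α‖ ^ k * ‖PowerSeries.coeff (n + k) f‖) := by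
    intro k
    induction k with
    | zero => simp
    | succ k ih =>
      refine ih.trans (max_le (le_max_left _ _) ?_)
      refine (mul_le_mul_of_nonneg_left (hstep (n + k)) (by positivity)).trans ?_
      rw [mul_max_of_nonneg _ _ (by positivity : (0 : ℝ) ≤ ‖α‖ ^ k)]
      refine max_le_max ?_ (by rw [pow_succ, mul_assoc]; rfl)
      calc ‖α‖ ^ k * (B * s ^ (n + k + 1)) = (‖α‖ * s) ^ k * (B * s ^ (n + 1)) := by
            rw [mul_pow]; ring
        _ ≤ 1 * (B * s ^ (n + 1)) := by
            gcongr
            exact pow_le_one₀ (by positivity) hαs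
        _ = _ := one_mul _
  have hlim : Tendsto (fun k : ℕ => max (B * s ^ (n + 1)) (B' * t ^ n * (‖α‖ * t) ^ k)) atTop
      (𝓝 (max (B * s ^ (n + 1)) (B' * t ^ n * 0))) :=
    tendsto_const_nhds.max
      ((tendsto_pow_atTop_nhds_zero_of_lt_one (by positivity) hαt).const_mul _)
  have := ge_of_tendsto' hlim fun k => (hiter k).trans (max_le_max le_rfl (by
    calc ‖α‖ ^ k * ‖PowerSeries.coeff (n + k) f‖ ≤ ‖α‖ ^ k * (B' * t ^ (n + k)) := by
          gcongr
          exact hf _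
      _ = _ := by rw [mul_pow]; ring))
  rw [mul_zero, max_eq_left (by positivity)] at this
  rwa [mul_assoc, ← pow_succ']

theorem of_X_sub_C_pow_mul {α : K} (hα : ‖α‖ ≤ 1) (hs : 0 ≤ s) (hαs : ‖α‖ * s ≤ 1) (ht : 1 ≤ t)
    (hαt : ‖α‖ * t < 1) (e : ℕ) (h : GrowthLE B s ((PowerSeries.X - PowerSeries.C α) ^ e * f))
    (hf : GrowthLE B' t f) : GrowthLE (B * s ^ e) s f := by
  induction e generalizing B with
  | zero => simpa using h
  | succ e ih =>
    rw [pow_succ', mul_assoc] at h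
    have := ih (of_X_sub_C_mul hs hαs (zero_le_one.trans ht) hαt h
      (integral_mul ht ((X_sub_C hα).pow e) hf))
    rwa [mul_assoc, ← pow_succ'] at this

end GrowthLE

/-- If `|α| ^ Q |G_{n+Q}| ≠ |G_n|` whenever `G_n ≠ 0`, no cancellation takes place in the
coefficients of `(z ^ Q - α ^ Q) G`, so `G` grows no faster than this product. -/
theorem norm_coeff_le_of_no_cancellation [IsUltrametricDist K] {G : K⟦X⟧} {α : K} {Q : ℕ}
    (h : ∀ n, PowerSeries.coeff n G ≠ 0 →
      ‖α‖ ^ Q * ‖PowerSeries.coeff (n + Q) G‖ ≠ ‖PowerSeries.coeff n G‖) (n : ℕ) :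
    ‖PowerSeries.coeff n G‖ ≤
      ‖PowerSeries.coeff (n + Q) ((PowerSeries.X ^ Q - PowerSeries.C (α ^ Q)) * G)‖ := by
  rw [sub_mul, map_sub, PowerSeries.coeff_X_pow_mul, PowerSeries.coeff_C_mul]
  by_cases h0 : PowerSeries.coeff n G = 0
  · simp only [h0, norm_zero]
    exact norm_nonneg _
  · rw [sub_eq_add_neg, IsUltrametricDist.norm_add_eq_max_of_norm_ne_norm]
    · exact le_max_left _ _
    · rw [norm_neg, norm_mul, norm_pow]
      exact (h n h0).symm

end Growth

/-! ### Integrality of Frobenius-equivariant families of power series -/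
section Integrality

variable {K : Type*} [NormedField K] {q : ℕ} {σ : K →+* K}

theorem coeff_map_pow (hσ : ∀ x, σ x = x ^ q) (j : ℕ) (f : K⟦X⟧) (n : ℕ) :
    PowerSeries.coeff n ((PowerSeries.map σ ^ j) f) = PowerSeries.coeff n f ^ q ^ j := by
  induction j with
  | zero => simp
  | succ j ih =>
    rw [pow_succ', RingHom.mul_def, RingHom.comp_apply, PowerSeries.coeff_map, hσ, ih, ← pow_mul,
      ← pow_succ]

theorem map_pow_C (hσ : ∀ x, σ x = x ^ q) (j : ℕ) (α : K) :
    (PowerSeries.map σ ^ j) (PowerSeries.C α) = PowerSeries.C (α ^ q ^ j) := by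
  induction j with
  | zero => simp
  | succ j ih =>
    rw [pow_succ', RingHom.mul_def, RingHom.comp_apply, ih, PowerSeries.map_C, hσ, ← pow_mul,
      ← pow_succ]

theorem map_pow_X (j : ℕ) :
    (PowerSeries.map σ ^ j) (PowerSeries.X : K⟦X⟧) = PowerSeries.X := by
  induction j with
  | zero => simp
  | succ j ih => rw [pow_succ', RingHom.mul_def, RingHom.comp_apply, ih, PowerSeries.map_X]

theorem map_pow_X_sub_C (hσ : ∀ x, σ x = x ^ q) (j : ℕ) (α : K) :
    (PowerSeries.map σ ^ j) (PowerSeries.X - PowerSeries.C α) =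
      PowerSeries.X - PowerSeries.C (α ^ q ^ j) := by
  rw [map_sub, map_pow_X, map_pow_C hσ]

theorem GrowthLE.map_pow (hσ : ∀ x, σ x = x ^ q) {B s : ℝ} {f : K⟦X⟧} (hf : GrowthLE B s f)
    (j : ℕ) : GrowthLE (B ^ q ^ j) (s ^ q ^ j) ((PowerSeries.map σ ^ j) f) := fun n => by
  rw [coeff_map_pow hσ, norm_pow, ← pow_mul, mul_comm (q ^ j) n, pow_mul, ← mul_pow]
  exact pow_le_pow_left₀ (norm_nonneg _) (hf n) _

theorem GrowthLE.integral_map_pow (hσ : ∀ x, σ x = x ^ q) {f : K⟦X⟧} (hf : GrowthLE 1 1 f)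
    (j : ℕ) : GrowthLE 1 1 ((PowerSeries.map σ ^ j) f) := by
  simpa using hf.map_pow hσ j

variable [IsUltrametricDist K] {p k : ℕ} [Fact p.Prime] [CharP K p]

omit [IsUltrametricDist K] in
theorem X_sub_C_pow_q_pow (hq : q = p ^ k) (m : ℕ) (α : K) :
    (PowerSeries.X - PowerSeries.C α : K⟦X⟧) ^ q ^ m =
      PowerSeries.X ^ q ^ m - PowerSeries.C (α ^ q ^ m) := by
  have : CharP K⟦X⟧ p := charP_of_injective_ringHom (f := PowerSeries.C) PowerSeries.C_injective p
  rw [hq, ← pow_mul, sub_pow_char_pow, _root_.map_pow]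

/-- The situation of the integrality theorem: a finite family `f` of power series over `K` such
that, up to a factor `(z - ζ) ^ e`, the family `σ f` consists of `R⟦z⟧`-linear combinations of `f`
and conversely. -/
structure FrobFamily {ι : Type*} [Fintype ι] (q : ℕ) (σ : K →+* K) (ζ : K) (e : ℕ)
    (f : ι → K⟦X⟧) (c d : ι → ι → K⟦X⟧) : Prop where
  two_le : 2 ≤ q
  pow : ∀ x, σ x = x ^ q
  ζ_pos : 0 < ‖ζ‖
  ζ_lt : ‖ζ‖ < 1
  integral_c : ∀ i j, GrowthLE 1 1 (c i j)
  integral_d : ∀ i j, GrowthLE 1 1 (d i j)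
  frob : ∀ i, (PowerSeries.X - PowerSeries.C ζ) ^ e * PowerSeries.map σ (f i) = ∑ j, c i j * f j
  inv : ∀ i, (PowerSeries.X - PowerSeries.C ζ) ^ e * f i = ∑ j, d i j * PowerSeries.map σ (f j)

namespace FrobFamily

variable {ι : Type*} [Fintype ι] {ζ : K} {e : ℕ} {f : ι → K⟦X⟧} {c d : ι → ι → K⟦X⟧}

/-- The exponent `e` may be replaced by a power of `q`. -/
theorem frob_q_pow (h : FrobFamily q σ ζ e f c d) : ∃ c' : ι → ι → K⟦X⟧,
    (∀ i j, GrowthLE 1 1 (c' i j)) ∧ ∀ i, (PowerSeries.X - PowerSeries.C ζ) ^ q ^ e *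
      PowerSeries.map σ (f i) = ∑ j, c' i j * f j := by
  refine ⟨fun i j => (PowerSeries.X - PowerSeries.C ζ) ^ (q ^ e - e) * c i j, fun i j =>
    ((GrowthLE.X_sub_C h.ζ_lt.le).pow _).integral_mul le_rfl (h.integral_c i j), fun i => ?_⟩
  have he : q ^ e = (q ^ e - e) + e := by
    have := Nat.lt_pow_self (n := e) h.two_le
    omega
  rw [he, pow_add, mul_assoc, h.frob, Finset.mul_sum, ← he]
  simp only [mul_assoc]

/-- The family converges on the disc of radius `|ζ| ^ (1 / 2)`. -/
theorem growth (hq : q = p ^ k) (h : FrobFamily q σ ζ e f c d) {t : ℝ} (ht : 1 ≤ t)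
    (hζt : ‖ζ‖ * t ^ 2 = 1) : ∃ B, ∀ i, GrowthLE B t (f i) := by
  obtain ⟨c', hc', hf⟩ := h.frob_q_pow
  set Q := q ^ e with hQ
  have ha := h.ζ_pos
  set B : ℝ := (‖ζ‖ ^ Q)⁻¹ with hB
  have hB1 : 1 ≤ B := (one_le_inv₀ (by positivity)).mpr (pow_le_one₀ ha.le h.ζ_lt.le)
  have hBζ : ‖ζ‖ ^ Q * B = 1 := mul_inv_cancel₀ (by positivity)
  have ht0 : 0 < t := zero_lt_one.trans_le ht
  refine ⟨B, fun i n => ?_⟩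
  induction n using Nat.strong_induction_on generalizing i with
  | _ n ih =>
  have : Nonempty ι := ⟨i⟩
  obtain ⟨i₀, hi₀⟩ := Finite.exists_max fun i => ‖PowerSeries.coeff n (f i)‖
  refine (hi₀ i).trans ?_
  set x := ‖PowerSeries.coeff n (f i₀)‖ with hx
  by_contra! hlt
  have hyt : 1 ≤ B * t ^ n := one_le_mul_of_one_le_of_one_le hB1 (one_le_pow₀ ht)
  have hx1 : 1 < x := hyt.trans_lt hlt
  -- the coefficient of `z ^ n` in `(z ^ Q - ζ ^ Q) σ(f i₀) = ∑ c' f`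
  have hsum : ‖PowerSeries.coeff n (∑ j, c' i₀ j * f j)‖ ≤ x := by
    rw [map_sum]
    refine IsUltrametricDist.norm_sum_le_of_forall_le_of_nonneg (norm_nonneg _) fun j _ => ?_
    rw [PowerSeries.coeff_mul]
    refine IsUltrametricDist.norm_sum_le_of_forall_le_of_nonneg (norm_nonneg _) fun r hr => ?_
    have hr := Finset.HasAntidiagonal.mem_antidiagonal.mp hr
    have hc1 : ‖PowerSeries.coeff r.1 (c' i₀ j)‖ ≤ 1 := by simpa using hc' i₀ j r.1
    have hf1 : ‖PowerSeries.coeff r.2 (f j)‖ ≤ x := by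
      rcases (show r.2 ≤ n by omega).lt_or_eq with h' | h'
      · refine (ih _ h' j).trans ((mul_le_mul_of_nonneg_left ?_ (by positivity)).trans hlt.le)
        exact pow_le_pow_right₀ ht h'.le
      · rw [h']; exact hi₀ j
    rw [norm_mul]
    exact (mul_le_mul hc1 hf1 (norm_nonneg _) zero_le_one).trans (one_mul _).le
  have key : ‖ζ‖ ^ Q * x ^ q ≤
      max (if Q ≤ n then ‖PowerSeries.coeff (n - Q) (f i₀)‖ ^ q else 0) x := by
    have h1 := congrArg (PowerSeries.coeff n) (hf i₀)
    rw [X_sub_C_pow_q_pow hq, sub_mul, map_sub, PowerSeries.coeff_X_pow_mul',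
      PowerSeries.coeff_C_mul, PowerSeries.coeff_map, PowerSeries.coeff_map, h.pow, h.pow,
      sub_eq_iff_eq_add', ← sub_eq_iff_eq_add] at h1
    have h2 : ‖ζ‖ ^ Q * x ^ q = ‖ζ ^ Q * PowerSeries.coeff n (f i₀) ^ q‖ := by
      rw [norm_mul, norm_pow, norm_pow]
    rw [h2, ← h1, sub_eq_add_neg]
    refine (IsUltrametricDist.norm_add_le_max _ _).trans (max_le_max ?_ ?_)
    · split_ifs
      · exact (norm_pow _ _).le
      · exact norm_zero.le
    · rwa [norm_neg]
  rcases le_max_iff.mp key with h1 | h1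
  · split_ifs at h1 with hQn
    · have h2 := ih (n - Q) (Nat.sub_lt_self (pow_pos (by have := h.two_le; omega) _) hQn) i₀
      have h3 : (B * t ^ n) ^ q < x ^ q :=
        pow_lt_pow_left₀ hlt (by positivity) (by have := h.two_le; omega)
      have h4 : 1 ≤ ‖ζ‖ ^ Q * (t ^ Q) ^ q := by
        calc (1 : ℝ) = ‖ζ‖ ^ Q * (t ^ Q) ^ 2 := by
              rw [← pow_mul, mul_comm Q, pow_mul, ← mul_pow, hζt, one_pow]
          _ ≤ _ := by
              gcongr
              · exact one_le_pow₀ ht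
              · exact h.two_le
      have h5 : (B * t ^ n) ^ q = (B * t ^ (n - Q)) ^ q * (t ^ Q) ^ q := by
        rw [← mul_pow, mul_assoc, ← pow_add, Nat.sub_add_cancel hQn]
      have h6 : ‖PowerSeries.coeff (n - Q) (f i₀)‖ ^ q ≤ (B * t ^ (n - Q)) ^ q :=
        pow_le_pow_left₀ (norm_nonneg _) h2 q
      have h7 : (B * t ^ (n - Q)) ^ q * 1 ≤
          (B * t ^ (n - Q)) ^ q * (‖ζ‖ ^ Q * (t ^ Q) ^ q) := by gcongr
      have h8 : ‖ζ‖ ^ Q * (B * t ^ n) ^ q < ‖ζ‖ ^ Q * x ^ q := by gcongr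
      rw [h5] at h8
      linarith
    · exact absurd h1 (not_le.mpr (by positivity))
  · have h2 : ‖ζ‖ ^ Q * (x * x) ≤ ‖ζ‖ ^ Q * x ^ q := by
      gcongr
      rw [← sq]
      exact pow_le_pow_right₀ hx1.le h.two_le
    have h3 : ‖ζ‖ ^ Q * (x * x) > x * t ^ n := by
      calc x * t ^ n = ‖ζ‖ ^ Q * (x * (B * t ^ n)) := by linear_combination (-x * t ^ n) * hBζ
        _ < _ := by gcongr
    have h4 : x * 1 ≤ x * t ^ n := by gcongr; exact one_le_pow₀ ht
    linarith

omit [IsUltrametricDist K] in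
theorem frob_map_pow (h : FrobFamily q σ ζ e f c d) (m : ℕ) (i : ι) :
    (PowerSeries.X - PowerSeries.C (ζ ^ q ^ m)) ^ e * (PowerSeries.map σ ^ (m + 1)) (f i) =
      ∑ j, (PowerSeries.map σ ^ m) (c i j) * (PowerSeries.map σ ^ m) (f j) := by
  have := congrArg (PowerSeries.map σ ^ m) (h.frob i)
  simpa only [map_mul, map_pow, map_sum, map_pow_X_sub_C h.pow, pow_succ, RingHom.mul_def,
    RingHom.comp_apply] using this

omit [IsUltrametricDist K] in
theorem inv_map_pow (h : FrobFamily q σ ζ e f c d) (m : ℕ) (i : ι) :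
    (PowerSeries.X - PowerSeries.C (ζ ^ q ^ m)) ^ e * (PowerSeries.map σ ^ m) (f i) =
      ∑ j, (PowerSeries.map σ ^ m) (d i j) * (PowerSeries.map σ ^ (m + 1)) (f j) := by
  have := congrArg (PowerSeries.map σ ^ m) (h.inv i)
  simpa only [map_mul, map_pow, map_sum, map_pow_X_sub_C h.pow, pow_succ, RingHom.mul_def,
    RingHom.comp_apply] using this

omit [IsUltrametricDist K] in
theorem integral_X_sub_C (h : FrobFamily q σ ζ e f c d) (m : ℕ) :
    GrowthLE 1 1 (PowerSeries.X - PowerSeries.C (ζ ^ m)) :=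
  GrowthLE.X_sub_C (by rw [norm_pow]; exact pow_le_one₀ (norm_nonneg _) h.ζ_lt.le)

/-- On the disc of radius `1 / t = |ζ| ^ (1 / 2)`, the family `σ ^ j f` has poles at most at the
points `ζ ^ (q ^ l)` with `l < j`. -/
theorem growth_prod (hq : q = p ^ k) (h : FrobFamily q σ ζ e f c d) {t : ℝ} (ht : 1 ≤ t)
    (hζt : ‖ζ‖ * t ^ 2 = 1) (j : ℕ) : ∃ B, ∀ i, GrowthLE B t
      ((∏ l ∈ Finset.range j, (PowerSeries.X - PowerSeries.C (ζ ^ q ^ l))) ^ q ^ e *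
        (PowerSeries.map σ ^ j) (f i)) := by
  obtain ⟨c', hc', hf⟩ := h.frob_q_pow
  induction j with
  | zero => simpa using h.growth hq ht hζt
  | succ j ih =>
    obtain ⟨B, hB⟩ := ih
    refine ⟨B, fun i => ?_⟩
    have h1 := congrArg (PowerSeries.map σ ^ j) (hf i)
    rw [map_mul, map_pow, map_pow_X_sub_C h.pow, map_sum] at h1
    simp only [map_mul] at h1
    rw [Finset.prod_range_succ, mul_pow, mul_assoc, pow_succ, RingHom.mul_def, RingHom.comp_apply,
      h1, Finset.mul_sum]
    refine GrowthLE.sum (hB i).nonneg (zero_le_one.trans ht) fun l _ => ?_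
    rw [mul_left_comm]
    exact ((hc' i l).integral_map_pow h.pow j).integral_mul ht (hB l)

/-- Over a discretely valued field, `σ ^ (j + 1) f` has no pole at `ζ` for large `j`: after
multiplication by a `q ^ (j + 1)`-th power which removes the other poles, the valuations of its
coefficients are divisible by `q ^ (j + 1)`, whereas a pole at `ζ` makes these valuations vary in
steps of `q ^ e v(ζ)`. -/
theorem exists_growth_of_discrete (hq : q = p ^ k) (h : FrobFamily q σ ζ e f c d) {t : ℝ}
    (ht : 1 ≤ t) (hζt : ‖ζ‖ * t ^ 2 = 1) {δ : ℝ} (hδ : δ < 1) (hdisc : ∀ x : K, ‖x‖ < 1 → ‖x‖ ≤ δ) :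
    ∃ (j N : ℕ) (B : ℝ), ∀ i, GrowthLE B t
      ((∏ l ∈ Finset.range j, (PowerSeries.X - PowerSeries.C (ζ ^ q ^ (l + 1)))) ^ N *
        (PowerSeries.map σ ^ (j + 1)) (f i)) := by
  have hδ0 : 0 ≤ δ := by simpa using hdisc 0 (by simp)
  have ha := h.ζ_pos
  set Q := q ^ e with hQ
  have hQ0 : Q ≠ 0 := pow_ne_zero _ (by have := h.two_le; omega)
  obtain ⟨j, hj⟩ := exists_pow_lt_of_lt_one (show 0 < ‖ζ‖ ^ Q by positivity) hδ
  have hjm : δ ^ q ^ (j + 1) < ‖ζ‖ ^ Q := by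
    refine (pow_le_pow_of_le_one hδ0 hδ.le ?_).trans_lt hj
    exact (Nat.lt_succ_self j).le.trans (Nat.lt_pow_self h.two_le).le
  set m := q ^ (j + 1) with hm
  have hm0 : m ≠ 0 := pow_ne_zero _ (by have := h.two_le; omega)
  obtain ⟨B, hB⟩ := h.growth_prod hq ht hζt (j + 1)
  set E := ∏ l ∈ Finset.range j, (PowerSeries.X - PowerSeries.C (ζ ^ q ^ (l + 1))) with hE
  have hE1 : GrowthLE 1 1 E := GrowthLE.prod fun l _ => h.integral_X_sub_C _
  refine ⟨j, m * Q, B * t ^ Q, fun i n => ?_⟩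
  have hmem : E ^ (m * Q) * (PowerSeries.map σ ^ (j + 1)) (f i) ∈
      (PowerSeries.map σ ^ (j + 1)).range := by
    refine mul_mem ?_ ⟨_, rfl⟩
    rw [pow_mul, hE, ← Finset.prod_pow]
    refine pow_mem (prod_mem fun l _ => ?_) _
    refine ⟨PowerSeries.X ^ m - PowerSeries.C (ζ ^ q ^ (l + 1)), ?_⟩
    rw [hm, X_sub_C_pow_q_pow hq, map_sub, map_pow, map_pow_X, map_pow_C h.pow]
  obtain ⟨g, hg⟩ := hmem
  have hH : GrowthLE B t ((PowerSeries.X ^ Q - PowerSeries.C (ζ ^ Q)) *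
      (E ^ (m * Q) * (PowerSeries.map σ ^ (j + 1)) (f i))) := by
    have hsplit : m * Q = (m * Q - Q) + Q :=
      (Nat.sub_add_cancel (Nat.le_mul_of_pos_left Q (Nat.pos_of_ne_zero hm0))).symm
    have := (hE1.pow (m * Q - Q)).integral_mul ht (hB i)
    rw [Finset.prod_range_succ', ← hE, pow_zero, pow_one, mul_pow, X_sub_C_pow_q_pow hq,
      ← hQ] at this
    rw [hsplit, pow_add]
    convert this using 1
    ring
  refine (norm_coeff_le_of_no_cancellation (α := ζ) (Q := Q) (fun r hr heq => ?_) n).trans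
    ((hH (n + Q)).trans (by rw [pow_add]; linarith))
  rw [← hg, coeff_map_pow h.pow] at hr heq
  rw [coeff_map_pow h.pow, norm_pow, norm_pow, ← hm] at heq
  set x := PowerSeries.coeff (r + Q) g
  set y := PowerSeries.coeff r g
  have hy : y ≠ 0 := fun h0 => hr (by rw [h0, zero_pow hm0])
  have hx : x ≠ 0 := by
    intro h0
    rw [h0, norm_zero, zero_pow hm0, mul_zero] at heq
    exact (pow_ne_zero m (norm_ne_zero_iff.mpr hy)) heq.symm
  have hu : ‖y / x‖ ^ m = ‖ζ‖ ^ Q := by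
    rw [norm_div, div_pow, ← heq]
    exact mul_div_cancel_right₀ _ (pow_ne_zero m (norm_ne_zero_iff.mpr hx))
  have hu1 : ‖y / x‖ < 1 := by
    by_contra! hle
    have := one_le_pow₀ hle (n := m)
    rw [hu] at this
    exact absurd (pow_lt_one₀ ha.le h.ζ_lt hQ0) (not_lt.mpr this)
  have := pow_le_pow_left₀ (norm_nonneg _) (hdisc _ hu1) m
  rw [hu] at this
  linarith

/-- If `σ ^ (j + 2) f` has no pole at `ζ`, then neither has `σ ^ (j + 1) f`. -/
theorem growth_descent (hq : q = p ^ k) (h : FrobFamily q σ ζ e f c d) {t : ℝ}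
    (ht : 1 ≤ t) (hζt : ‖ζ‖ * t ^ 2 = 1) (hζt1 : ‖ζ‖ * t < 1) (j : ℕ)
    (hj : ∃ (N : ℕ) (B : ℝ), ∀ i, GrowthLE B t
      ((∏ l ∈ Finset.range j, (PowerSeries.X - PowerSeries.C (ζ ^ q ^ (l + 1)))) ^ N *
        (PowerSeries.map σ ^ (j + 1)) (f i))) :
    ∃ B, ∀ i, GrowthLE B t (PowerSeries.map σ (f i)) := by
  have ht0 := zero_le_one.trans ht
  induction j with
  | zero => simpa using hj
  | succ j ih =>
    obtain ⟨N, B, hB⟩ := hj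
    obtain ⟨B₀, hB₀⟩ := h.growth hq ht hζt
    refine ih ⟨N, B * t ^ (N + e), fun i => ?_⟩
    set E := ∏ l ∈ Finset.range j, (PowerSeries.X - PowerSeries.C (ζ ^ q ^ (l + 1))) with hE
    have hE1 : GrowthLE 1 1 E := GrowthLE.prod fun l _ => h.integral_X_sub_C _
    have hq0 : q ^ (j + 1) ≠ 0 := pow_ne_zero _ (by have := h.two_le; omega)
    -- `f` itself converges at `ζ`, so `σ ^ (j + 1) f` converges at `ζ ^ (q ^ (j + 1))`
    refine GrowthLE.of_X_sub_C_pow_mul (α := ζ ^ q ^ (j + 1)) (t := t ^ q ^ (j + 1)) ?_ ht0 ?_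
      (one_le_pow₀ ht) ?_ (N + e) ?_ ((hE1.pow N).integral_mul (one_le_pow₀ ht)
        ((hB₀ i).map_pow h.pow (j + 1)))
    · rw [norm_pow]; exact pow_le_one₀ (norm_nonneg _) h.ζ_lt.le
    · rw [norm_pow]
      refine (mul_le_mul_of_nonneg_right ?_ ht0).trans hζt1.le
      exact pow_le_of_le_one (norm_nonneg _) h.ζ_lt.le hq0
    · rw [norm_pow, ← mul_pow]
      exact pow_lt_one₀ (by positivity) hζt1 hq0
    · have h1 := h.inv_map_pow (j + 1) i
      have h2 : (PowerSeries.X - PowerSeries.C (ζ ^ q ^ (j + 1))) ^ (N + e) *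
          (E ^ N * (PowerSeries.map σ ^ (j + 1)) (f i)) =
          ∑ r, (PowerSeries.map σ ^ (j + 1)) (d i r) *
            ((∏ l ∈ Finset.range (j + 1), (PowerSeries.X - PowerSeries.C (ζ ^ q ^ (l + 1)))) ^ N *
              (PowerSeries.map σ ^ (j + 1 + 1)) (f r)) := by
        rw [Finset.prod_range_succ, ← hE]
        simp only [mul_left_comm _ ((E * _) ^ N)]
        rw [← Finset.mul_sum, ← h1, mul_pow, pow_add]
        ring
      rw [h2]
      exact GrowthLE.sum (hB i).nonneg ht0 fun r _ =>
        ((h.integral_d i r).integral_map_pow h.pow _).integral_mul ht (hB r)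

/-- Once `σ f` converges at `ζ`, so do all `σ ^ (m + 1) f`, with a growth which is uniform enough to
force the coefficients of `f` to be integral. -/
theorem growth_map_pow (h : FrobFamily q σ ζ e f c d) {t : ℝ} (ht : 1 ≤ t) (hζt1 : ‖ζ‖ * t < 1)
    {B : ℝ} (hB : ∀ i, GrowthLE B t (PowerSeries.map σ (f i))) (m : ℕ) (i : ι) :
    GrowthLE (B * t ^ (e * m)) t ((PowerSeries.map σ ^ (m + 1)) (f i)) := by
  have ht0 := zero_le_one.trans ht
  induction m generalizing i with
  | zero => simpa using hB i
  | succ m ih =>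
    have hq0 : q ^ (m + 1) ≠ 0 := pow_ne_zero _ (by have := h.two_le; omega)
    have := GrowthLE.of_X_sub_C_pow_mul (α := ζ ^ q ^ (m + 1)) (s := t) (t := t ^ q ^ (m + 1))
      (f := (PowerSeries.map σ ^ (m + 1 + 1)) (f i)) (B := B * t ^ (e * m)) ?_ ht0 ?_
      (one_le_pow₀ ht) ?_ e ?_ ((hB i).map_pow h.pow (m + 1))
    · rwa [mul_assoc, ← pow_add] at this
    · rw [norm_pow]; exact pow_le_one₀ (norm_nonneg _) h.ζ_lt.le
    · rw [norm_pow]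
      refine (mul_le_mul_of_nonneg_right ?_ ht0).trans hζt1.le
      exact pow_le_of_le_one (norm_nonneg _) h.ζ_lt.le hq0
    · rw [norm_pow, ← mul_pow]
      exact pow_lt_one₀ (by positivity) hζt1 hq0
    · rw [h.frob_map_pow]
      exact GrowthLE.sum (ih i).nonneg ht0 fun r _ =>
        ((h.integral_c i r).integral_map_pow h.pow _).integral_mul ht (ih r)

/-- Over a discretely valued field, all members of a Frobenius-equivariant family have integral
coefficients. -/
theorem norm_coeff_le_one (hq : q = p ^ k) (h : FrobFamily q σ ζ e f c d) {δ : ℝ} (hδ : δ < 1)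
    (hdisc : ∀ x : K, ‖x‖ < 1 → ‖x‖ ≤ δ) (i : ι) (n : ℕ) : ‖PowerSeries.coeff n (f i)‖ ≤ 1 := by
  have ha := h.ζ_pos
  set t : ℝ := (Real.sqrt ‖ζ‖)⁻¹ with htdef
  have hs0 : 0 < Real.sqrt ‖ζ‖ := Real.sqrt_pos.mpr ha
  have hs1 : Real.sqrt ‖ζ‖ < 1 := by
    rw [Real.sqrt_lt' one_pos, one_pow]; exact h.ζ_lt
  have hss : Real.sqrt ‖ζ‖ ^ 2 = ‖ζ‖ := Real.sq_sqrt ha.le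
  have ht : 1 ≤ t := (one_le_inv₀ hs0).mpr hs1.le
  have hζt : ‖ζ‖ * t ^ 2 = 1 := by
    rw [htdef, inv_pow, hss]; exact mul_inv_cancel₀ ha.ne'
  have hζt1 : ‖ζ‖ * t < 1 := by
    have : ‖ζ‖ * t = Real.sqrt ‖ζ‖ := by
      rw [htdef, ← hss, Real.sqrt_sq hs0.le, sq, mul_assoc, mul_inv_cancel₀ hs0.ne', mul_one]
    rwa [this]
  obtain ⟨j, N, B, hB⟩ := h.exists_growth_of_discrete hq ht hζt hδ hdisc
  obtain ⟨B, hB⟩ := h.growth_descent hq ht hζt hζt1 j ⟨N, B, hB⟩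
  by_contra! hlt
  set x := ‖PowerSeries.coeff n (f i)‖ with hx
  -- `x ^ (2 ^ (m + 1))` would be bounded by an exponential function of `m`
  have hbound : ∀ m : ℕ, x ^ q ^ (m + 1) ≤ B * t ^ n * (t ^ e) ^ m := by
    intro m
    have := h.growth_map_pow ht hζt1 hB m i n
    rw [coeff_map_pow h.pow, norm_pow, ← hx] at this
    refine this.trans_eq ?_
    rw [pow_mul]; ring
  obtain ⟨N₁, hN₁⟩ := pow_unbounded_of_one_lt (B * t ^ n) hlt
  obtain ⟨N₂, hN₂⟩ := pow_unbounded_of_one_lt (t ^ e) hlt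
  set s := N₁ + N₂ with hs
  have h1 : x ^ q ^ (2 * s + 1) ≤ x ^ (N₁ + N₂ * (2 * s)) := by
    refine (hbound (2 * s)).trans ?_
    rw [pow_add, pow_mul x N₂]
    exact mul_le_mul hN₁.le (pow_le_pow_left₀ (by positivity) hN₂.le _) (by positivity)
      (by positivity)
  have h2 : q ^ (2 * s + 1) ≤ N₁ + N₂ * (2 * s) := (pow_le_pow_iff_right₀ hlt).mp h1
  have h3 : 2 ^ (2 * s + 1) ≤ q ^ (2 * s + 1) := Nat.pow_le_pow_left h.two_le _
  have h4 : 2 ^ (2 * s + 1) = 2 * (2 ^ s * 2 ^ s) := by ring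
  have h5 : s + 1 ≤ 2 ^ s := Nat.lt_pow_self one_lt_two
  have h6 : (s + 1) * (s + 1) ≤ 2 ^ s * 2 ^ s := Nat.mul_le_mul h5 h5
  nlinarith [Nat.zero_le (N₁ * s), Nat.zero_le N₁, Nat.zero_le N₂]

end FrobFamily
end Integrality

/-! ### Frobenius-semilinear maps over a separably closed field -/
section Lang

variable {L : Type*} [Field L] [IsSepClosed L] {q : ℕ} {σ : L →+* L}

/-- Artin-Schreier equations are solvable over a separably closed field. -/
theorem exists_eq_pow_add (hq0 : (q : L) = 0) (w : L) : ∃ y : L, y = y ^ q + w := by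
  let P : Polynomial L := Polynomial.X ^ q - Polynomial.X + Polynomial.C w
  have hder : Polynomial.derivative P = -1 := by simp [P, Polynomial.derivative_X_pow, hq0]
  have hdeg : P.degree ≠ 0 := by
    intro h
    rw [Polynomial.eq_C_of_degree_eq_zero h, Polynomial.derivative_C] at hder
    simp at hder
  have hsep : P.Separable := by
    rw [Polynomial.separable_def, hder]
    exact isCoprime_one_right.neg_right
  obtain ⟨y, hy⟩ := IsSepClosed.exists_root P hdeg hsep
  refine ⟨y, ?_⟩
  have : y ^ q - y + w = 0 := by simpa [P] using hy
  linear_combination -this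

/-- The polynomials `P_0 = a_0 X ^ q` and `P_{i+1} = P_i ^ q + a_{i+1} X ^ q`. -/
noncomputable def fixedPoly (q : ℕ) (a : ℕ → L) : ℕ → Polynomial L
  | 0 => Polynomial.C (a 0) * Polynomial.X ^ q
  | i + 1 => fixedPoly q a i ^ q + Polynomial.C (a (i + 1)) * Polynomial.X ^ q

omit [IsSepClosed L] in
theorem derivative_fixedPoly (hq0 : (q : L) = 0) (a : ℕ → L) (i : ℕ) :
    Polynomial.derivative (fixedPoly q a i) = 0 := by
  cases i <;> simp [fixedPoly, Polynomial.derivative_pow, hq0]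

omit [IsSepClosed L] in
theorem X_pow_dvd_fixedPoly (hq : 1 < q) (a : ℕ → L) (i : ℕ) :
    (Polynomial.X : Polynomial L) ^ q ∣ fixedPoly q a i := by
  induction i with
  | zero => exact dvd_mul_left _ _
  | succ i ih =>
    exact dvd_add (ih.trans (dvd_pow_self _ (by omega))) (dvd_mul_left _ _)

omit [IsSepClosed L] in
theorem eq_zero_of_fixedPoly_eq_zero (hq : 1 < q) (a : ℕ → L) (i : ℕ) (h : fixedPoly q a i = 0) :
    ∀ l ≤ i, a l = 0 := by
  induction i with
  | zero =>
    intro l hl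
    obtain rfl : l = 0 := by omega
    simpa [fixedPoly] using h
  | succ i ih =>
    have h0 : (fixedPoly q a i ^ q).coeff q = 0 := by
      have h1 : (Polynomial.X : Polynomial L) ^ (q * q) ∣ fixedPoly q a i ^ q := by
        rw [pow_mul]; exact pow_dvd_pow_of_dvd (X_pow_dvd_fixedPoly hq a i) q
      exact Polynomial.X_pow_dvd_iff.mp h1 q (by nlinarith)
    have ha : a (i + 1) = 0 := by
      have := congrArg (Polynomial.coeff · q) h
      simpa [fixedPoly, h0] using this
    have hi : fixedPoly q a i = 0 := by
      rw [fixedPoly, ha, map_zero, zero_mul, add_zero] at h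
      exact eq_zero_of_pow_eq_zero h
    intro l hl
    rcases hl.lt_or_eq with hl | rfl
    · exact ih hi l (by omega)
    · exact ha

theorem exists_ne_zero_eval_fixedPoly (hq : 1 < q) (hq0 : (q : L) = 0) (a : ℕ → L) (i l : ℕ)
    (hl : l ≤ i) (ha : a l ≠ 0) : ∃ y : L, y ≠ 0 ∧ (fixedPoly q a i).eval y = y := by
  set P := fixedPoly q a i - Polynomial.X with hP
  have hder : Polynomial.derivative P = -1 := by
    rw [hP, Polynomial.derivative_sub, derivative_fixedPoly hq0, Polynomial.derivative_X, zero_sub]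
  have hsep : P.Separable := by
    rw [Polynomial.separable_def, hder]
    exact isCoprime_one_right.neg_right
  obtain ⟨S, hS⟩ : Polynomial.X ∣ P :=
    dvd_sub ((dvd_pow_self _ (by omega)).trans (X_pow_dvd_fixedPoly hq a i)) dvd_rfl
  have hS0 : S.eval 0 = -1 := by
    have := congrArg (Polynomial.eval 0) hder
    rw [hS] at this
    simpa using this
  have hdeg : S.degree ≠ 0 := by
    intro hd
    rw [Polynomial.eq_C_of_degree_eq_zero hd] at hS hS0
    rw [Polynomial.eval_C] at hS0
    rw [hS0, hP] at hS
    have : fixedPoly q a i = 0 := by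
      have h1 : fixedPoly q a i = (fixedPoly q a i - Polynomial.X) + Polynomial.X := by ring
      rw [h1, hS]
      simp
    exact ha (eq_zero_of_fixedPoly_eq_zero hq a i this l hl)
  obtain ⟨y, hy⟩ := IsSepClosed.exists_root S hdeg (hsep.of_dvd (hS ▸ dvd_mul_left _ _))
  refine ⟨y, ?_, ?_⟩
  · rintro rfl
    rw [Polynomial.IsRoot, hS0] at hy
    simp at hy
  · have : P.eval y = 0 := by rw [hS, Polynomial.eval_mul, hy, mul_zero]
    rw [hP, Polynomial.eval_sub, Polynomial.eval_X] at this
    exact sub_eq_zero.mp this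

variable {V : Type*} [AddCommGroup V] [Module L V] [FiniteDimensional L V]

/-- An injective Frobenius-semilinear endomorphism has a nonzero fixed vector: such a vector is
found in the span of an orbit `v, φ v, φ² v, …` of minimal length. -/
theorem exists_ne_zero_fixed (hq : 1 < q) (hq0 : (q : L) = 0) (hσ : ∀ x, σ x = x ^ q)
    [Nontrivial V] (φ : V →ₛₗ[σ] V) (hφ : Function.Injective φ) : ∃ x : V, x ≠ 0 ∧ φ x = x := by
  classical
  obtain ⟨v, hv⟩ := exists_ne (0 : V)
  let u : ℕ → V := fun i => φ^[i] v
  have hu : ∀ i, φ (u i) = u (i + 1) := fun i => (Function.iterate_succ_apply' φ i v).symm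
  have hu0 : ∀ i, u i ≠ 0 := by
    intro i
    induction i with
    | zero => exact hv
    | succ i ih => rw [← hu, Ne, map_eq_zero_iff φ hφ]; exact ih
  have hex : ∃ n, u n ∈ Submodule.span L (u '' Set.Iio n) := by
    obtain ⟨n, hn⟩ := monotone_stabilizes_iff_noetherian.mpr (inferInstance : IsNoetherian L V)
      ⟨fun n => Submodule.span L (u '' Set.Iio n), fun m n h =>
        Submodule.span_mono (Set.image_mono (Set.Iio_subset_Iio h))⟩
    refine ⟨n, ?_⟩
    have h1 := hn (n + 1) (Nat.le_succ n)
    change Submodule.span L (u '' Set.Iio n) = Submodule.span L (u '' Set.Iio (n + 1)) at h1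
    rw [h1]
    exact Submodule.subset_span ⟨n, Nat.lt_succ_self n, rfl⟩
  set n := Nat.find hex with hn
  have hmem := Nat.find_spec hex
  have hmin : ∀ m < n, u m ∉ Submodule.span L (u '' Set.Iio m) := fun m hm => Nat.find_min hex hm
  obtain ⟨m, hm⟩ : ∃ m, n = m + 1 := Nat.exists_eq_succ_of_ne_zero (by
    intro h0
    rw [← hn, h0] at hmem
    simp at hmem
    exact hu0 0 hmem)
  rw [← hn, hm] at hmem
  obtain ⟨a, ha⟩ : ∃ a : ℕ → L, ∑ i ∈ Finset.range (m + 1), a i • u i = u (m + 1) := by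
    rw [← Finset.coe_range] at hmem
    exact Submodule.mem_span_image_finset_iff_exists_fun' L |>.mp hmem
  obtain ⟨l, hl, hal⟩ : ∃ l ≤ m, a l ≠ 0 := by
    by_contra! hall
    refine hu0 (m + 1) ?_
    rw [← ha]
    refine Finset.sum_eq_zero fun i hi => ?_
    rw [hall i (by have := Finset.mem_range.mp hi; omega), zero_smul]
  obtain ⟨y, hy0, hy⟩ := exists_ne_zero_eval_fixedPoly hq hq0 a m l hl hal
  refine ⟨∑ i ∈ Finset.range (m + 1), (fixedPoly q a i).eval y • u i, ?_, ?_⟩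
  · intro h0
    rw [Finset.sum_range_succ, hy] at h0
    refine hmin m (by omega) ?_
    have h1 : u m = -(y⁻¹ • ∑ i ∈ Finset.range m, (fixedPoly q a i).eval y • u i) := by
      rw [eq_neg_iff_add_eq_zero, add_comm, ← smul_right_injective V hy0 |>.eq_iff]
      simp only [smul_add, smul_zero, smul_inv_smul₀ hy0]
      exact h0
    rw [h1]
    refine neg_mem (Submodule.smul_mem _ _ (sum_mem fun i hi => Submodule.smul_mem _ _
      (Submodule.subset_span ⟨i, Finset.mem_range.mp hi, rfl⟩)))
  · rw [map_sum]
    simp only [map_smulₛₗ, hσ, hu]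
    rw [Finset.sum_range_succ, hy, ← ha, Finset.smul_sum, Finset.sum_range_succ', ← add_assoc,
      ← Finset.sum_add_distrib, Finset.sum_range_succ']
    simp only [fixedPoly, Polynomial.eval_add, Polynomial.eval_mul, Polynomial.eval_pow,
      Polynomial.eval_C, Polynomial.eval_X, add_smul, mul_comm (a _), mul_smul]

/-- A Frobenius-semilinear endomorphism whose image spans the space is injective. -/
theorem injective_of_span_range {L : Type*} [Field L] {σ : L →+* L} {V : Type*} [AddCommGroup V]
    [Module L V] [FiniteDimensional L V] (φ : V →ₛₗ[σ] V)
    (hφ : Submodule.span L (Set.range φ) = ⊤) : Function.Injective φ := by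
  let b := Module.finBasis L V
  have hspan : ⊤ ≤ Submodule.span L (Set.range fun i => φ (b i)) := by
    rw [← hφ, Submodule.span_le]
    rintro _ ⟨x, rfl⟩
    rw [← b.sum_repr x, map_sum]
    simp only [map_smulₛₗ]
    exact sum_mem fun i _ => Submodule.smul_mem _ _ (Submodule.subset_span ⟨i, rfl⟩)
  have hli : LinearIndependent L fun i => φ (b i) :=
    linearIndependent_of_top_le_span_of_card_eq_finrank hspan (by simp)
  rw [injective_iff_map_eq_zero]
  intro x hx
  rw [← b.sum_repr x, map_sum] at hx
  simp only [map_smulₛₗ] at hx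
  have := Fintype.linearIndependent_iff.mp hli _ hx
  refine b.ext_elem fun i => ?_
  simpa using this i

/-- Lang's theorem: the fixed vectors of a Frobenius-semilinear endomorphism whose image spans the
space span the space. -/
theorem span_fixed_eq_top (hq : 1 < q) (hq0 : (q : L) = 0) (hσ : ∀ x, σ x = x ^ q)
    (φ : V →ₛₗ[σ] V) (hφ : Submodule.span L (Set.range φ) = ⊤) :
    Submodule.span L {x | φ x = x} = ⊤ := by
  set W := Submodule.span L {x | φ x = x} with hW
  by_contra hne
  have hφW : W ≤ W.comap φ := by
    rw [hW, Submodule.span_le]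
    intro x hx
    change φ x ∈ W
    rw [show φ x = x from hx]
    exact Submodule.subset_span hx
  have : Nontrivial (V ⧸ W) := Submodule.Quotient.nontrivial_iff.mpr hne
  let ψ : V ⧸ W →ₛₗ[σ] V ⧸ W := W.mapQ W φ hφW
  have hψ : Submodule.span L (Set.range ψ) = ⊤ := by
    have h1 := congrArg (Submodule.map W.mkQ) hφ
    rw [Submodule.map_span, Submodule.map_top, Submodule.range_mkQ] at h1
    rw [← h1]
    congr 1
    ext x
    constructor
    · rintro ⟨y, rfl⟩
      obtain ⟨y, rfl⟩ := W.mkQ_surjective y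
      exact ⟨φ y, ⟨y, rfl⟩, rfl⟩
    · rintro ⟨_, ⟨y, rfl⟩, rfl⟩
      exact ⟨W.mkQ y, rfl⟩
  obtain ⟨x, hx0, hx⟩ := exists_ne_zero_fixed hq hq0 hσ ψ (injective_of_span_range ψ hψ)
  obtain ⟨x, rfl⟩ := W.mkQ_surjective x
  have hsolve : ∀ w ∈ W, ∃ u ∈ W, u = φ u + w := by
    intro w hw
    induction hw using Submodule.closure_induction with
    | zero => exact ⟨0, zero_mem _, by simp⟩
    | add a b _ _ iha ihb =>
      obtain ⟨u, hu, hua⟩ := iha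
      obtain ⟨u', hu', hub⟩ := ihb
      refine ⟨u + u', add_mem hu hu', ?_⟩
      nth_rewrite 1 [hua, hub]
      rw [map_add]; abel
    | smul_mem c a ha =>
      obtain ⟨y, hy⟩ := exists_eq_pow_add hq0 c
      refine ⟨y • a, Submodule.smul_mem _ _ (Submodule.subset_span ha), ?_⟩
      rw [map_smulₛₗ, show φ a = a from ha, hσ, ← add_smul, ← hy]
  obtain ⟨u, hu, huw⟩ := hsolve (φ x - x) ((Submodule.Quotient.eq W).mp hx)
  have hfix : φ (x + u) = x + u := by
    nth_rewrite 2 [huw]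
    rw [map_add]; abel
  refine hx0 ((Submodule.Quotient.mk_eq_zero W).mpr ?_)
  have := sub_mem (Submodule.subset_span (s := {x | φ x = x}) hfix) hu
  rwa [add_sub_cancel_right] at this

/-- Lang's theorem in matrix form. -/
theorem exists_matrix_fixed {ι : Type*} [Fintype ι] [DecidableEq ι] (hq : 1 < q)
    (hq0 : (q : L) = 0) (hσ : ∀ x, σ x = x ^ q) (T : Matrix ι ι L) (hT : IsUnit T) :
    ∃ U : Matrix ι ι L, IsUnit U ∧ T * U.map σ = U := by
  let φ : (ι → L) →ₛₗ[σ] (ι → L) :=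
    { toFun := fun x => T.mulVec (σ ∘ x)
      map_add' := fun x y => by
        rw [← Matrix.mulVec_add]; congr 1; ext i; simp
      map_smul' := fun c x => by
        rw [← Matrix.mulVec_smul]; congr 1; ext i; simp }
  have hφ : Submodule.span L (Set.range φ) = ⊤ := by
    have hsurj : Function.Surjective T.mulVec := Matrix.mulVec_surjective_iff_isUnit.mpr hT
    have h1 : Submodule.map T.mulVecLin (Submodule.span L (Set.range (Pi.basisFun L ι))) = ⊤ := by
      rw [(Pi.basisFun L ι).span_eq, Submodule.map_top, LinearMap.range_eq_top]
      exact hsurj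
    rw [Submodule.map_span] at h1
    rw [eq_top_iff, ← h1]
    refine Submodule.span_mono ?_
    rintro _ ⟨_, ⟨i, rfl⟩, rfl⟩
    refine ⟨Pi.single i 1, ?_⟩
    change T.mulVec (σ ∘ Pi.single i 1) = T.mulVec _
    congr 1
    ext j
    by_cases h : j = i
    · subst h; simp
    · simp [h]
  have hspan := span_fixed_eq_top hq hq0 hσ φ hφ
  obtain ⟨s, hs, hsspan, hli⟩ := exists_linearIndependent L {x | φ x = x}
  let b₀ : Module.Basis s L (ι → L) := Module.Basis.mk hli (by
    rw [Subtype.range_coe, hsspan, hspan])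
  let b : Module.Basis ι L (ι → L) := b₀.reindex (b₀.indexEquiv (Pi.basisFun L ι))
  have hb : ∀ i, φ (b i) = b i := by
    intro i
    have : b i = (((b₀.indexEquiv (Pi.basisFun L ι)).symm i : s) : ι → L) := by
      simp [b, b₀]
    rw [this]
    exact hs (Subtype.mem _)
  refine ⟨(Pi.basisFun L ι).toMatrix b, ?_, ?_⟩
  · have := (Pi.basisFun L ι).invertibleToMatrix b
    exact isUnit_of_invertible _
  · ext i j
    have := congrFun (hb j) i
    exact this

/-- The coefficients of a solution `U` of `T σ(U) = U` over `L⟦z⟧` with constant term `U₀`: the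
coefficient of `z ^ (n + 1)` is `U₀ Y`, where `Y` solves the Artin-Schreier equation
`Y = σ(Y) + U₀⁻¹ ∑ T_{n+1-i} σ(U_i)`, the sum being over `i ≤ n`; here `s w` is a solution of
`y = σ(y) + w`. -/
noncomputable def fixedCoeff {L ι : Type*} [Field L] [Fintype ι] [DecidableEq ι] (σ : L →+* L)
    (s : L → L) (T : ℕ → Matrix ι ι L) (U₀ : Matrix ι ι L) : ℕ → Matrix ι ι L
  | 0 => U₀
  | n + 1 => U₀ * (U₀⁻¹ * ∑ i : Fin (n + 1), T (n + 1 - i) * (fixedCoeff σ s T U₀ i).map σ).map s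

/-- Lang's theorem over `L⟦z⟧`. -/
theorem exists_powerSeries_matrix_fixed {ι : Type*} [Fintype ι] [DecidableEq ι] (hq : 1 < q)
    (hq0 : (q : L) = 0) (hσ : ∀ x, σ x = x ^ q) (T : Matrix ι ι L⟦X⟧) (hT : IsUnit T) :
    ∃ U : Matrix ι ι L⟦X⟧, IsUnit U ∧ T * U.map (PowerSeries.map σ) = U := by
  choose s hs using fun w : L => exists_eq_pow_add hq0 w
  let T' : ℕ → Matrix ι ι L := fun n => T.map (PowerSeries.coeff n)
  have hT0 : IsUnit (T' 0) := by
    have : T' 0 = (PowerSeries.constantCoeff (R := L)).mapMatrix T := by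
      ext a b; simp [T']
    rw [this]
    exact hT.map _
  obtain ⟨U₀, hU₀, hTU₀⟩ := exists_matrix_fixed hq hq0 hσ (T' 0) hT0
  have hU₀det : IsUnit U₀.det := (Matrix.isUnit_iff_isUnit_det _).mp hU₀
  let V := fixedCoeff σ s T' U₀
  have hV0 : V 0 = U₀ := by simp only [V]; rw [fixedCoeff]
  let U : Matrix ι ι L⟦X⟧ := Matrix.of fun a b => PowerSeries.mk fun n => V n a b
  refine ⟨U, ?_, ?_⟩
  · rw [Matrix.isUnit_iff_isUnit_det, PowerSeries.isUnit_iff_constantCoeff, RingHom.map_det]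
    have : (PowerSeries.constantCoeff (R := L)).mapMatrix U = U₀ := by
      ext a b; simp [U, hV0]
    rwa [this]
  · have hrec : ∀ n, ∑ r ∈ Finset.HasAntidiagonal.antidiagonal n, T' r.1 * (V r.2).map σ = V n := by
      intro n
      rw [Finset.Nat.sum_antidiagonal_eq_sum_range_succ (fun i j => T' i * (V j).map σ),
        ← Finset.sum_range_reflect]
      have h1 : ∀ j ∈ Finset.range (n + 1), T' (n + 1 - 1 - j) * (V (n - (n + 1 - 1 - j))).map σ =
          T' (n - j) * (V j).map σ := by
        intro j hj
        have := Finset.mem_range.mp hj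
        rw [show n + 1 - 1 - j = n - j by omega, show n - (n - j) = j by omega]
      rw [Finset.sum_congr rfl h1, Finset.sum_range_succ, Nat.sub_self]
      cases n with
      | zero => simpa [hV0] using hTU₀
      | succ n =>
        set W := ∑ i : Fin (n + 1), T' (n + 1 - i) * (V i).map σ with hW
        have hVn : V (n + 1) = U₀ * (U₀⁻¹ * W).map s := by
          simp only [V]; rw [fixedCoeff]
        have hY : (U₀⁻¹ * W).map s = ((U₀⁻¹ * W).map s).map σ + U₀⁻¹ * W := by
          ext a b
          simp only [Matrix.map_apply, Matrix.add_apply, hσ]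
          exact hs _
        rw [← Fin.sum_univ_eq_sum_range (fun i => T' (n + 1 - i) * (V i).map σ), ← hW, hVn]
        conv_rhs => rw [hY]
        rw [Matrix.map_mul, ← Matrix.mul_assoc, hTU₀, Matrix.mul_add, ← Matrix.mul_assoc U₀ U₀⁻¹,
          Matrix.mul_nonsing_inv _ hU₀det, Matrix.one_mul, add_comm]
    ext a b n
    have := congrFun (congrFun (hrec n) a) b
    rw [Matrix.sum_apply] at this
    simp only [Matrix.mul_apply] at this
    rw [Matrix.mul_apply, map_sum]
    simp only [PowerSeries.coeff_mul]
    rw [Finset.sum_comm]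
    simpa [U, T'] using this

/-- The elements of `L` fixed by `x ↦ x ^ q` come from the field of `q` elements. -/
theorem mem_range_of_map_eq {F L : Type*} [Field F] [Finite F] [Field L] {q : ℕ} {σ : L →+* L}
    (hσ : ∀ x, σ x = x ^ q) (hF : Nat.card F = q) (i : F →+* L) {x : L} (hx : σ x = x) :
    ∃ y, i y = x := by
  classical
  let _ := Fintype.ofFinite F
  rw [Nat.card_eq_fintype_card] at hF
  have hq : 1 < q := hF ▸ Fintype.one_lt_card
  have hne : (Polynomial.X ^ q - Polynomial.X : Polynomial L) ≠ 0 :=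
    FiniteField.X_pow_card_sub_X_ne_zero L hq
  have hdeg : (Polynomial.X ^ q - Polynomial.X : Polynomial L).natDegree = q :=
    FiniteField.X_pow_card_sub_X_natDegree_eq L hq
  have hsub : Finset.univ.image i ⊆
      (Polynomial.X ^ q - Polynomial.X : Polynomial L).roots.toFinset := by
    intro z hz
    obtain ⟨y, -, rfl⟩ := Finset.mem_image.mp hz
    rw [Multiset.mem_toFinset, Polynomial.mem_roots hne]
    simp [← map_pow, ← hF, FiniteField.pow_card]
  have hcard : (Polynomial.X ^ q - Polynomial.X : Polynomial L).roots.toFinset.card ≤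
      (Finset.univ.image i).card := by
    rw [Finset.card_image_of_injective _ i.injective, Finset.card_univ, hF]
    exact (Multiset.toFinset_card_le _).trans ((Polynomial.card_roots' _).trans hdeg.le)
  have hmem : x ∈ Finset.univ.image i := by
    rw [Finset.eq_of_subset_of_card_le hsub hcard, Multiset.mem_toFinset, Polynomial.mem_roots hne]
    simp [← hσ, hx]
  obtain ⟨y, -, hy⟩ := Finset.mem_image.mp hmem
  exact ⟨y, hy⟩

end Lang

/-! ### Coordinates on base changes of free modules -/
section Coordinates

variable {B C D : Type*} [CommRing B] [CommRing C] [CommRing D] {M M' : Type*} [AddCommGroup M]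
  [Module B M] [AddCommGroup M'] [Module B M'] {ι ι' : Type*}

namespace BaseChange

/-- The basis `1 ⊗ b_i` of `C ⊗_B M`. -/
noncomputable def basis (g : B →+* C) (b : Module.Basis ι B M) :
    Module.Basis ι C (BaseChange g M) :=
  letI := g.toAlgebra
  Algebra.TensorProduct.basis C b

theorem basis_apply (g : B →+* C) (b : Module.Basis ι B M) (i : ι) :
    basis g b i = mk g (b i) :=
  letI := g.toAlgebra
  Algebra.TensorProduct.basis_apply b i

theorem repr_along {g : B →+* C} {g' : B →+* D} (h : C →+* D) (hg : h.comp g = g')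
    (b : Module.Basis ι B M) (x : BaseChange g M) (i : ι) :
    (basis g' b).repr (along h hg x) i = h ((basis g b).repr x i) := by
  classical
  let φ : BaseChange g M →ₛₗ[h] D := ((basis g' b).coord i).comp (along h hg)
  let ψ : BaseChange g M →ₛₗ[h] D :=
    { toFun := fun x => h ((basis g b).repr x i)
      map_add' := fun x y => by rw [map_add, Finsupp.add_apply, map_add]
      map_smul' := fun c x => by
        rw [map_smul, Finsupp.smul_apply, smul_eq_mul, map_mul, smul_eq_mul] }
  have : φ = ψ := (basis g b).ext fun j => by
    change (basis g' b).repr (along h hg (basis g b j)) i = h ((basis g b).repr (basis g b j) i)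
    rw [Module.Basis.repr_self, basis_apply, along_mk, ← basis_apply g' b, Module.Basis.repr_self,
      Finsupp.single_apply, Finsupp.single_apply]
    split_ifs <;> simp
  exact LinearMap.congr_fun this x

theorem along_injective {g : B →+* C} {g' : B →+* D} {h : C →+* D} {hg : h.comp g = g'}
    [Module.Free B M] (hh : Function.Injective h) :
    Function.Injective (along h hg : BaseChange g M → BaseChange g' M) := by
  intro x y hxy
  refine (basis g (Module.Free.chooseBasis B M)).ext_elem fun i => hh ?_
  rw [← repr_along h hg, ← repr_along h hg, hxy]

theorem repr_mk (g : B →+* C) (b : Module.Basis ι B M) (m : M) (i : ι) :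
    (basis g b).repr (mk g m) i = g (b.repr m i) := by
  classical
  let φ : M →ₛₗ[g] C := ((basis g b).coord i).comp (mk g)
  let ψ : M →ₛₗ[g] C :=
    { toFun := fun x => g (b.repr x i)
      map_add' := fun x y => by rw [map_add, Finsupp.add_apply, map_add]
      map_smul' := fun c x => by
        rw [map_smul, Finsupp.smul_apply, smul_eq_mul, map_mul, smul_eq_mul] }
  have : φ = ψ := b.ext fun j => by
    change (basis g b).repr (mk g (b j)) i = g (b.repr (b j) i)
    rw [← basis_apply, Module.Basis.repr_self, Module.Basis.repr_self,
      Finsupp.single_apply, Finsupp.single_apply]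
    split_ifs <;> simp
  exact LinearMap.congr_fun this m

theorem mk_injective {g : B →+* C} [Module.Free B M] (hg : Function.Injective g) :
    Function.Injective (mk g : M → BaseChange g M) := by
  intro x y hxy
  refine (Module.Free.chooseBasis B M).ext_elem fun i => hg ?_
  rw [← repr_mk g, ← repr_mk g, hxy]

theorem map_injective {g : B →+* C} [Module.Free B M'] (hg : Function.Injective g) :
    Function.Injective (map g : (M →ₗ[B] M') → _) := by
  intro f f' h
  refine LinearMap.ext fun m => mk_injective hg ?_
  rw [← map_mk, ← map_mk, h]

theorem extend_injective {g : B →+* C} {g' : B →+* D} {h : C →+* D} {hg : h.comp g = g'}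
    [Module.Free B M'] (hh : Function.Injective h) : Function.Injective
      (extend h hg : (BaseChange g M →ₗ[C] BaseChange g M') → _) := by
  intro f f' hf
  refine LinearMap.ext fun x => along_injective (hg := hg) hh ?_
  rw [← extend_along, ← extend_along, hf]

end BaseChange
end Coordinates

/-! ### Solution spaces in a fundamental system -/
section Solutions

variable {Fq Q K : Type*} [Field Fq] [Finite Fq] [Field Q] [Algebra Fq Q]
  [IsCurveFunctionField Fq Q] [NontriviallyNormedField K] [IsUltrametricDist K]
  {𝔇 : BaseDatum Fq Q K} {E G C : Type*} [CommRing E] [Group G] [CommRing C]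

namespace LocalShtuka

variable {ι : Type*} [Fintype ι] [DecidableEq ι]

/-- The matrix of `τ_M` with respect to a basis of `M`. -/
noncomputable def frobMatrix (N : LocalShtuka.{v} 𝔇)
    (b : Module.Basis ι (IntegerRing K)⟦X⟧ N.M) : Matrix ι ι 𝔇.Rzζ :=
  LinearMap.toMatrix (BaseChange.basis 𝔇.loc (BaseChange.basis 𝔇.σ b)) (BaseChange.basis 𝔇.loc b)
    N.τ.toLinearMap

/-- The matrix of `τ_M⁻¹` with respect to a basis of `M`. -/
noncomputable def frobMatrixInv (N : LocalShtuka.{v} 𝔇)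
    (b : Module.Basis ι (IntegerRing K)⟦X⟧ N.M) : Matrix ι ι 𝔇.Rzζ :=
  LinearMap.toMatrix (BaseChange.basis 𝔇.loc b) (BaseChange.basis 𝔇.loc (BaseChange.basis 𝔇.σ b))
    N.τ.symm.toLinearMap

variable (N : LocalShtuka.{v} 𝔇) (b : Module.Basis ι (IntegerRing K)⟦X⟧ N.M)

theorem frobMatrix_mul_inv : N.frobMatrix b * N.frobMatrixInv b = 1 := by
  rw [frobMatrix, frobMatrixInv, ← LinearMap.toMatrix_comp]
  simp

theorem frobMatrixInv_mul : N.frobMatrixInv b * N.frobMatrix b = 1 := by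
  rw [frobMatrix, frobMatrixInv, ← LinearMap.toMatrix_comp]
  simp

end LocalShtuka

namespace CoeffRing

variable (P : CoeffRing 𝔇 E G C) {N N' : LocalShtuka.{v} 𝔇} {ι ι' : Type*} [Fintype ι]
  [Fintype ι']

/-- Every fixed element of `σ` comes from `E`, and `E` is contained in `C`. -/
structure FixedRing (P : CoeffRing 𝔇 E G C) : Prop where
  injective : Function.Injective P.coeff
  mem_range : ∀ c, P.σ c = c → ∃ e, P.coeff e = c

variable {P}

/-- A `C`-basis of `M ⊗ C` which consists of solutions is an `E`-basis of the space of solutions. -/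
noncomputable def solBasis (hP : P.FixedRing) (s : Module.Basis ι C (BaseChange P.incl N.M))
    (hs : ∀ i, P.frob N (s i) = s i) : Module.Basis ι E (P.solutions N) :=
  Module.Basis.mk (v := fun i => ⟨s i, hs i⟩)
    (by
      rw [Fintype.linearIndependent_iff]
      intro e he i
      have h1 : ∑ i, P.coeff (e i) • s i = 0 := by
        have := congrArg (P.solutions N).subtype he
        rw [map_sum] at this
        exact this
      exact hP.injective ((Fintype.linearIndependent_iff.mp s.linearIndependent _ h1 i).trans
        (map_zero _).symm))
    (by
      rintro ⟨x, hx⟩ -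
      have hfix : ∀ i, P.σ (s.repr x i) = s.repr x i := by
        have h1 : P.frob N x = ∑ i, P.σ (s.repr x i) • s i := by
          conv_lhs => rw [← s.sum_repr x, map_sum]
          simp only [map_smulₛₗ, hs]
        intro i
        rw [show P.frob N x = x from hx] at h1
        conv_rhs => rw [h1]
        rw [s.repr_sum_self]
      choose e he using fun i => hP.mem_range _ (hfix i)
      have h2 : (⟨x, hx⟩ : P.solutions N) = ∑ i, e i • (⟨s i, hs i⟩ : P.solutions N) := by
        refine Subtype.ext ?_
        change x = (P.solutions N).subtype _
        rw [map_sum]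
        conv_lhs => rw [← s.sum_repr x]
        refine Finset.sum_congr rfl fun i _ => ?_
        rw [← he i]
        rfl
      rw [h2]
      exact sum_mem fun i _ => Submodule.smul_mem _ _ (Submodule.subset_span ⟨i, rfl⟩))

theorem coe_solBasis (hP : P.FixedRing) (s : Module.Basis ι C (BaseChange P.incl N.M))
    (hs : ∀ i, P.frob N (s i) = s i) (i : ι) :
    (solBasis hP s hs i : BaseChange P.incl N.M) = s i := by
  rw [solBasis, Module.Basis.mk_apply]

/-- The `C`-linear extension of an `E`-linear map between spaces of solutions. -/
noncomputable def extendSol (hP : P.FixedRing) (s : Module.Basis ι C (BaseChange P.incl N.M))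
    (hs : ∀ i, P.frob N (s i) = s i) (φ : P.solutions N →ₗ[E] P.solutions N') :
    BaseChange P.incl N.M →ₗ[C] BaseChange P.incl N'.M :=
  s.constr C fun i => (φ (solBasis hP s hs i) : BaseChange P.incl N'.M)

section ExtendSol

variable (hP : P.FixedRing) (s : Module.Basis ι C (BaseChange P.incl N.M))
  (hs : ∀ i, P.frob N (s i) = s i) (φ : P.solutions N →ₗ[E] P.solutions N')

theorem extendSol_coe (x : P.solutions N) :
    extendSol hP s hs φ x = φ x := by
  let F : P.solutions N →ₗ[E] BaseChange P.incl N'.M :=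
    { toFun := fun x => extendSol hP s hs φ x
      map_add' := fun x y => map_add (extendSol hP s hs φ) _ _
      map_smul' := fun e x => map_smul (extendSol hP s hs φ) (P.coeff e) _ }
  have : F = (P.solutions N').subtype ∘ₗ φ := (solBasis hP s hs).ext fun i => by
    change extendSol hP s hs φ (solBasis hP s hs i : BaseChange P.incl N.M) = φ (solBasis hP s hs i)
    rw [coe_solBasis, extendSol, Module.Basis.constr_basis]
  exact LinearMap.congr_fun this x

theorem extendSol_basis (i : ι) :
    extendSol hP s hs φ (s i) = φ (solBasis hP s hs i) := by
  rw [extendSol, Module.Basis.constr_basis]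

theorem frob_extendSol (x : BaseChange P.incl N.M) :
    P.frob N' (extendSol hP s hs φ x) = extendSol hP s hs φ (P.frob N x) := by
  have : (P.frob N').comp (extendSol hP s hs φ) = (extendSol hP s hs φ).comp (P.frob N) :=
    s.ext fun i => by
      rw [LinearMap.comp_apply, LinearMap.comp_apply, hs, extendSol_basis]
      exact (φ (solBasis hP s hs i)).2
  exact LinearMap.congr_fun this x

theorem galois_extendSol (hφ : ∀ γ x, φ (P.ρ N γ x) = P.ρ N' γ (φ x)) (γ : G)
    (x : BaseChange P.incl N.M) :
    P.galois N' γ (extendSol hP s hs φ x) = extendSol hP s hs φ (P.galois N γ x) := by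
  have : (P.galois N' γ).comp (extendSol hP s hs φ) =
      (extendSol hP s hs φ).comp (P.galois N γ) :=
    s.ext fun i => by
      rw [LinearMap.comp_apply, LinearMap.comp_apply, extendSol_basis]
      have h1 : P.galois N γ (s i) = (P.ρ N γ (solBasis hP s hs i) : BaseChange P.incl N.M) := by
        rw [← coe_solBasis hP s hs i]; rfl
      rw [h1, extendSol_coe, hφ]
      rfl
  exact LinearMap.congr_fun this x

end ExtendSol

/-- A `G`-equivariant `E`-linear map between spaces of solutions extends to a `C`-linear map which
commutes with Frobenius and with `G`. -/
theorem exists_linear_extension (hP : P.FixedRing)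
    (s : Module.Basis ι C (BaseChange P.incl N.M)) (hs : ∀ i, P.frob N (s i) = s i)
    (φ : P.solutions N →ₗ[E] P.solutions N') (hφ : ∀ γ x, φ (P.ρ N γ x) = P.ρ N' γ (φ x)) :
    ∃ Φ : BaseChange P.incl N.M →ₗ[C] BaseChange P.incl N'.M,
      (∀ x, P.frob N' (Φ x) = Φ (P.frob N x)) ∧
      (∀ γ x, P.galois N' γ (Φ x) = Φ (P.galois N γ x)) ∧ ∀ x : P.solutions N, Φ x = φ x :=
  ⟨extendSol hP s hs φ, frob_extendSol hP s hs φ, galois_extendSol hP s hs φ hφ,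
    extendSol_coe hP s hs φ⟩

omit [Fintype ι] in
/-- A `C`-linear map is determined by its values on solutions. -/
theorem eq_of_eqOn_solutions (s : Module.Basis ι C (BaseChange P.incl N.M))
    (hs : ∀ i, P.frob N (s i) = s i) {F F' : BaseChange P.incl N.M →ₗ[C] BaseChange P.incl N'.M}
    (h : ∀ x ∈ P.solutions N, F x = F' x) : F = F' :=
  s.ext fun i => h _ (hs i)

variable [DecidableEq ι] [DecidableEq ι']

variable (P) in
theorem repr_frob (b : Module.Basis ι (IntegerRing K)⟦X⟧ N.M) (x : BaseChange P.incl N.M) (i : ι) :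
    (BaseChange.basis P.incl b).repr (P.frob N x) i =
      ∑ j, P.inclLoc (N.frobMatrix b i j) * P.σ ((BaseChange.basis P.incl b).repr x j) := by
  have h1 : ∀ j, (BaseChange.basis P.incl b).repr (P.frob N (BaseChange.basis P.incl b j)) i =
      P.inclLoc (N.frobMatrix b i j) := by
    intro j
    rw [BaseChange.basis_apply, frob, LocalShtuka.frob_mk, BaseChange.repr_along,
      LocalShtuka.frobMatrix, LinearMap.toMatrix_apply, BaseChange.basis_apply,
      BaseChange.basis_apply]
    rfl
  conv_lhs => rw [← (BaseChange.basis P.incl b).sum_repr x, map_sum]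
  simp only [map_smulₛₗ, map_sum, Finsupp.coe_finsetSum, Finset.sum_apply,
    Finsupp.smul_apply, h1, smul_eq_mul]
  exact Finset.sum_congr rfl fun j _ => mul_comm _ _

variable (P) in
/-- A fundamental matrix: an invertible matrix whose columns are the coordinates of solutions. -/
structure IsFundamental (b : Module.Basis ι (IntegerRing K)⟦X⟧ N.M) (U : Matrix ι ι C) : Prop where
  isUnit : IsUnit U
  frob : (N.frobMatrix b).map P.inclLoc * U.map P.σ = U

namespace IsFundamental

variable {b : Module.Basis ι (IntegerRing K)⟦X⟧ N.M} {U : Matrix ι ι C}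

/-- The basis of `M ⊗ C` given by the columns of a fundamental matrix. -/
noncomputable def basis (hU : P.IsFundamental b U) :
    Module.Basis ι C (BaseChange P.incl N.M) :=
  (BaseChange.basis P.incl b).map (Matrix.toLinearEquiv (BaseChange.basis P.incl b) U
    ((Matrix.isUnit_iff_isUnit_det _).mp hU.isUnit))

theorem repr_basis (hU : P.IsFundamental b U) (i j : ι) :
    (BaseChange.basis P.incl b).repr (hU.basis j) i = U i j := by
  rw [basis, Module.Basis.map_apply]
  change (BaseChange.basis P.incl b).repr (Matrix.toLin _ _ U _) i = _
  rw [Matrix.toLin_self, Module.Basis.repr_sum_self]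

theorem frob_basis (hU : P.IsFundamental b U) (j : ι) : P.frob N (hU.basis j) = hU.basis j := by
  refine (BaseChange.basis P.incl b).ext_elem fun i => ?_
  rw [repr_frob, hU.repr_basis]
  conv_rhs => rw [← hU.frob, Matrix.mul_apply]
  simp only [hU.repr_basis, Matrix.map_apply]

/-- The basis of the space of solutions given by the columns of a fundamental matrix. -/
noncomputable def solBasis (hU : P.IsFundamental b U) (hP : P.FixedRing) :
    Module.Basis ι E (P.solutions N) :=
  CoeffRing.solBasis hP hU.basis hU.frob_basis

/-- The matrix of `γ` in the basis of solutions is `U⁻¹ γ(U)`. -/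
theorem map_act (hU : P.IsFundamental b U) (hP : P.FixedRing) (γ : G) :
    U.map (P.act γ) =
      U * (LinearMap.toMatrix (hU.solBasis hP) (hU.solBasis hP) (P.ρ N γ)).map P.coeff := by
  ext i j
  have h1 : (P.ρ N γ (hU.solBasis hP j) : BaseChange P.incl N.M) =
      P.galois N γ (hU.basis j) := by
    rw [← coe_solBasis hP hU.basis hU.frob_basis j]; rfl
  have h2 : (P.ρ N γ (hU.solBasis hP j) : BaseChange P.incl N.M) =
      ∑ l, P.coeff ((hU.solBasis hP).repr (P.ρ N γ (hU.solBasis hP j)) l) • hU.basis l := by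
    have := congrArg (P.solutions N).subtype
      ((hU.solBasis hP).sum_repr (P.ρ N γ (hU.solBasis hP j)))
    rw [map_sum] at this
    refine this.symm.trans (Finset.sum_congr rfl fun l _ => ?_)
    rw [← coe_solBasis hP hU.basis hU.frob_basis l]; rfl
  rw [Matrix.map_apply, ← hU.repr_basis i j, ← BaseChange.repr_along (P.act γ) (P.act_incl γ)]
  change (BaseChange.basis P.incl b).repr (P.galois N γ (hU.basis j)) i = _
  rw [← h1, h2, map_sum, Finsupp.coe_finsetSum, Finset.sum_apply, Matrix.mul_apply]
  refine Finset.sum_congr rfl fun l _ => ?_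
  rw [map_smul, Finsupp.smul_apply, hU.repr_basis, Matrix.map_apply, LinearMap.toMatrix_apply,
    smul_eq_mul, mul_comm]

end IsFundamental

/-- A linear map commuting with Frobenius, in coordinates. -/
theorem toMatrix_frob (b : Module.Basis ι (IntegerRing K)⟦X⟧ N.M)
    (b' : Module.Basis ι' (IntegerRing K)⟦X⟧ N'.M)
    (F : BaseChange P.incl N.M →ₗ[C] BaseChange P.incl N'.M)
    (hF : ∀ x, P.frob N' (F x) = F (P.frob N x)) :
    (N'.frobMatrix b').map P.inclLoc *
        (LinearMap.toMatrix (BaseChange.basis P.incl b) (BaseChange.basis P.incl b') F).map P.σ =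
      LinearMap.toMatrix (BaseChange.basis P.incl b) (BaseChange.basis P.incl b') F *
        (N.frobMatrix b).map P.inclLoc := by
  ext i j
  have h1 := congrArg (fun x => (BaseChange.basis P.incl b').repr x i)
    (hF (BaseChange.basis P.incl b j))
  simp only [repr_frob] at h1
  rw [Matrix.mul_apply, Matrix.mul_apply]
  simp only [Matrix.map_apply, LinearMap.toMatrix_apply]
  rw [h1]
  conv_lhs => rw [← (BaseChange.basis P.incl b).sum_repr (P.frob N _), map_sum]
  rw [map_sum, Finsupp.coe_finsetSum, Finset.sum_apply]
  refine Finset.sum_congr rfl fun l _ => ?_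
  rw [map_smul, map_smul, Finsupp.smul_apply, smul_eq_mul, mul_comm, repr_frob,
    Finset.sum_eq_single j]
  · simp
  · intro m _ hm
    simp [hm.symm]
  · simp

omit [DecidableEq ι'] in
/-- A linear map commuting with `G` has `G`-invariant coordinates. -/
theorem act_toMatrix (b : Module.Basis ι (IntegerRing K)⟦X⟧ N.M)
    (b' : Module.Basis ι' (IntegerRing K)⟦X⟧ N'.M)
    (F : BaseChange P.incl N.M →ₗ[C] BaseChange P.incl N'.M) (γ : G)
    (hF : ∀ x, P.galois N' γ (F x) = F (P.galois N γ x)) (i : ι') (j : ι) :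
    P.act γ (LinearMap.toMatrix (BaseChange.basis P.incl b) (BaseChange.basis P.incl b') F i j) =
      LinearMap.toMatrix (BaseChange.basis P.incl b) (BaseChange.basis P.incl b') F i j := by
  rw [LinearMap.toMatrix_apply, ← BaseChange.repr_along (P.act γ) (P.act_incl γ)]
  change (BaseChange.basis P.incl b').repr (P.galois N' γ _) i = _
  rw [hF, BaseChange.basis_apply, galois, BaseChange.along_mk]

end CoeffRing
end Solutions

/-! ### Injectivity of the coefficient maps, fixed rings -/
section Coefficients

theorem lift_injective_of_injective {A S B : Type*} [CommRing A] [CommRing S] [CommRing B]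
    [Algebra A S] (M : Submonoid A) [IsLocalization M S] {g : A →+* B} (hg : ∀ y : M, IsUnit (g y))
    (h : Function.Injective g) : Function.Injective (IsLocalization.lift (S := S) hg) :=
  (IsLocalization.lift_injective_iff hg).mpr fun x y =>
    ⟨fun hxy => by
        rw [← IsLocalization.lift_eq (S := S) hg x, hxy, IsLocalization.lift_eq],
      fun hxy => congrArg _ (h hxy)⟩

theorem powerSeries_injective_laurent (E : Type*) [CommRing E] :
    Function.Injective (algebraMap E⟦X⟧ E⸨X⸩) :=
  HahnSeries.ofPowerSeries_injective

theorem isUnit_laurent_X (E : Type*) [CommRing E] :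
    IsUnit (algebraMap E⟦X⟧ E⸨X⸩ PowerSeries.X) :=
  IsLocalization.map_units E⸨X⸩
    (⟨PowerSeries.X, 1, pow_one _⟩ : Submonoid.powers (PowerSeries.X : E⟦X⟧))

theorem laurentMap_injective {E E' : Type*} [CommRing E] [CommRing E'] {f : E →+* E'}
    (hf : Function.Injective f) : Function.Injective (laurentMap f) :=
  lift_injective_of_injective _ _
    ((powerSeries_injective_laurent E').comp (PowerSeries.map_injective f hf))

variable {Fq Q K : Type*} [Field Fq] [Finite Fq] [Field Q] [Algebra Fq Q]
  [IsCurveFunctionField Fq Q] [NontriviallyNormedField K] [IsUltrametricDist K]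
  (𝔇 : BaseDatum Fq Q K) (L : Type*) [Field L] [Algebra K L]

theorem exists_charP_of_hom {E : Type*} [Field E] (i : IntegerRing K →+* E) :
    ∃ p k : ℕ, p.Prime ∧ CharP E p ∧ 𝔇.qhat = p ^ k := by
  obtain ⟨p, k, hp, hc, hq⟩ := 𝔇.exists_char
  exact ⟨p, k, hp, charP_of_injective_ringHom
    (f := (i.comp 𝔇.γ).comp (algebraMap Fq 𝔇.A)) (RingHom.injective _) p, hq⟩

theorem qhat_cast_eq_zero {E : Type*} [Field E] (i : IntegerRing K →+* E) : (𝔇.qhat : E) = 0 := by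
  obtain ⟨p, k, hp, hc, hq⟩ := exists_charP_of_hom 𝔇 i
  have hk : k ≠ 0 := by
    rintro rfl
    have := 𝔇.one_lt_qhat
    rw [hq] at this
    simp at this
  rw [hq, Nat.cast_pow, CharP.cast_eq_zero, zero_pow hk]

theorem norm_ζ_lt_one : ‖(𝔇.ζ : K)‖ < 1 := by
  have hmem : 𝔇.ζ ∈ maximalIdeal (IntegerRing K) := by
    obtain ⟨a, s, ha, -, h⟩ := 𝔇.exists_z
    have h1 := congrArg 𝔇.γLoc h
    have h2 : ∀ x, 𝔇.γLoc (algebraMap _ _ x) = 𝔇.γ x := fun x => IsLocalization.lift_eq _ _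
    rw [map_mul, h2, h2] at h1
    have h3 : 𝔇.γ a ∈ maximalIdeal (IntegerRing K) := ha
    rw [← h1] at h3
    exact (Ideal.mul_unit_mem_iff_mem _ (𝔇.isUnit_γ s)).mp h3
  rw [Valuation.mem_maximalIdeal_iff] at hmem
  exact hmem

variable [CompleteSpace K]

theorem tateCoeff_fixedRing : (tateCoeff 𝔇 L).FixedRing where
  injective := PowerSeries.map_injective _ (teichL 𝔇 L).injective
  mem_range c hc := by
    have h : ∀ n, ∃ y, teichL 𝔇 L y = PowerSeries.coeff n c := fun n =>
      mem_range_of_map_eq (σ := 𝔇.frob (toL K L)) (fun _ => rfl) rfl _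
        ((PowerSeries.coeff_map _ n c).symm.trans (congrArg _ hc))
    choose y hy using h
    exact ⟨PowerSeries.mk y, PowerSeries.ext fun n =>
      (PowerSeries.coeff_map _ _ _).trans (by rw [PowerSeries.coeff_mk, hy])⟩

theorem rationalCoeff_coeff_algebraMap (x : 𝔇.Aε) :
    (rationalCoeff 𝔇 L).coeff (algebraMap 𝔇.Aε 𝔇.Qε x) =
      algebraMap L⟦X⟧ L⸨X⸩ ((tateCoeff 𝔇 L).coeff x) :=
  IsFractionRing.lift_algebraMap (algebraMap_comp_coeff_injective 𝔇 L) x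

theorem rationalCoeff_σ_algebraMap (x : L⟦X⟧) :
    (rationalCoeff 𝔇 L).σ (algebraMap L⟦X⟧ L⸨X⸩ x) =
      algebraMap L⟦X⟧ L⸨X⸩ ((tateCoeff 𝔇 L).σ x) :=
  laurentMap_algebraMap _ _

theorem rationalCoeff_act_algebraMap (g : L ≃ₐ[K] L) (x : L⟦X⟧) :
    (rationalCoeff 𝔇 L).act g (algebraMap L⟦X⟧ L⸨X⸩ x) =
      algebraMap L⟦X⟧ L⸨X⸩ ((tateCoeff 𝔇 L).act g x) :=
  laurentMap_algebraMap _ _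

theorem tateCoeff_σ_X : (tateCoeff 𝔇 L).σ PowerSeries.X = PowerSeries.X := PowerSeries.map_X _

theorem tateCoeff_act_X (g : L ≃ₐ[K] L) : (tateCoeff 𝔇 L).act g PowerSeries.X = PowerSeries.X :=
  PowerSeries.map_X _

theorem tateCoeff_coeff_X : (tateCoeff 𝔇 L).coeff PowerSeries.X = PowerSeries.X :=
  PowerSeries.map_X _

theorem rationalCoeff_fixedRing : (rationalCoeff 𝔇 L).FixedRing where
  injective := RingHom.injective _
  mem_range c hc := by
    obtain ⟨⟨f, ⟨_, n, rfl⟩⟩, hf⟩ :=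
      IsLocalization.surj (Submonoid.powers (PowerSeries.X : L⟦X⟧)) c
    have hX : IsUnit (algebraMap L⟦X⟧ L⸨X⸩ (PowerSeries.X ^ n)) := by
      rw [map_pow]; exact (isUnit_laurent_X L).pow n
    change c * algebraMap L⟦X⟧ L⸨X⸩ (PowerSeries.X ^ n) = algebraMap L⟦X⟧ L⸨X⸩ f at hf
    have hσf : (tateCoeff 𝔇 L).σ f = f := by
      apply powerSeries_injective_laurent L
      rw [← rationalCoeff_σ_algebraMap, ← hf, map_mul, hc, rationalCoeff_σ_algebraMap, map_pow,
        tateCoeff_σ_X]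
    obtain ⟨e, he⟩ := (tateCoeff_fixedRing 𝔇 L).mem_range f hσf
    refine ⟨algebraMap 𝔇.Aε 𝔇.Qε e * (algebraMap 𝔇.Aε 𝔇.Qε (PowerSeries.X ^ n))⁻¹, ?_⟩
    have hne : algebraMap 𝔇.Aε 𝔇.Qε (PowerSeries.X ^ n) ≠ 0 :=
      (map_ne_zero_iff _ (IsFractionRing.injective 𝔇.Aε 𝔇.Qε)).mpr
        (pow_ne_zero _ PowerSeries.X_ne_zero)
    apply hX.mul_right_cancel
    rw [hf, ← he, ← rationalCoeff_coeff_algebraMap]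
    have h1 : algebraMap L⟦X⟧ L⸨X⸩ (PowerSeries.X ^ n) =
        (rationalCoeff 𝔇 L).coeff (algebraMap 𝔇.Aε 𝔇.Qε (PowerSeries.X ^ n)) := by
      rw [rationalCoeff_coeff_algebraMap, map_pow, map_pow, map_pow, tateCoeff_coeff_X]
    rw [h1, ← map_mul, inv_mul_cancel_right₀ hne]

theorem tateCoeff_incl_injective : Function.Injective (tateCoeff 𝔇 L).incl :=
  PowerSeries.map_injective _ (toL_injective L)

theorem tateCoeff_inclLoc_injective : Function.Injective (tateCoeff 𝔇 L).inclLoc :=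
  lift_injective_of_injective _ _ (tateCoeff_incl_injective 𝔇 L)

theorem liftRzzζ_injective :
    Function.Injective (CoeffRing.liftRzzζ (rationalCoeff_incl 𝔇 L)) :=
  lift_injective_of_injective _ _ (laurentMap_injective (toL_injective L))

end Coefficients

/-! ### Existence of fundamental matrices -/
section Fundamental

variable {Fq Q K : Type*} [Field Fq] [Finite Fq] [Field Q] [Algebra Fq Q]
  [IsCurveFunctionField Fq Q] [NontriviallyNormedField K] [IsUltrametricDist K]
  {𝔇 : BaseDatum Fq Q K} (L : Type*) [Field L] [Algebra K L] [CompleteSpace K]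
  {N N' : LocalShtuka.{v} 𝔇} {ι ι' : Type*} [Fintype ι] [DecidableEq ι] [Fintype ι']
  [DecidableEq ι']

theorem exists_isFundamental [IsSepClosed L] (b : Module.Basis ι (IntegerRing K)⟦X⟧ N.M) :
    ∃ U, (tateCoeff 𝔇 L).IsFundamental b U := by
  have hT : IsUnit ((N.frobMatrix b).map (tateCoeff 𝔇 L).inclLoc) := by
    have h1 : IsUnit (N.frobMatrix b) :=
      ⟨⟨_, _, N.frobMatrix_mul_inv b, N.frobMatrixInv_mul b⟩, rfl⟩
    exact h1.map (tateCoeff 𝔇 L).inclLoc.mapMatrix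
  obtain ⟨U, hU, h⟩ := exists_powerSeries_matrix_fixed (σ := 𝔇.frob (toL K L)) 𝔇.one_lt_qhat
    (qhat_cast_eq_zero 𝔇 (toL K L)) (fun _ => rfl) _ hT
  exact ⟨U, hU, h⟩

variable {L}

theorem CoeffRing.IsFundamental.rational {b : Module.Basis ι (IntegerRing K)⟦X⟧ N.M}
    {U : Matrix ι ι L⟦X⟧} (hU : (tateCoeff 𝔇 L).IsFundamental b U) :
    (rationalCoeff 𝔇 L).IsFundamental b (U.map (algebraMap L⟦X⟧ L⸨X⸩)) where
  isUnit := hU.isUnit.map (algebraMap L⟦X⟧ L⸨X⸩).mapMatrix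
  frob := by
    have h1 : (U.map (algebraMap L⟦X⟧ L⸨X⸩)).map (rationalCoeff 𝔇 L).σ =
        (U.map (tateCoeff 𝔇 L).σ).map (algebraMap L⟦X⟧ L⸨X⸩) := by
      ext1 i j
      exact rationalCoeff_σ_algebraMap 𝔇 L _
    have h2 : (N.frobMatrix b).map (rationalCoeff 𝔇 L).inclLoc =
        ((N.frobMatrix b).map (tateCoeff 𝔇 L).inclLoc).map (algebraMap L⟦X⟧ L⸨X⸩) := rfl
    rw [h1, h2, ← Matrix.map_mul, hU.frob]

end Fundamental

/-! ### Frobenius- and Galois-equivariant matrices are integral -/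
section Descent

variable {Fq Q K : Type*} [Field Fq] [Finite Fq] [Field Q] [Algebra Fq Q]
  [IsCurveFunctionField Fq Q] [NontriviallyNormedField K] [IsUltrametricDist K]

theorem exists_norm_le_of_lt_one [IsDiscreteValuationRing (IntegerRing K)] :
    ∃ δ : ℝ, δ < 1 ∧ ∀ x : K, ‖x‖ < 1 → ‖x‖ ≤ δ := by
  obtain ⟨ϖ, hϖ⟩ := IsDiscreteValuationRing.exists_irreducible (IntegerRing K)
  have hmax := hϖ.maximalIdeal_eq
  have hlt : ∀ y : IntegerRing K, y ∈ maximalIdeal (IntegerRing K) ↔ ‖(y : K)‖ < 1 := by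
    intro y
    rw [Valuation.mem_maximalIdeal_iff]
    exact Iff.rfl
  refine ⟨‖(ϖ : K)‖, (hlt ϖ).mp (by rw [hmax]; exact Ideal.mem_span_singleton_self _),
    fun x hx => ?_⟩
  have h1 : (⟨x, hx.le⟩ : IntegerRing K) ∈ maximalIdeal (IntegerRing K) := (hlt _).mpr hx
  rw [hmax, Ideal.mem_span_singleton] at h1
  obtain ⟨y, hy⟩ := h1
  have h2 : x = ϖ * y := congrArg Subtype.val hy
  rw [h2, norm_mul]
  exact mul_le_of_le_one_right (norm_nonneg _) y.2

theorem map_mul_map_eq_one {κ B C : Type*} [Fintype κ] [DecidableEq κ] [CommRing B] [CommRing C]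
    (g : B →+* C) {X Y : Matrix κ κ B} (h : X * Y = 1) : X.map g * Y.map g = 1 := by
  rw [← Matrix.map_mul, h, Matrix.map_one _ (map_zero _) (map_one _)]

variable {𝔇 : BaseDatum Fq Q K} {L : Type*} [Field L] [Algebra K L] [CompleteSpace K]
  {N N' : LocalShtuka.{v} 𝔇} {ι ι' : Type*} [Fintype ι] [DecidableEq ι] [Fintype ι']
  [DecidableEq ι']

/-- A matrix over `L⟦z⟧` which is Galois-invariant and commutes with the Frobenius maps of two local
shtukas has coefficients in `R`. -/
theorem exists_integral_matrix [IsDiscreteValuationRing (IntegerRing K)] [IsGalois K L]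
    (b : Module.Basis ι (IntegerRing K)⟦X⟧ N.M) (b' : Module.Basis ι' (IntegerRing K)⟦X⟧ N'.M)
    (f : Matrix ι' ι L⟦X⟧) (hG : ∀ g i j, (tateCoeff 𝔇 L).act g (f i j) = f i j)
    (hf : (N'.frobMatrix b').map (tateCoeff 𝔇 L).inclLoc * f.map (tateCoeff 𝔇 L).σ =
      f * (N.frobMatrix b).map (tateCoeff 𝔇 L).inclLoc) :
    ∃ f₀ : Matrix ι' ι (IntegerRing K)⟦X⟧, f₀.map (tateCoeff 𝔇 L).incl = f := by
  set P := tateCoeff 𝔇 L with hP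
  -- descent to `K` by Galois invariance
  have hfix : ∀ i j n, ∃ y : K, algebraMap K L y = PowerSeries.coeff n (f i j) := by
    intro i j n
    have : PowerSeries.coeff n (f i j) ∈ (⊥ : IntermediateField K L) := by
      rw [InfiniteGalois.mem_bot_iff_fixed]
      intro g
      have h1 := congrArg (PowerSeries.coeff n) (hG g i j)
      exact (PowerSeries.coeff_map _ _ _).symm.trans h1
    exact IntermediateField.mem_bot.mp this
  choose y hy using hfix
  let F : ι' × ι → K⟦X⟧ := fun x => PowerSeries.mk (y x.1 x.2)
  have hF : ∀ x, PowerSeries.map (algebraMap K L) (F x) = f x.1 x.2 := fun x =>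
    PowerSeries.ext fun n => by
      rw [PowerSeries.coeff_map, PowerSeries.coeff_mk, hy]
  -- solve the equation for `σ(f)` and for `f`
  let T := N.frobMatrix b
  let W := N.frobMatrixInv b
  let T' := N'.frobMatrix b'
  let W' := N'.frobMatrixInv b'
  have hσ : f.map P.σ = W'.map P.inclLoc * f * T.map P.inclLoc := by
    rw [Matrix.mul_assoc, ← hf, ← Matrix.mul_assoc,
      map_mul_map_eq_one P.inclLoc (N'.frobMatrixInv_mul b'), Matrix.one_mul]
  have hinv : f = T'.map P.inclLoc * f.map P.σ * W.map P.inclLoc := by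
    rw [hf, Matrix.mul_assoc, map_mul_map_eq_one P.inclLoc (N.frobMatrix_mul_inv b), Matrix.mul_one]
  -- clear the denominators
  obtain ⟨⟨_, e, rfl⟩, he⟩ := IsLocalization.exist_integer_multiples_of_finite
    (Submonoid.powers 𝔇.zSubζ) (S := 𝔇.Rzζ)
    (Sum.elim (fun x : (ι' × ι) × (ι' × ι) => W' x.1.1 x.2.1 * T x.2.2 x.1.2)
      (fun x : (ι' × ι) × (ι' × ι) => T' x.1.1 x.2.1 * W x.2.2 x.1.2))
  choose c hc using fun x z : ι' × ι => he (Sum.inl (x, z))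
  choose d hd using fun x z : ι' × ι => he (Sum.inr (x, z))
  have hincl : ∀ r, P.inclLoc (algebraMap _ 𝔇.Rzζ r) = P.incl r := fun r =>
    DFunLike.congr_fun P.inclLoc_comp r
  have hc' : ∀ x z : ι' × ι, P.incl (c x z) =
      P.incl (𝔇.zSubζ ^ e) * (P.inclLoc (W' x.1 z.1) * P.inclLoc (T z.2 x.2)) := by
    intro x z
    have := congrArg P.inclLoc (hc x z)
    rw [hincl] at this
    rw [this, ← map_mul, ← hincl, ← map_mul]
    exact congrArg _ (Algebra.smul_def _ _)
  have hd' : ∀ x z : ι' × ι, P.incl (d x z) =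
      P.incl (𝔇.zSubζ ^ e) * (P.inclLoc (T' x.1 z.1) * P.inclLoc (W z.2 x.2)) := by
    intro x z
    have := congrArg P.inclLoc (hd x z)
    rw [hincl] at this
    rw [this, ← map_mul, ← hincl, ← map_mul]
    exact congrArg _ (Algebra.smul_def _ _)
  let sub : (IntegerRing K)⟦X⟧ →+* K⟦X⟧ := PowerSeries.map (IntegerRing K).subtype
  have hsub : ∀ r, PowerSeries.map (algebraMap K L) (sub r) = P.incl r := fun r =>
    PowerSeries.ext fun n => by
      rw [PowerSeries.coeff_map, PowerSeries.coeff_map]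
      exact (PowerSeries.coeff_map (toL K L) n r).symm
  have hsubz : sub 𝔇.zSubζ = PowerSeries.X - PowerSeries.C (𝔇.ζ : K) := by
    rw [BaseDatum.zSubζ, map_sub, PowerSeries.map_X, PowerSeries.map_C]; rfl
  have hFσ : ∀ x, PowerSeries.map (algebraMap K L)
      (PowerSeries.map (𝔇.frob (IntegerRing K).subtype) (F x)) = P.σ (f x.1 x.2) := by
    intro x
    rw [← hF]
    refine PowerSeries.ext fun n => ?_
    rw [PowerSeries.coeff_map, PowerSeries.coeff_map]
    refine Eq.trans ?_ (PowerSeries.coeff_map _ _ _).symm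
    rw [PowerSeries.coeff_map]
    exact map_pow _ _ _
  have hKL : Function.Injective (PowerSeries.map (algebraMap K L)) :=
    PowerSeries.map_injective _ (algebraMap K L).injective
  have hgrowth : ∀ r : (IntegerRing K)⟦X⟧, GrowthLE 1 1 (sub r) := fun r n => by
    rw [one_pow, one_mul, PowerSeries.coeff_map]
    exact (PowerSeries.coeff n r).2
  obtain ⟨p, k, hp, hchar, hq⟩ := exists_charP_of_hom 𝔇 (IntegerRing K).subtype
  have : Fact p.Prime := ⟨hp⟩
  have hfam : FrobFamily 𝔇.qhat (𝔇.frob (IntegerRing K).subtype) (𝔇.ζ : K) e F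
      (fun x z => sub (c x z)) (fun x z => sub (d x z)) :=
    { two_le := 𝔇.one_lt_qhat
      pow := fun _ => rfl
      ζ_pos := norm_pos_iff.mpr fun h => 𝔇.ζ_ne_zero (Subtype.ext h)
      ζ_lt := norm_ζ_lt_one 𝔇
      integral_c := fun _ _ => hgrowth _
      integral_d := fun _ _ => hgrowth _
      frob := fun x => hKL (by
        have h1 := congrFun (congrFun hσ x.1) x.2
        rw [← hsubz, ← map_pow, map_mul, hsub, hFσ, map_sum]
        simp only [map_mul, hsub, hF, hc']
        rw [Matrix.map_apply, Matrix.mul_apply] at h1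
        rw [h1, Fintype.sum_prod_type_right, Finset.mul_sum]
        refine Finset.sum_congr rfl fun l _ => ?_
        rw [Matrix.mul_apply, Finset.sum_mul, Finset.mul_sum]
        refine Finset.sum_congr rfl fun m _ => ?_
        rw [Matrix.map_apply, Matrix.map_apply]
        ring)
      inv := fun x => hKL (by
        have h1 := congrFun (congrFun hinv x.1) x.2
        rw [← hsubz, ← map_pow, map_mul, hsub, hF, map_sum]
        simp only [map_mul, hsub, hFσ, hd']
        rw [Matrix.mul_apply] at h1
        rw [h1, Fintype.sum_prod_type_right, Finset.mul_sum]
        refine Finset.sum_congr rfl fun l _ => ?_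
        rw [Matrix.mul_apply, Finset.sum_mul, Finset.mul_sum]
        refine Finset.sum_congr rfl fun m _ => ?_
        rw [Matrix.map_apply, Matrix.map_apply, Matrix.map_apply]
        ring) }
  obtain ⟨δ, hδ, hdisc⟩ := exists_norm_le_of_lt_one (K := K)
  have hint := hfam.norm_coeff_le_one hq hδ hdisc
  refine ⟨Matrix.of fun i j => PowerSeries.mk fun n =>
    ⟨PowerSeries.coeff n (F (i, j)), hint (i, j) n⟩, ?_⟩
  ext1 i j
  rw [Matrix.map_apply, ← hsub, ← hF (i, j)]
  congr 1
  ext n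
  rw [PowerSeries.coeff_map, Matrix.of_apply, PowerSeries.coeff_mk]
  rfl

end Descent

/-! ### Full faithfulness -/
section FullyFaithful

variable {Fq Q K : Type*} [Field Fq] [Finite Fq] [Field Q] [Algebra Fq Q]
  [IsCurveFunctionField Fq Q] [NontriviallyNormedField K] [IsUltrametricDist K]
  {𝔇 : BaseDatum Fq Q K} {N N' : LocalShtuka.{v} 𝔇}

namespace CoeffRing

variable {E G C : Type*} [CommRing E] [Group G] [CommRing C] {P : CoeffRing 𝔇 E G C}

/-- The equation of a morphism may be checked over any ring containing `R⟦z⟧[1/(z-ζ)]`. -/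
theorem comm_of_map_frob (hinj : Function.Injective P.inclLoc)
    (f : N.M →ₗ[(IntegerRing K)⟦X⟧] N'.M)
    (h : ∀ x, P.frob N' (BaseChange.map P.incl f x) = BaseChange.map P.incl f (P.frob N x)) :
    N'.τ.toLinearMap ∘ₗ BaseChange.map 𝔇.loc (BaseChange.map 𝔇.σ f) =
      BaseChange.map 𝔇.loc f ∘ₗ N.τ.toLinearMap := by
  refine (BaseChange.basis 𝔇.loc (BaseChange.basis 𝔇.σ
    (Module.Free.chooseBasis _ N.M))).ext fun j => ?_
  rw [BaseChange.basis_apply, BaseChange.basis_apply]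
  set m := Module.Free.chooseBasis (IntegerRing K)⟦X⟧ N.M j
  apply BaseChange.along_injective (hg := P.inclLoc_comp) hinj
  have h1 := h (BaseChange.mk P.incl m)
  rw [BaseChange.map_mk, frob, LocalShtuka.frob_mk, frob, LocalShtuka.frob_mk,
    BaseChange.map_along] at h1
  rw [LinearMap.comp_apply, LinearMap.comp_apply, BaseChange.map_mk, BaseChange.map_mk]
  exact h1

/-- The equation of a quasi-morphism may be checked over any ring containing
`R((z))[1/(z-ζ)]`. -/
theorem comm_of_extend_frob {r : (IntegerRing K)⸨X⸩ →+* C}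
    (hr : r.comp (BaseDatum.toLaurent (IntegerRing K)) = P.incl)
    (hinj : Function.Injective (liftRzzζ hr))
    (f : BaseChange (BaseDatum.toLaurent (IntegerRing K)) N.M →ₗ[(IntegerRing K)⸨X⸩]
      BaseChange (BaseDatum.toLaurent (IntegerRing K)) N'.M)
    (h : ∀ x, P.frob N' (BaseChange.extend r hr f x) = BaseChange.extend r hr f (P.frob N x))
    (x : BaseChange (BaseDatum.toLaurent (IntegerRing K)) N.M) :
    N'.frobLaurent (f x) = BaseChange.extend 𝔇.laurentToRzzζ rfl f (N.frobLaurent x) := by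
  apply BaseChange.along_injective (hg := liftRzzζ_comp_toRzzζ hr) hinj
  rw [← extend_along_lift hr, ← frob_along hr, ← frob_along hr, ← h, BaseChange.extend_along]

end CoeffRing

variable [CompleteSpace K] (L : Type*) [Field L] [Algebra K L]

theorem tateFunctor_faithful [IsSepClosed L] : (tateFunctor.{v} 𝔇 L).Faithful where
  map_injective {N N'} a a' h := by
    obtain ⟨U, hU⟩ := exists_isFundamental (𝔇 := 𝔇) L
      (Module.Free.chooseBasis (IntegerRing K)⟦X⟧ N.M)
    have h1 : BaseChange.map (tateCoeff 𝔇 L).incl a.f =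
        BaseChange.map (tateCoeff 𝔇 L).incl a'.f := by
      refine CoeffRing.eq_of_eqOn_solutions hU.basis hU.frob_basis fun x hx => ?_
      exact congrArg Subtype.val
        (congrArg (fun φ => φ.hom (⟨x, hx⟩ : (tateCoeff 𝔇 L).solutions N)) h)
    exact LocalShtuka.Hom.ext (BaseChange.map_injective (tateCoeff_incl_injective 𝔇 L) h1)

theorem rationalTateFunctor_faithful [IsSepClosed L] :
    (rationalTateFunctor.{v} 𝔇 L).Faithful where
  map_injective {N N'} a a' h := by
    obtain ⟨U, hU⟩ := exists_isFundamental (𝔇 := 𝔇) L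
      (Module.Free.chooseBasis (IntegerRing K)⟦X⟧ N.obj.M)
    have h1 : BaseChange.extend _ (rationalCoeff_incl 𝔇 L) a.f =
        BaseChange.extend _ (rationalCoeff_incl 𝔇 L) a'.f := by
      refine CoeffRing.eq_of_eqOn_solutions hU.rational.basis hU.rational.frob_basis fun x hx => ?_
      exact congrArg Subtype.val
        (congrArg (fun φ => φ.hom (⟨x, hx⟩ : (rationalCoeff 𝔇 L).solutions N.obj)) h)
    exact LocalShtuka.QuasiHom.ext
      (BaseChange.extend_injective (laurentMap_injective (toL_injective L)) h1)

theorem tateFunctor_full [IsDiscreteValuationRing (IntegerRing K)] [IsSepClosed L] [IsGalois K L] :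
    (tateFunctor.{v} 𝔇 L).Full where
  map_surjective {N N'} φ := by
    let b := Module.Free.chooseBasis (IntegerRing K)⟦X⟧ N.M
    let b' := Module.Free.chooseBasis (IntegerRing K)⟦X⟧ N'.M
    obtain ⟨U, hU⟩ := exists_isFundamental (𝔇 := 𝔇) L b
    obtain ⟨Φ, hfrob, hgal, hΦ⟩ := CoeffRing.exists_linear_extension (tateCoeff_fixedRing 𝔇 L)
      hU.basis hU.frob_basis φ.hom.toLinearMap fun g x => Rep.hom_comm_apply φ g x
    obtain ⟨f₀, hf₀⟩ := exists_integral_matrix b b'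
      (LinearMap.toMatrix (BaseChange.basis (tateCoeff 𝔇 L).incl b)
        (BaseChange.basis (tateCoeff 𝔇 L).incl b') Φ)
      (fun g => CoeffRing.act_toMatrix b b' Φ g (hgal g))
      (CoeffRing.toMatrix_frob b b' Φ hfrob)
    let f := Matrix.toLin b b' f₀
    have hf : BaseChange.map (tateCoeff 𝔇 L).incl f = Φ := by
      refine (BaseChange.basis (tateCoeff 𝔇 L).incl b).ext fun j =>
        (BaseChange.basis (tateCoeff 𝔇 L).incl b').ext_elem fun i => ?_
      have h1 := congrFun (congrFun hf₀ i) j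
      rw [Matrix.map_apply, LinearMap.toMatrix_apply] at h1
      rw [← h1, BaseChange.basis_apply, BaseChange.map_mk, BaseChange.repr_mk, Matrix.toLin_self,
        Module.Basis.repr_sum_self]
    refine ⟨⟨f, CoeffRing.comm_of_map_frob (tateCoeff_inclLoc_injective 𝔇 L) f fun x => ?_⟩, ?_⟩
    · rw [hf]; exact hfrob x
    · refine Rep.hom_ext (Representation.IntertwiningMap.ext
        (LinearMap.ext fun x => Subtype.ext ?_))
      exact (LinearMap.congr_fun hf _).trans (hΦ x)

theorem rationalTateFunctor_full [IsDiscreteValuationRing (IntegerRing K)] [IsSepClosed L]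
    [IsGalois K L] : (rationalTateFunctor.{v} 𝔇 L).Full where
  map_surjective {N N'} φ := by
    let b := Module.Free.chooseBasis (IntegerRing K)⟦X⟧ N.obj.M
    let b' := Module.Free.chooseBasis (IntegerRing K)⟦X⟧ N'.obj.M
    obtain ⟨U, hU⟩ := exists_isFundamental (𝔇 := 𝔇) L b
    replace hU := hU.rational
    obtain ⟨Φ, hfrob, hgal, hΦ⟩ := CoeffRing.exists_linear_extension (rationalCoeff_fixedRing 𝔇 L)
      hU.basis hU.frob_basis φ.hom.toLinearMap fun g x => Rep.hom_comm_apply φ g x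
    set A := LinearMap.toMatrix (BaseChange.basis (rationalCoeff 𝔇 L).incl b)
      (BaseChange.basis (rationalCoeff 𝔇 L).incl b') Φ with hA
    have hAgal : ∀ g i j, (rationalCoeff 𝔇 L).act g (A i j) = A i j := fun g =>
      CoeffRing.act_toMatrix b b' Φ g (hgal g)
    have hAfrob := CoeffRing.toMatrix_frob b b' Φ hfrob
    rw [← hA] at hAfrob
    -- clear the powers of `z` in the denominators
    obtain ⟨⟨_, n, rfl⟩, hn⟩ := IsLocalization.exist_integer_multiples_of_finite
      (Submonoid.powers (PowerSeries.X : L⟦X⟧)) (S := L⸨X⸩)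
      (fun x : Module.Free.ChooseBasisIndex (IntegerRing K)⟦X⟧ N'.obj.M ×
        Module.Free.ChooseBasisIndex (IntegerRing K)⟦X⟧ N.obj.M => A x.1 x.2)
    choose a ha using hn
    let ξ : L⸨X⸩ := algebraMap L⟦X⟧ L⸨X⸩ (PowerSeries.X ^ n)
    have hξ : IsUnit ξ := by
      simp only [ξ, map_pow]; exact (isUnit_laurent_X L).pow n
    have ha' : ∀ i j, algebraMap L⟦X⟧ L⸨X⸩ (a (i, j)) = ξ * A i j := fun i j =>
      (ha (i, j)).trans (Algebra.smul_def _ _)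
    have hξact : ∀ g, (rationalCoeff 𝔇 L).act g ξ = ξ := fun g => by
      rw [rationalCoeff_act_algebraMap, map_pow, tateCoeff_act_X]
    have hξσ : (rationalCoeff 𝔇 L).σ ξ = ξ := by
      rw [rationalCoeff_σ_algebraMap, map_pow, tateCoeff_σ_X]
    obtain ⟨f₀, hf₀⟩ := exists_integral_matrix (𝔇 := 𝔇) b b' (Matrix.of fun i j => a (i, j))
      (fun g i j => powerSeries_injective_laurent L (by
        rw [Matrix.of_apply, ← rationalCoeff_act_algebraMap, ha', map_mul, hξact, hAgal]))
      (by
        ext1 i j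
        apply powerSeries_injective_laurent L
        have h1 := congrFun (congrFun hAfrob i) j
        rw [Matrix.mul_apply, Matrix.mul_apply] at h1 ⊢
        simp only [Matrix.map_apply, Matrix.of_apply, map_sum, map_mul,
          ← rationalCoeff_σ_algebraMap, ha'] at h1 ⊢
        rw [hξσ]
        have h2 := congrArg (ξ * ·) h1
        simp only [Finset.mul_sum] at h2
        refine Eq.trans (Finset.sum_congr rfl fun l _ => ?_)
          (h2.trans (Finset.sum_congr rfl fun l _ => ?_))
        · exact mul_left_comm _ _ _
        · exact (mul_assoc _ _ _).symm)
    let xn : Submonoid.powers (PowerSeries.X : (IntegerRing K)⟦X⟧) := ⟨PowerSeries.X ^ n, n, rfl⟩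
    let f := Matrix.toLin (BaseChange.basis (BaseDatum.toLaurent (IntegerRing K)) b)
      (BaseChange.basis (BaseDatum.toLaurent (IntegerRing K)) b')
      (Matrix.of fun i j => IsLocalization.mk' (IntegerRing K)⸨X⸩ (f₀ i j) xn)
    have hf : BaseChange.extend _ (rationalCoeff_incl 𝔇 L) f = Φ := by
      refine (BaseChange.basis (rationalCoeff 𝔇 L).incl b).ext fun j =>
        (BaseChange.basis (rationalCoeff 𝔇 L).incl b').ext_elem fun i => hξ.mul_left_cancel ?_
      have h1 : (BaseChange.basis (rationalCoeff 𝔇 L).incl b').repr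
          (Φ (BaseChange.basis (rationalCoeff 𝔇 L).incl b j)) i = A i j := by
        rw [hA, LinearMap.toMatrix_apply]
      have h2 := congrFun (congrFun hf₀ i) j
      rw [Matrix.map_apply, Matrix.of_apply] at h2
      rw [h1, ← ha', ← h2, BaseChange.basis_apply, BaseChange.extend_mk, BaseChange.repr_along,
        ← BaseChange.basis_apply, Matrix.toLin_self, Module.Basis.repr_sum_self, Matrix.of_apply]
      have h3 : ξ = laurentMap (toL K L)
          (algebraMap (IntegerRing K)⟦X⟧ (IntegerRing K)⸨X⸩ xn) := by
        rw [laurentMap_algebraMap]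
        simp only [ξ, xn, map_pow, PowerSeries.map_X]
      rw [h3, ← map_mul, mul_comm, IsLocalization.mk'_spec, laurentMap_algebraMap]
      rfl
    refine ⟨⟨f, CoeffRing.comm_of_extend_frob (rationalCoeff_incl 𝔇 L) (liftRzzζ_injective 𝔇 L) f
      fun x => ?_⟩, ?_⟩
    · rw [hf]; exact hfrob x
    · refine Rep.hom_ext (Representation.IntertwiningMap.ext
        (LinearMap.ext fun x => Subtype.ext ?_))
      exact (LinearMap.congr_fun hf _).trans (hΦ x)

end FullyFaithful

/-! ### Continuity of the Galois representations -/
section Continuity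

variable {Fq Q K : Type*} [Field Fq] [Finite Fq] [Field Q] [Algebra Fq Q]
  [IsCurveFunctionField Fq Q] [NontriviallyNormedField K] [IsUltrametricDist K]
  {𝔇 : BaseDatum Fq Q K} {N : LocalShtuka.{v} 𝔇} [CompleteSpace K] {L : Type*} [Field L]
  [Algebra K L] {ι : Type*} [Fintype ι] [DecidableEq ι]

/-- An automorphism acts on the Tate module trivially modulo `z ^ n` as soon as it fixes the
coefficients up to `z ^ n` of a fundamental matrix. -/
theorem isOpen_toMatrix_congruence [Algebra.IsAlgebraic K L]
    {b : Module.Basis ι (IntegerRing K)⟦X⟧ N.M} {U : Matrix ι ι L⟦X⟧}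
    (hU : (tateCoeff 𝔇 L).IsFundamental b U) (n : ℕ) :
    IsOpen {g : L ≃ₐ[K] L | ∀ i j, (PowerSeries.X : 𝔇.𝔽ε⟦X⟧) ^ n ∣
      LinearMap.toMatrix (hU.solBasis (tateCoeff_fixedRing 𝔇 L))
        (hU.solBasis (tateCoeff_fixedRing 𝔇 L)) ((tateCoeff 𝔇 L).ρ N g) i j -
          (1 : Matrix ι ι 𝔇.𝔽ε⟦X⟧) i j} := by
  have hset : {g : L ≃ₐ[K] L | ∀ i j, (PowerSeries.X : 𝔇.𝔽ε⟦X⟧) ^ n ∣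
      LinearMap.toMatrix (hU.solBasis (tateCoeff_fixedRing 𝔇 L))
        (hU.solBasis (tateCoeff_fixedRing 𝔇 L)) ((tateCoeff 𝔇 L).ρ N g) i j -
          (1 : Matrix ι ι 𝔇.𝔽ε⟦X⟧) i j} =
      ⋂ (i : ι) (j : ι) (m : Fin n), {g : L ≃ₐ[K] L |
        g (PowerSeries.coeff m (U i j)) = PowerSeries.coeff m (U i j)} := by
    ext g
    have hact := hU.map_act (tateCoeff_fixedRing 𝔇 L) g
    set D := LinearMap.toMatrix (hU.solBasis (tateCoeff_fixedRing 𝔇 L))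
        (hU.solBasis (tateCoeff_fixedRing 𝔇 L)) ((tateCoeff 𝔇 L).ρ N g)
    set P := tateCoeff 𝔇 L
    have hsub : U.map (P.act g) - U = U * (D - 1).map P.coeff := by
      have h1 : (D - 1).map P.coeff = D.map P.coeff - 1 := by
        rw [Matrix.map_sub _ (map_sub _), Matrix.map_one _ (map_zero _) (map_one _)]
      rw [h1, Matrix.mul_sub, ← hact, Matrix.mul_one]
    have hdvd : ∀ d : 𝔇.𝔽ε⟦X⟧, (PowerSeries.X : L⟦X⟧) ^ n ∣ P.coeff d ↔
        (PowerSeries.X : 𝔇.𝔽ε⟦X⟧) ^ n ∣ d := by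
      intro d
      rw [PowerSeries.X_pow_dvd_iff, PowerSeries.X_pow_dvd_iff]
      refine forall₂_congr fun m _ => ?_
      have : PowerSeries.coeff m (P.coeff d) = teichL 𝔇 L (PowerSeries.coeff m d) :=
        PowerSeries.coeff_map _ _ _
      rw [this]
      exact map_eq_zero_iff (teichL 𝔇 L) (teichL 𝔇 L).injective
    have hiff : (∀ i j, (PowerSeries.X : 𝔇.𝔽ε⟦X⟧) ^ n ∣ D i j - (1 : Matrix ι ι 𝔇.𝔽ε⟦X⟧) i j) ↔
        ∀ i j, (PowerSeries.X : L⟦X⟧) ^ n ∣ P.act g (U i j) - U i j := by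
      constructor
      · intro h i j
        have h1 := congrFun (congrFun hsub i) j
        rw [Matrix.sub_apply, Matrix.map_apply, Matrix.mul_apply] at h1
        rw [h1]
        exact Finset.dvd_sum fun l _ => Dvd.dvd.mul_left ((hdvd _).mpr (h l j)) _
      · intro h i j
        rw [← Matrix.sub_apply, ← hdvd]
        have h1 : U⁻¹ * (U.map (P.act g) - U) = (D - 1).map P.coeff := by
          rw [hsub, ← Matrix.mul_assoc,
            Matrix.nonsing_inv_mul _ ((Matrix.isUnit_iff_isUnit_det _).mp hU.isUnit),
            Matrix.one_mul]
        rw [← Matrix.map_apply (f := P.coeff), ← h1, Matrix.mul_apply]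
        exact Finset.dvd_sum fun l _ => Dvd.dvd.mul_left (h l j) _
    simp only [Set.mem_ofPred_eq, Set.mem_iInter]
    rw [hiff]
    refine forall₂_congr fun i j => ?_
    rw [PowerSeries.X_pow_dvd_iff]
    have hc : ∀ m, PowerSeries.coeff m (P.act g (U i j)) = g (PowerSeries.coeff m (U i j)) :=
      fun m => PowerSeries.coeff_map _ _ _
    constructor
    · intro h m
      have := h m m.2
      rwa [map_sub, hc, sub_eq_zero] at this
    · intro h m hm
      rw [map_sub, hc, sub_eq_zero]
      exact h ⟨m, hm⟩
  rw [hset]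
  exact isOpen_iInter_of_finite fun i => isOpen_iInter_of_finite fun j =>
    isOpen_iInter_of_finite fun m => stabilizer_isOpen_of_isIntegral _

theorem isContFiniteFree_tateFunctor [IsSepClosed L] [Algebra.IsAlgebraic K L]
    (N : LocalShtuka.{v} 𝔇) :
    IsContFiniteFree 𝔇.𝔽ε (L ≃ₐ[K] L) ((tateFunctor 𝔇 L).obj N) := by
  obtain ⟨U, hU⟩ := exists_isFundamental (𝔇 := 𝔇) L
    (Module.Free.chooseBasis (IntegerRing K)⟦X⟧ N.M)
  classical
  let s := hU.solBasis (tateCoeff_fixedRing 𝔇 L)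
  refine ⟨Module.Finite.of_basis s, Module.Free.of_basis s, fun n => ?_⟩
  convert isOpen_toMatrix_congruence hU n using 1
  ext g
  have hD : ∀ i j, LinearMap.toMatrix s s ((tateCoeff 𝔇 L).ρ N g) i j -
      (1 : Matrix _ _ 𝔇.𝔽ε⟦X⟧) i j =
      s.repr ((tateCoeff 𝔇 L).ρ N g (s j) - s j) i := by
    intro i j
    rw [LinearMap.toMatrix_apply, map_sub, Finsupp.sub_apply, s.repr_self, Finsupp.single_apply,
      Matrix.one_apply]
    simp only [eq_comm]
  change (∀ v : (tateCoeff 𝔇 L).solutions N, ∃ w : (tateCoeff 𝔇 L).solutions N,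
      (tateCoeff 𝔇 L).ρ N g v - v = (PowerSeries.X : 𝔇.𝔽ε⟦X⟧) ^ n • w) ↔ ∀ i j, _ ∣
      LinearMap.toMatrix s s ((tateCoeff 𝔇 L).ρ N g) i j - (1 : Matrix _ _ 𝔇.𝔽ε⟦X⟧) i j
  simp only [hD]
  constructor
  · intro h i j
    obtain ⟨w, hw⟩ := h (s j)
    rw [hw, map_smul, Finsupp.smul_apply]
    exact ⟨_, rfl⟩
  · intro h v
    choose c hc using h
    refine ⟨∑ j, s.repr v j • ∑ i, c i j • s i, ?_⟩
    have h1 : ∀ j, (tateCoeff 𝔇 L).ρ N g (s j) - s j =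
        (PowerSeries.X : 𝔇.𝔽ε⟦X⟧) ^ n • ∑ i, c i j • s i := by
      intro j
      rw [← s.sum_repr ((tateCoeff 𝔇 L).ρ N g (s j) - s j), Finset.smul_sum]
      simp only [hc, mul_smul]
    have h2 : (tateCoeff 𝔇 L).ρ N g v - v =
        ∑ j, s.repr v j • ((tateCoeff 𝔇 L).ρ N g (s j) - s j) := by
      simp only [smul_sub, Finset.sum_sub_distrib, s.sum_repr]
      conv_lhs => rw [← s.sum_repr v, map_sum]
      simp only [map_smul, s.sum_repr]
    rw [h2, Finset.smul_sum]
    simp only [h1, smul_comm ((PowerSeries.X : 𝔇.𝔽ε⟦X⟧) ^ n)]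

theorem isContFiniteDim_rationalTateFunctor [IsSepClosed L] [Algebra.IsAlgebraic K L]
    (N : QuasiLocalShtuka.{v} 𝔇) :
    IsContFiniteDim 𝔇.𝔽ε (L ≃ₐ[K] L) ((rationalTateFunctor 𝔇 L).obj N) := by
  classical
  let b := Module.finBasis (IntegerRing K)⟦X⟧ N.obj.M
  obtain ⟨U, hU⟩ := exists_isFundamental (𝔇 := 𝔇) L b
  let s := hU.rational.solBasis (rationalCoeff_fixedRing 𝔇 L)
  refine ⟨_, s, fun n => ?_⟩
  convert isOpen_toMatrix_congruence hU n using 1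
  ext g
  have hact := hU.map_act (tateCoeff_fixedRing 𝔇 L) g
  have hact' := hU.rational.map_act (rationalCoeff_fixedRing 𝔇 L) g
  set D := LinearMap.toMatrix (hU.solBasis (tateCoeff_fixedRing 𝔇 L))
    (hU.solBasis (tateCoeff_fixedRing 𝔇 L)) ((tateCoeff 𝔇 L).ρ N.obj g)
  -- both matrices are `U⁻¹ g(U)`
  have hDD : LinearMap.toMatrix s s ((rationalCoeff 𝔇 L).ρ N.obj g) =
      D.map (algebraMap 𝔇.Aε 𝔇.Qε) := by
    have h1 : (D.map (algebraMap 𝔇.Aε 𝔇.Qε)).map (rationalCoeff 𝔇 L).coeff =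
        (D.map (tateCoeff 𝔇 L).coeff).map (algebraMap L⟦X⟧ L⸨X⸩) := by
      ext1 i j
      exact rationalCoeff_coeff_algebraMap 𝔇 L _
    have h2 : (U.map (algebraMap L⟦X⟧ L⸨X⸩)).map ((rationalCoeff 𝔇 L).act g) =
        (U.map ((tateCoeff 𝔇 L).act g)).map (algebraMap L⟦X⟧ L⸨X⸩) := by
      ext1 i j
      exact rationalCoeff_act_algebraMap 𝔇 L g _
    rw [h2, hact, Matrix.map_mul, ← h1] at hact'
    have h3 := hU.rational.isUnit.mul_left_cancel hact'
    exact (Matrix.map_injective (rationalCoeff_fixedRing 𝔇 L).injective h3).symm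
  have hD : ∀ i j, s.repr ((rationalCoeff 𝔇 L).ρ N.obj g (s j) - s j) i =
      algebraMap 𝔇.Aε 𝔇.Qε (D i j - (1 : Matrix _ _ 𝔇.𝔽ε⟦X⟧) i j) := by
    intro i j
    have h1 := congrFun (congrFun hDD i) j
    rw [LinearMap.toMatrix_apply, Matrix.map_apply] at h1
    rw [map_sub, Finsupp.sub_apply, s.repr_self, Finsupp.single_apply, map_sub, h1,
      Matrix.one_apply, apply_ite (algebraMap 𝔇.Aε 𝔇.Qε), map_one, map_zero]
    simp only [eq_comm]
  change (∀ i j, ∃ c : 𝔇.𝔽ε⟦X⟧, s.repr ((rationalCoeff 𝔇 L).ρ N.obj g (s j) - s j) i =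
    algebraMap 𝔇.Aε 𝔇.Qε (PowerSeries.X ^ n * c)) ↔ ∀ i j, _ ∣ D i j - (1 : Matrix _ _ 𝔇.𝔽ε⟦X⟧) i j
  simp only [hD]
  refine forall₂_congr fun i j => exists_congr fun c => ?_
  exact (IsFractionRing.injective 𝔇.Aε 𝔇.Qε).eq_iff

end Continuity

end LocSht

theorem mainTheorem1 {Fq Q K Ksep : Type*} [Field Fq] [Finite Fq] [Field Q] [Algebra Fq Q]
    [LocSht.IsCurveFunctionField Fq Q] [NontriviallyNormedField K] [IsUltrametricDist K]
    [CompleteSpace K] [IsDiscreteValuationRing (LocSht.IntegerRing K)]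
    [Field Ksep] [Algebra K Ksep] [IsSepClosure K Ksep] (𝔇 : LocSht.BaseDatum Fq Q K) :
    (∃ hT : ∀ N : LocSht.LocalShtuka 𝔇,
        LocSht.IsContFiniteFree 𝔇.𝔽ε (Ksep ≃ₐ[K] Ksep) ((LocSht.tateFunctor 𝔇 Ksep).obj N),
      (ObjectProperty.lift _ (LocSht.tateFunctor 𝔇 Ksep) hT).Full ∧
      (ObjectProperty.lift _ (LocSht.tateFunctor 𝔇 Ksep) hT).Faithful) ∧
    (∃ hV : ∀ N : LocSht.QuasiLocalShtuka 𝔇,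
        LocSht.IsContFiniteDim 𝔇.𝔽ε (Ksep ≃ₐ[K] Ksep)
          ((LocSht.rationalTateFunctor 𝔇 Ksep).obj N),
      (ObjectProperty.lift _ (LocSht.rationalTateFunctor 𝔇 Ksep) hV).Full ∧
      (ObjectProperty.lift _ (LocSht.rationalTateFunctor 𝔇 Ksep) hV).Faithful) := by
  have : IsSepClosed Ksep := IsSepClosure.sep_closed K
  have hT := LocSht.tateFunctor_full (𝔇 := 𝔇) Ksep
  have hT' := LocSht.tateFunctor_faithful (𝔇 := 𝔇) Ksep
  have hV := LocSht.rationalTateFunctor_full (𝔇 := 𝔇) Ksep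
  have hV' := LocSht.rationalTateFunctor_faithful (𝔇 := 𝔇) Ksep
  exact ⟨⟨LocSht.isContFiniteFree_tateFunctor, inferInstance, inferInstance⟩,
    ⟨LocSht.isContFiniteDim_rationalTateFunctor, inferInstance, inferInstance⟩⟩
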